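/- Let $\mathbb T=\mathbb R/\mathbb Z$, let $\mu,\lambda>0$, let $h\in C^\infty(\mathbb T;\mathbb R)$ have mean zero, and let $M\ge 2$ be an integer. Functions on $\mathbb T\times\mathbb R$ are written $f(\theta,y)$; $\|f\|_{H^m}=\sum_{|\alpha|\le m}\|\partial^\alpha f\|_{L^2(\mathbb T\times\mathbb R)}$, $H^\infty=\bigcap_m H^m(\mathbb T\times\mathbb R)$, $\mathcal H_T^\infty=C^\infty([0,T];H^\infty)$, and $\mathcal E_\delta^\infty$ is the set of $f:[0,\infty[\to H^\infty$ with $\sup_{\tau\ge0}e^{\delta\tau}\|f(\tau)\|_{H^m}<\infty$ for every $m$. Let $\Pi f(y)=\int_{\mathbb T}f(\theta,y)\,d\theta$, and let $\partial_\theta^{-1}h$ be the primitive of $h$ of mean zero. For $v=(v^1,v^2)$ and $\varepsilon\in\,]0,1]$ put $$\mathcal L_1^a(\varepsilon,v)=\partial_tv^1+\tfrac1\varepsilon h\,\partial_yv^1+\varepsilon^{M-2}\bigl(v^1\partial_\theta v^1+\varepsilon v^2\partial_yv^1\bigr)-\tfrac1{\varepsilon^2}\Bigl(\mu(\partial_{\theta\theta}v^1+\varepsilon^2\partial_{yy}v^1)+\lambda\varepsilon(\partial_{\theta\theta}v^1+\varepsilon\partial_{\theta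 y}v^2)\Bigr),$$ $$\mathcal L_2^a(\varepsilon,v)=\partial_tv^2+\tfrac1\varepsilon h\,\partial_yv^2+\tfrac1{\varepsilon^2}h'\,v^1+\varepsilon^{M-2}\bigl(v^1\partial_\theta v^2+\varepsilon v^2\partial_yv^2\bigr)-\tfrac1{\varepsilon^2}\Bigl(\mu(\partial_{\theta\theta}v^2+\varepsilon^2\partial_{yy}v^2)+\lambda\varepsilon(\varepsilon\partial_{\theta y}v^1+\varepsilon^2\partial_{yy}v^2)\Bigr).$$ There are maps $S_0,S_1,S_2,\dots$, where $S_k$ takes as arguments $k$ profiles (functions of $(t,\theta,y)$, $t\ge0$, with values in $\mathbb R^2$) and returns a function of $(t,y)$ with values in $\mathbb R^2$, such that the following holds for every $N\in\mathbb N$, every $\delta\in\,]0,\mu[$ and all $v_0^0,\dots,v_{N+1}^0\in H^\infty(\mathbb T\times\mathbb R;\mathbb R^2)$. There are slow profiles $v_k^s\in\bigcap_{T>0}\mathcal H_T^\infty$ and fast profiles $v_k^f\in\mathcal E_\delta^\infty$, of class $C^1$ in time with values in $H^\infty$ ($0\le k\le N+1$), such that $$v_\varepsilon^a(t,\theta,y)=\sum_{k=0}^{N+1}\varepsilon^k\bigl(v_k^s(t,\theta,y)+v_k^f(t/\varepsilon^2,\theta,y)\bigr)$$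 satisfies: i) $v_\varepsilon^a(0,\cdot)=\sum_{k=0}^{N+1}\varepsilon^kv_k^0$ for all $\varepsilon\in\,]0,1]$. ii) For every $T>0$ and $j\in\{1,2\}$, $\mathcal L_j^a(\varepsilon,v_\varepsilon^a)\in C([0,T];H^\infty)$ for each $\varepsilon\in\,]0,1]$, and for every $m\in\mathbb N$ $$\sup_{\varepsilon\in]0,1]}\ \sup_{t\in[0,T]}\ \max_{j\in\{1,2\}}\bigl\|\varepsilon^{-N}\mathcal L_j^a(\varepsilon,v_\varepsilon^a)(t)\bigr\|_{H^m(\mathbb T\times\mathbb R)}<+\infty .$$ iii) For $0\le k\le N+1$ the mean $\Pi v_k^s$ solves on $t\ge0$, $y\in\mathbb R$ $$\partial_t\Pi v_k^s-\Bigl(\mu+\tfrac1\mu\,\Pi\bigl((\partial_\theta^{-1}h)^2\bigr)\Bigr)\partial_{yy}\Pi v_k^s=S_k(v_0^s,\dots,v_{k-1}^s),$$ and, for each component, it is determined by this equation and its value at $t=0$: every solution that is $C^1$ in time with values in $H^\infty$ and has the same value at $t=0$ coincides with it. -/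

import Mathlib

open Set Filter Topology MeasureTheory
open scoped ENNReal NNReal ContDiff

namespace OscFlow

noncomputable section

/-- A real function on the cylinder `𝕋 × ℝ`, with `𝕋 = ℝ/ℤ`, written as a function of `(θ, y)` on
`ℝ × ℝ`; the 1-periodicity in `θ` is part of the membership predicates below. -/
abbrev Cyl := ℝ → ℝ → ℝ

/-- `∂_θ`. -/
def dTheta (f : Cyl) : Cyl := fun θ y => deriv (fun s => f s y) θ

/-- `∂_y`. -/
def dY (f : Cyl) : Cyl := fun θ y => deriv (fun s => f θ s) y

/-- `∂^α = ∂_θ^a ∂_y^b` for `α = (a, b)`. -/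
def dMulti (a b : ℕ) (f : Cyl) : Cyl := dTheta^[a] (dY^[b] f)

/-- Lebesgue measure on `𝕋 × ℝ`, on the fundamental domain `]0,1] × ℝ`. -/
def cylMeasure : Measure (ℝ × ℝ) := ((volume : Measure ℝ).restrict (Ioc 0 1)).prod volume

/-- The Sobolev norm `‖f‖_{H^m} = ∑_{k ≤ m} ∑_{|α| = k} ‖∂^α f‖_{L²(𝕋 × ℝ)}`, with values in
`[0, ∞]`. It is only applied to smooth functions. -/
def hNorm (m : ℕ) (f : Cyl) : ℝ≥0∞ :=
  ∑ k ∈ Finset.range (m + 1), ∑ α ∈ Finset.HasAntidiagonal.antidiagonal k,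
    eLpNorm (fun p : ℝ × ℝ => dMulti α.1 α.2 f p.1 p.2) 2 cylMeasure

/-- `H^∞(𝕋 × ℝ) = ⋂_m H^m(𝕋 × ℝ)`: by Sobolev embedding its elements are (represented by) the
smooth functions on `𝕋 × ℝ` all of whose derivatives are square integrable. -/
structure MemHInf (f : Cyl) : Prop where
  periodic : ∀ θ y, f (θ + 1) y = f θ y
  smooth : ContDiff ℝ ∞ (fun p : ℝ × ℝ => f p.1 p.2)
  memLp : ∀ a b : ℕ, MemLp (fun p : ℝ × ℝ => dMulti a b f p.1 p.2) 2 cylMeasure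

/-- `f ∈ C^n([0,T]; H^∞(𝕋 × ℝ))`, that is, `f ∈ C^n([0,T]; H^m)` for every `m`: there are curves
`F 0 = f, F 1, …` in `H^∞`, continuous on `[0,T]` in every `H^m` norm, such that `F (j + 1)` is
the derivative of `F j` in every `H^m` norm (one-sided at the end points).
For `n = ⊤` this is the space `𝓗_T^∞ = ⋂_m ⋂_{j ≤ m} C^j([0,T]; H^{m-j})`, for `n = 0` it is
`𝓗_T^{∞,0} = ⋂_m C^0([0,T]; H^m)`. -/
def MemHT (n : ℕ∞) (T : ℝ) (f : ℝ → Cyl) : Prop :=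
  ∃ F : ℕ → ℝ → Cyl,
    (∀ t ∈ Icc 0 T, F 0 t = f t) ∧
    (∀ j : ℕ, (j : ℕ∞) ≤ n → ∀ t ∈ Icc 0 T, MemHInf (F j t) ∧
      ∀ m : ℕ, Tendsto (fun s => hNorm m (F j s - F j t)) (𝓝[Icc 0 T] t) (𝓝 0)) ∧
    (∀ j : ℕ, (j : ℕ∞) < n → ∀ t ∈ Icc 0 T, ∀ m : ℕ,
      Tendsto (fun s => hNorm m ((s - t)⁻¹ • (F j s - F j t) - F (j + 1) t))
        (𝓝[Icc 0 T \ {t}] t) (𝓝 0))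

/-- `f ∈ 𝓔_δ^∞`: every `H^m` norm of `f(t)` is `O(e^{-δt})` on `[0, ∞[`. -/
def MemE (δ : ℝ) (f : ℝ → Cyl) : Prop :=
  (∀ t, 0 ≤ t → MemHInf (f t)) ∧
  ∀ m : ℕ, (⨆ t ∈ Ici (0 : ℝ), ENNReal.ofReal (Real.exp (δ * t)) * hNorm m (f t)) < ⊤

/-- The mean `Π f (y) = ∫_𝕋 f(θ, y) dθ`. -/
def mean (f : Cyl) : ℝ → ℝ := fun y => ∫ θ in (0 : ℝ)..1, f θ y

/-- `∂_θ^{-1} u`, the primitive of mean zero of a function `u` of mean zero on `𝕋`. -/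
def primitive (u : ℝ → ℝ) : ℝ → ℝ := fun θ =>
  (∫ s in (0 : ℝ)..θ, u s) - ∫ r in (0 : ℝ)..1, ∫ s in (0 : ℝ)..r, u s

/-- The enhanced viscosity `μ + μ⁻¹ Π((∂_θ^{-1} h)²)`. -/
def enhancedViscosity (μ : ℝ) (h : ℝ → ℝ) : ℝ :=
  μ + μ⁻¹ * ∫ θ in (0 : ℝ)..1, primitive h θ ^ 2

/-- The time derivative on `[0, ∞[` (one-sided at `t = 0`). -/
def dT (g : ℝ → ℝ) (t : ℝ) : ℝ := derivWithin g (Ici 0) t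

/-- The two components of the rescaled dissipation `P̃_ε u`. The components `u¹, u²` are `u 0, u 1`. -/
def dissipation (μ lam ε : ℝ) (u : Fin 2 → Cyl) : Fin 2 → Cyl :=
  ![fun θ y => (ε ^ 2)⁻¹ *
      (μ * (dTheta (dTheta (u 0)) θ y + ε ^ 2 * dY (dY (u 0)) θ y)
        + lam * ε * (dTheta (dTheta (u 0)) θ y + ε * dTheta (dY (u 1)) θ y)),
    fun θ y => (ε ^ 2)⁻¹ *
      (μ * (dTheta (dTheta (u 1)) θ y + ε ^ 2 * dY (dY (u 1)) θ y)
        + lam * ε * (ε * dTheta (dY (u 0)) θ y + ε ^ 2 * dY (dY (u 1)) θ y))]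

/-- The singular zeroth order term `ε⁻² ᵗ(0, ∂_θ h v¹)`. -/
def shearTerm (h : ℝ → ℝ) (ε : ℝ) (u : Fin 2 → Cyl) : Fin 2 → Cyl :=
  ![fun _ _ => 0, fun θ y => (ε ^ 2)⁻¹ * deriv h θ * u 0 θ y]

/-- The velocity operators `L^a_1` (`j = 0`) and `L^a_2` (`j = 1`) applied to `v = (v¹, v²)`:
`∂_t v^j + ε⁻¹ h ∂_y v^j + ε⁻² (0, h' v¹)_j + ε^{M-2} (v¹ ∂_θ v^j + ε v² ∂_y v^j) - (P̃_ε v)_j`. -/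
def La (μ lam : ℝ) (h : ℝ → ℝ) (M : ℕ) (ε : ℝ) (v : Fin 2 → ℝ → Cyl) (j : Fin 2) : ℝ → Cyl :=
  fun t θ y =>
    dT (fun s => v j s θ y) t
      + ε⁻¹ * h θ * dY (v j t) θ y
      + shearTerm h ε (fun i => v i t) j θ y
      + ε ^ ((M : ℤ) - 2) *
          (v 0 t θ y * dTheta (v j t) θ y + ε * v 1 t θ y * dY (v j t) θ y)
      - dissipation μ lam ε (fun i => v i t) j θ y

/-- `v^a_ε(t) = ∑_{k=0}^{N+1} ε^k (v_k^s(t) + v_k^f(t/ε²))`. -/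
def approxVelocity (N : ℕ) (vs vf : ℕ → Fin 2 → ℝ → Cyl) (ε : ℝ) : Fin 2 → ℝ → Cyl :=
  fun j t θ y => ∑ k ∈ Finset.range (N + 2), ε ^ k * (vs k j t θ y + vf k j (t / ε ^ 2) θ y)

/-- `w(t, y)` solves `∂_t w - ν ∂_{yy} w = S` for `t ≥ 0`, `y ∈ ℝ`. -/
def SolvesHeat (ν : ℝ) (S : ℝ≥0 → ℝ → ℝ) (w : ℝ → ℝ → ℝ) : Prop :=
  ∀ (t : ℝ≥0) (y : ℝ),
    dT (fun s => w s y) t - ν * deriv (fun x => deriv (fun z => w t z) x) y = S t y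

end

end OscFlow

open OscFlow

open OscFlow

/-! ### Majorants in `y`. -/

namespace OscFlow

noncomputable section

/-! In the fast time `τ = t/ε²`, the operator `ε² L^a` is polynomial in `ε` (`La_rescaled`). Its
part of order zero is `∂_τ - μ ∂_θθ`, with the coupling `h' v¹` added in the second component.
Profiles `v_k^s(ε² τ) + v_k^f(τ)` are inserted, and the coefficient of every power of `ε` below
`ε^(N+2)` is made to vanish. What remains is `ε^(N+2)` times a function bounded in every `H^m`,
uniformly in `ε` on `ε² τ ≤ T`. Dividing by `ε²` leaves `O(ε^N)`.

Slow profiles. Order `n` requires `μ ∂_θθ v_n¹ = R_n¹` and `μ ∂_θθ v_n² = h' v_n¹ + R_n²`, where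
`R_n` involves lower orders only. Let `μ a' = h`, `χ' = a` and `μ b' = χ h - Π(χ h)`. The solution
is a double primitive (`corrector`) plus free means `w_n¹` and `w_n² + a w_n¹`. It exists if and
only if `Π R_n¹ = 0` and `Π(a R_n¹ + R_n²) = 0`. At order `k + 2` these conditions contain `h ∂_y
v_{k+1}`. Two integrations by parts against `χ` and `b` replace it by terms of order at most `k`,
and `∂_yy w_k` then appears with the coefficient `Π(χ h) = -μ⁻¹ Π((∂_θ⁻¹ h)²)`. All other
occurrences of `w_k` beyond its own heat operator cancel (`Correctors.sourceG_eq`). The solvability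
conditions are thus two heat equations with the enhanced viscosity, whose sources depend only on the
orders below `k` (`Correctors.mn_slowR_zero`, `Correctors.mn_slowR_one`, `Homogenized.slowEq`).

Fast profiles. Where the slow part meets the fast one it is expanded at `τ = 0`, with coefficients
that grow more slowly than any exponential (`Slow.expands_scal`). Products with fast profiles
therefore keep every decay rate below `μ` (`Fast.fastP`). Each order solves `∂_τ f = μ ∂_θθ f - Q`
(`Fast.fastSol`): the oscillating part by the heat flow on the circle, which decays at least like
`e^{-μ τ}` on functions of mean zero, and the mean by integrating the source from infinity. Decay
leaves no freedom in the mean at `τ = 0`, so the heat equation for the slow mean absorbs the rest of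
the initial value (`Setup.exists_isStep`). The slow and the fast coefficients then vanish separately
(`evol_slowFam`, `evolDiff_fastFam`).

Function spaces. Regularity means that all derivatives in `(t, θ, y)` exist and are bounded by
functions of `y` that are both bounded and square integrable, times an exponential in time (`Reg`).
This class is stable under products, averages and heat flows, it controls all `H^m` norms, and it
contains `H^∞` by a Sobolev inequality (`MemHInf.slow`). Uniqueness of the means is the `L²` energy
estimate for the heat equation (`SolvesHeat.unique`). -/

/-- Admissible majorants: nonnegative, measurable, bounded and square integrable on `ℝ`. -/
structure Maj (g : ℝ → ℝ) : Prop where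
  nonneg : ∀ y, 0 ≤ g y
  meas : Measurable g
  bdd : ∃ C, 0 ≤ C ∧ ∀ y, g y ≤ C
  memLp : MemLp g 2 volume

namespace Maj

lemma zero : Maj (fun _ => 0) :=
  ⟨fun _ => le_rfl, measurable_const, ⟨0, le_rfl, fun _ => le_rfl⟩, MemLp.zero⟩

lemma add {g g' : ℝ → ℝ} (hg : Maj g) (hg' : Maj g') : Maj (fun y => g y + g' y) := by
  obtain ⟨C, hC, h⟩ := hg.bdd
  obtain ⟨C', hC', h'⟩ := hg'.bdd
  exact ⟨fun y => add_nonneg (hg.nonneg y) (hg'.nonneg y), hg.meas.add hg'.meas,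
    ⟨C + C', by positivity, fun y => add_le_add (h y) (h' y)⟩, hg.memLp.add hg'.memLp⟩

lemma const_mul {g : ℝ → ℝ} (hg : Maj g) {c : ℝ} (hc : 0 ≤ c) : Maj (fun y => c * g y) := by
  obtain ⟨C, hC, h⟩ := hg.bdd
  exact ⟨fun y => mul_nonneg hc (hg.nonneg y), hg.meas.const_mul c,
    ⟨c * C, by positivity, fun y => mul_le_mul_of_nonneg_left (h y) hc⟩, hg.memLp.const_mul c⟩

/-- One factor is bounded and the other square integrable. This is why majorants are required to be
both: nonlinear terms need no algebra property of Sobolev spaces. -/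
lemma mul {g g' : ℝ → ℝ} (hg : Maj g) (hg' : Maj g') : Maj (fun y => g y * g' y) := by
  obtain ⟨C, hC, h⟩ := hg.bdd
  obtain ⟨C', hC', h'⟩ := hg'.bdd
  refine ⟨fun y => mul_nonneg (hg.nonneg y) (hg'.nonneg y), hg.meas.mul hg'.meas,
    ⟨C * C', by positivity, fun y => mul_le_mul (h y) (h' y) (hg'.nonneg y) hC⟩, ?_⟩
  refine (hg'.memLp.const_mul C).of_le (hg.meas.mul hg'.meas).aestronglyMeasurable
    (Eventually.of_forall fun y => ?_)
  simp only [Real.norm_eq_abs, abs_mul, abs_of_nonneg (hg.nonneg y), abs_of_nonneg hC]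
  exact mul_le_mul_of_nonneg_right (h y) (abs_nonneg _)

end Maj

/-! ### Regular families: all derivatives exist and have majorants. -/

section Families

variable {E : Type*}

/-- `F` and its majorants: on every `I ∈ ℐ` and for every rate `δ ∈ Δ`, the function
`e^{δt} |F(e,t,θ,y)|` is bounded by an admissible majorant in `y`. -/
def UB (ℐ : Set (Set (E × ℝ≥0))) (Δ : Set ℝ) (F : E → ℝ≥0 → Cyl) : Prop :=
  ∀ I ∈ ℐ, ∀ δ ∈ Δ, ∃ g, Maj g ∧
    ∀ e t, (e, t) ∈ I → ∀ θ y, |F e t θ y| ≤ Real.exp (-(δ * t)) * g y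

/-- `G = ∂_d F`, with `d = 0, 1, 2` for `t`, `θ`, `y`. -/
def Der : Fin 3 → (E → ℝ≥0 → Cyl) → (E → ℝ≥0 → Cyl) → Prop
  | 0, F, G => ∀ e (t : ℝ≥0) θ y,
      HasDerivWithinAt (fun s : ℝ => F e s.toNNReal θ y) (G e t θ y) (Ici 0) t
  | 1, F, G => ∀ e t θ y, HasDerivAt (fun s => F e t s y) (G e t θ y) θ
  | 2, F, G => ∀ e t θ y, HasDerivAt (fun s => F e t θ s) (G e t θ y) y

/-- The canonical derivative `∂_d F`. -/
def der : Fin 3 → (E → ℝ≥0 → Cyl) → E → ℝ≥0 → Cyl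
  | 0, F => fun e t θ y => derivWithin (fun s : ℝ => F e s.toNNReal θ y) (Ici 0) t
  | 1, F => fun e t => dTheta (F e t)
  | 2, F => fun e t => dY (F e t)

/-- Derivatives are unique, also the one-sided time derivative at `0`, so the existential in `RegN`
may always be replaced by the canonical `der`. -/
lemma Der.eq {d : Fin 3} {F G : E → ℝ≥0 → Cyl} (h : Der d F G) : der d F = G := by
  fin_cases d
  · funext e t θ y
    exact (h e t θ y).derivWithin (uniqueDiffOn_Ici 0 _ (mem_Ici.2 t.2))
  · funext e t θ y
    exact (h e t θ y).deriv
  · funext e t θ y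
    exact (h e t θ y).deriv

lemma Der.add {d : Fin 3} {F G F' G' : E → ℝ≥0 → Cyl} (h : Der d F F') (h' : Der d G G') :
    Der d (fun e t θ y => F e t θ y + G e t θ y) (fun e t θ y => F' e t θ y + G' e t θ y) := by
  fin_cases d <;> exact fun e t θ y => (h e t θ y).add (h' e t θ y)

lemma Der.const_mul {d : Fin 3} {F F' : E → ℝ≥0 → Cyl} (c : E → ℝ) (h : Der d F F') :
    Der d (fun e t θ y => c e * F e t θ y) (fun e t θ y => c e * F' e t θ y) := by
  fin_cases d <;> exact fun e t θ y => (h e t θ y).const_mul (c e)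

lemma Der.mul {d : Fin 3} {F G F' G' : E → ℝ≥0 → Cyl} (h : Der d F F') (h' : Der d G G') :
    Der d (fun e t θ y => F e t θ y * G e t θ y)
      (fun e t θ y => F' e t θ y * G e t θ y + F e t θ y * G' e t θ y) := by
  fin_cases d
  · intro e t θ y
    have := (h e t θ y).mul (h' e t θ y)
    simp only [Real.toNNReal_coe] at this
    exact this
  · exact fun e t θ y => (h e t θ y).mul (h' e t θ y)
  · exact fun e t θ y => (h e t θ y).mul (h' e t θ y)

lemma Der.zero {d : Fin 3} : Der d (fun (_ : E) _ _ _ => 0) (fun _ _ _ _ => 0) := by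
  fin_cases d
  · exact fun e t θ y => hasDerivWithinAt_const _ _ _
  · exact fun e t θ y => hasDerivAt_const _ _
  · exact fun e t θ y => hasDerivAt_const _ _

/-- `n`-fold differentiability in `(t, θ, y)` in all orders, with majorants for all derivatives. -/
def RegN (ℐ : Set (Set (E × ℝ≥0))) (Δ : Set ℝ) : ℕ → (E → ℝ≥0 → Cyl) → Prop
  | 0, F => UB ℐ Δ F ∧ ∀ e t θ y, F e t (θ + 1) y = F e t θ y
  | n + 1, F => (UB ℐ Δ F ∧ ∀ e t θ y, F e t (θ + 1) y = F e t θ y) ∧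
      ∀ d, ∃ G, Der d F G ∧ RegN ℐ Δ n G

/-- Smooth families of functions on the cylinder with majorants for all derivatives. -/
def Reg (ℐ : Set (Set (E × ℝ≥0))) (Δ : Set ℝ) (F : E → ℝ≥0 → Cyl) : Prop :=
  ∀ n, RegN ℐ Δ n F

variable {ℐ ℐ₁ ℐ₂ : Set (Set (E × ℝ≥0))} {Δ Δ₁ Δ₂ : Set ℝ} {F G : E → ℝ≥0 → Cyl}

lemma RegN.base {n : ℕ} (h : RegN ℐ Δ n F) :
    UB ℐ Δ F ∧ ∀ e t θ y, F e t (θ + 1) y = F e t θ y := by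
  cases n with
  | zero => exact h
  | succ n => exact h.1

lemma Reg.ub (h : Reg ℐ Δ F) : UB ℐ Δ F := (h 0).1

lemma Reg.per (h : Reg ℐ Δ F) (e : E) (t : ℝ≥0) (θ y : ℝ) : F e t (θ + 1) y = F e t θ y :=
  (h 0).2 e t θ y

lemma RegN.of_succ {n : ℕ} : ∀ {F : E → ℝ≥0 → Cyl}, RegN ℐ Δ (n + 1) F → RegN ℐ Δ n F := by
  induction n with
  | zero => exact fun h => h.1
  | succ n ih =>
    intro F h
    refine ⟨h.1, fun d => ?_⟩
    obtain ⟨G, hG, hr⟩ := h.2 d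
    exact ⟨G, hG, ih hr⟩

lemma Reg.hasDer (h : Reg ℐ Δ F) (d : Fin 3) : Der d F (der d F) := by
  obtain ⟨G, hG, -⟩ := (h 1).2 d
  rwa [hG.eq]

lemma Reg.der (h : Reg ℐ Δ F) (d : Fin 3) : Reg ℐ Δ (der d F) := by
  intro n
  obtain ⟨G, hG, hr⟩ := (h (n + 1)).2 d
  rwa [hG.eq]

lemma UB.add (h : UB ℐ Δ F) (h' : UB ℐ Δ G) : UB ℐ Δ (fun e t θ y => F e t θ y + G e t θ y) := by
  intro I hI δ hδ
  obtain ⟨g, hg, hb⟩ := h I hI δ hδ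
  obtain ⟨g', hg', hb'⟩ := h' I hI δ hδ
  refine ⟨_, hg.add hg', fun e t he θ y => ?_⟩
  calc _ ≤ |F e t θ y| + |G e t θ y| := abs_add_le _ _
    _ ≤ _ := by rw [mul_add]; exact add_le_add (hb e t he θ y) (hb' e t he θ y)

/-- The rates of decay in `Δ` are attained by products of functions with rates in `Δ₁`, `Δ₂`. -/
def RateMul (Δ₁ Δ₂ Δ : Set ℝ) : Prop := ∀ δ ∈ Δ, ∃ δ₁ ∈ Δ₁, ∃ δ₂ ∈ Δ₂, δ ≤ δ₁ + δ₂

lemma UB.mul (hΔ : RateMul Δ₁ Δ₂ Δ) (h : UB ℐ Δ₁ F) (h' : UB ℐ Δ₂ G) :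
    UB ℐ Δ (fun e t θ y => F e t θ y * G e t θ y) := by
  intro I hI δ hδ
  obtain ⟨δ₁, h₁, δ₂, h₂, hle⟩ := hΔ δ hδ
  obtain ⟨g, hg, hb⟩ := h I hI δ₁ h₁
  obtain ⟨g', hg', hb'⟩ := h' I hI δ₂ h₂
  refine ⟨_, hg.mul hg', fun e t he θ y => ?_⟩
  have h0 : 0 ≤ g y * g' y := mul_nonneg (hg.nonneg y) (hg'.nonneg y)
  calc _ = |F e t θ y| * |G e t θ y| := abs_mul _ _
    _ ≤ (Real.exp (-(δ₁ * t)) * g y) * (Real.exp (-(δ₂ * t)) * g' y) :=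
      mul_le_mul (hb e t he θ y) (hb' e t he θ y) (abs_nonneg _)
        (mul_nonneg (Real.exp_pos _).le (hg.nonneg y))
    _ = Real.exp (-((δ₁ + δ₂) * t)) * (g y * g' y) := by
      rw [add_mul, neg_add, Real.exp_add]; ring
    _ ≤ _ := by
      gcongr

lemma UB.of_le {K : ℝ} (hK : 0 ≤ K) (h : UB ℐ Δ F)
    (hle : ∀ e t θ y, |G e t θ y| ≤ K * |F e t θ y|) : UB ℐ Δ G := by
  intro I hI δ hδ
  obtain ⟨g, hg, hb⟩ := h I hI δ hδ
  refine ⟨_, hg.const_mul hK, fun e t he θ y => (hle e t θ y).trans ?_⟩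
  rw [mul_left_comm]
  exact mul_le_mul_of_nonneg_left (hb e t he θ y) hK

lemma RegN.add {n : ℕ} : ∀ {F G : E → ℝ≥0 → Cyl}, RegN ℐ Δ n F → RegN ℐ Δ n G →
    RegN ℐ Δ n (fun e t θ y => F e t θ y + G e t θ y) := by
  have base : ∀ {n : ℕ} {F G : E → ℝ≥0 → Cyl}, RegN ℐ Δ n F → RegN ℐ Δ n G →
    RegN ℐ Δ 0 (fun e t θ y => F e t θ y + G e t θ y) := fun h h' =>
      ⟨h.base.1.add h'.base.1, fun e t θ y => by simp only [h.base.2, h'.base.2]⟩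
  induction n with
  | zero => exact fun h h' => base h h'
  | succ n ih =>
    intro F G h h'
    refine ⟨base h h', fun d => ?_⟩
    obtain ⟨F', hF, hr⟩ := h.2 d
    obtain ⟨G', hG, hr'⟩ := h'.2 d
    exact ⟨_, hF.add hG, ih hr hr'⟩

/-- A class of families closed under differentiation, with majorants, consists of regular
families. -/
lemma Reg.of_closed (C : (E → ℝ≥0 → Cyl) → Prop)
    (hub : ∀ F, C F → UB ℐ Δ F) (hper : ∀ F, C F → ∀ e t θ y, F e t (θ + 1) y = F e t θ y)
    (hder : ∀ F, C F → ∀ d, ∃ G H, Der d F (fun e t θ y => G e t θ y + H e t θ y) ∧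
      Reg ℐ Δ G ∧ C H) :
    ∀ F, C F → Reg ℐ Δ F := by
  intro F hF n
  induction n generalizing F with
  | zero => exact ⟨hub F hF, hper F hF⟩
  | succ n ih =>
    refine ⟨⟨hub F hF, hper F hF⟩, fun d => ?_⟩
    obtain ⟨G, H, hd, hG, hH⟩ := hder F hF d
    exact ⟨_, hd, (hG n).add (ih H hH)⟩

lemma RegN.mul (hΔ : RateMul Δ₁ Δ₂ Δ) {n : ℕ} : ∀ {F G : E → ℝ≥0 → Cyl}, RegN ℐ Δ₁ n F →
    RegN ℐ Δ₂ n G → RegN ℐ Δ n (fun e t θ y => F e t θ y * G e t θ y) := by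
  have base : ∀ {n : ℕ} {F G : E → ℝ≥0 → Cyl}, RegN ℐ Δ₁ n F → RegN ℐ Δ₂ n G →
    RegN ℐ Δ 0 (fun e t θ y => F e t θ y * G e t θ y) := fun h h' =>
      ⟨UB.mul hΔ h.base.1 h'.base.1, fun e t θ y => by simp only [h.base.2, h'.base.2]⟩
  induction n with
  | zero => exact fun h h' => base h h'
  | succ n ih =>
    intro F G h h'
    refine ⟨base h h', fun d => ?_⟩
    obtain ⟨F', hF, hr⟩ := h.2 d
    obtain ⟨G', hG, hr'⟩ := h'.2 d
    exact ⟨_, hF.mul hG, (ih hr h'.of_succ).add (ih h.of_succ hr')⟩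

lemma RegN.const_mul {n : ℕ} {c : E → ℝ} {K : ℝ} (hc : ∀ e, |c e| ≤ K) :
    ∀ {F : E → ℝ≥0 → Cyl}, RegN ℐ Δ n F → RegN ℐ Δ n (fun e t θ y => c e * F e t θ y) := by
  have base : ∀ {n : ℕ} {F : E → ℝ≥0 → Cyl}, RegN ℐ Δ n F →
    RegN ℐ Δ 0 (fun e t θ y => c e * F e t θ y) := by
    refine fun h => ⟨h.base.1.of_le (abs_nonneg K) fun e t θ y => ?_,
      fun e t θ y => by simp only [h.base.2]⟩
    rw [abs_mul]
    exact mul_le_mul_of_nonneg_right ((hc e).trans (le_abs_self K)) (abs_nonneg _)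
  induction n with
  | zero => exact fun h => base h
  | succ n ih =>
    intro F h
    refine ⟨base h, fun d => ?_⟩
    obtain ⟨F', hF, hr⟩ := h.2 d
    exact ⟨_, hF.const_mul c, ih hr⟩

lemma Reg.add (h : Reg ℐ Δ F) (h' : Reg ℐ Δ G) :
    Reg ℐ Δ (fun e t θ y => F e t θ y + G e t θ y) := fun n => (h n).add (h' n)

lemma Reg.mul (hΔ : RateMul Δ₁ Δ₂ Δ) (h : Reg ℐ Δ₁ F) (h' : Reg ℐ Δ₂ G) :
    Reg ℐ Δ (fun e t θ y => F e t θ y * G e t θ y) := fun n => (h n).mul hΔ (h' n)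

lemma Reg.const_mul_of_bdd (h : Reg ℐ Δ F) {c : E → ℝ} {K : ℝ} (hc : ∀ e, |c e| ≤ K) :
    Reg ℐ Δ (fun e t θ y => c e * F e t θ y) := fun n => (h n).const_mul hc

lemma Reg.const_mul (h : Reg ℐ Δ F) (c : ℝ) : Reg ℐ Δ (fun e t θ y => c * F e t θ y) :=
  h.const_mul_of_bdd (c := fun _ => c) (fun _ => le_rfl)

lemma Reg.neg (h : Reg ℐ Δ F) : Reg ℐ Δ (fun e t θ y => - F e t θ y) := by
  simpa using h.const_mul (-1)

lemma Reg.sub (h : Reg ℐ Δ F) (h' : Reg ℐ Δ G) :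
    Reg ℐ Δ (fun e t θ y => F e t θ y - G e t θ y) := by
  simpa only [sub_eq_add_neg] using h.add h'.neg

lemma Reg.zero : Reg ℐ Δ (fun _ _ _ _ => 0) := by
  have h0 : UB ℐ Δ (fun _ _ _ _ => 0) := fun I _ δ _ => ⟨_, Maj.zero, fun e t _ θ y => by simp⟩
  intro n
  induction n with
  | zero => exact ⟨h0, fun e t θ y => rfl⟩
  | succ n ih => exact ⟨⟨h0, fun e t θ y => rfl⟩, fun d => ⟨_, Der.zero, ih⟩⟩

lemma Reg.sum {κ : Type*} (s : Finset κ) {F : κ → E → ℝ≥0 → Cyl} (h : ∀ k ∈ s, Reg ℐ Δ (F k)) :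
    Reg ℐ Δ (fun e t θ y => ∑ k ∈ s, F k e t θ y) := by
  classical
  induction s using Finset.induction_on with
  | empty => simpa using Reg.zero
  | insert a s ha ih =>
    simp only [Finset.sum_insert ha]
    exact (h a (Finset.mem_insert_self a s)).add
      (ih fun k hk => h k (Finset.mem_insert_of_mem hk))

/-- Changes of class go through this: the parameter is pulled back along `φ`, the sets may shrink
and the rate may change, with `K` paying for the ratio of the exponentials. -/
lemma Reg.mono (h : Reg ℐ Δ F) {E' : Type*} {ℐ' : Set (Set (E' × ℝ≥0))} {Δ' : Set ℝ} (φ : E' → E)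
    (hle : ∀ I' ∈ ℐ', ∀ δ' ∈ Δ', ∃ I ∈ ℐ, ∃ δ ∈ Δ, ∃ K : ℝ, 0 ≤ K ∧ ∀ e t, (e, t) ∈ I' →
      (φ e, t) ∈ I ∧ Real.exp (-(δ * t)) ≤ K * Real.exp (-(δ' * t))) :
    Reg ℐ' Δ' (fun e => F (φ e)) := by
  have hub : ∀ {F : E → ℝ≥0 → Cyl}, UB ℐ Δ F → UB ℐ' Δ' (fun e => F (φ e)) := by
    intro F h I' hI' δ' hδ'
    obtain ⟨I, hI, δ, hδ, K, hK, hb⟩ := hle I' hI' δ' hδ'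
    obtain ⟨g, hg, hb'⟩ := h I hI δ hδ
    refine ⟨_, hg.const_mul hK, fun e t he θ y => (hb' _ t (hb e t he).1 θ y).trans ?_⟩
    calc _ ≤ K * Real.exp (-(δ' * t)) * g y :=
          mul_le_mul_of_nonneg_right (hb e t he).2 (hg.nonneg y)
      _ = _ := by ring
  intro n
  induction n generalizing F with
  | zero => exact ⟨hub h.ub, fun e => h.per (φ e)⟩
  | succ n ih =>
    refine ⟨⟨hub h.ub, fun e => h.per (φ e)⟩, fun d => ⟨_, ?_, ih (h.der d)⟩⟩
    have := h.hasDer d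
    fin_cases d <;> exact fun e => this (φ e)

/-- Rescaling of time. -/
lemma Reg.rescale (h : Reg ℐ Δ F) {ℐ' : Set (Set (E × ℝ≥0))} {Δ' : Set ℝ} (c : E → ℝ≥0) {C : ℝ}
    (hc : ∀ e, (c e : ℝ) ≤ C)
    (hle : ∀ I' ∈ ℐ', ∀ δ' ∈ Δ', ∃ I ∈ ℐ, ∃ δ ∈ Δ, ∃ K : ℝ, 0 ≤ K ∧ ∀ e t, (e, t) ∈ I' →
      (e, c e * t) ∈ I ∧ Real.exp (-(δ * (c e * t))) ≤ K * Real.exp (-(δ' * t))) :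
    Reg ℐ' Δ' (fun e t => F e (c e * t)) := by
  have hub : ∀ {F : E → ℝ≥0 → Cyl}, UB ℐ Δ F → UB ℐ' Δ' (fun e t => F e (c e * t)) := by
    intro F h I' hI' δ' hδ'
    obtain ⟨I, hI, δ, hδ, K, hK, hb⟩ := hle I' hI' δ' hδ'
    obtain ⟨g, hg, hb'⟩ := h I hI δ hδ
    refine ⟨_, hg.const_mul hK, fun e t he θ y => (hb' e _ (hb e t he).1 θ y).trans ?_⟩
    calc _ ≤ K * Real.exp (-(δ' * t)) * g y := by
          push_cast
          exact mul_le_mul_of_nonneg_right (hb e t he).2 (hg.nonneg y)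
      _ = _ := by ring
  intro n
  induction n generalizing F with
  | zero => exact ⟨hub h.ub, fun e t => h.per e _⟩
  | succ n ih =>
    refine ⟨⟨hub h.ub, fun e t => h.per e _⟩, fun d => ?_⟩
    have hd := h.hasDer d
    fin_cases d
    -- The chain rule brings out a factor `c e`, which the bound `C` keeps uniform in `e`.
    · refine ⟨fun e t θ y => c e * OscFlow.der 0 F e (c e * t) θ y, fun e t θ y => ?_,
        (ih (h.der 0)).const_mul (c := fun e => (c e : ℝ)) (K := C)
          (fun e => by rw [abs_of_nonneg (NNReal.coe_nonneg _)]; exact hc e)⟩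
      have h1 := hd e (c e * t) θ y
      have h2 : HasDerivWithinAt (fun s : ℝ => (c e : ℝ) * s) (c e) (Ici 0) t := by
        simpa using (hasDerivWithinAt_id (t : ℝ) (Ici 0)).const_mul (c e : ℝ)
      have h3 := HasDerivWithinAt.scomp (t : ℝ) (t' := Ici 0) (by simpa using h1) h2
        (fun s hs => mul_nonneg (c e).2 hs)
      refine (h3.congr (fun s hs => ?_) ?_) <;>
        simp [Function.comp, Real.toNNReal_mul (NNReal.coe_nonneg (c e))]
    · exact ⟨_, fun e t => hd e _, ih (h.der 1)⟩
    · exact ⟨_, fun e t => hd e _, ih (h.der 2)⟩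

end Families

end

end OscFlow

/-! ### Taylor estimates and symmetry of mixed derivatives. -/

namespace OscFlow

noncomputable section

section Calculus

lemma abs_sub_le_of_hasDerivWithinAt {S : Set ℝ} (hS : Convex ℝ S) {u u' : ℝ → ℝ}
    (hu : ∀ x ∈ S, HasDerivWithinAt u (u' x) S x) {C : ℝ} (hC : ∀ x ∈ S, |u' x| ≤ C)
    {x z : ℝ} (hx : x ∈ S) (hz : z ∈ S) : |u x - u z| ≤ C * |x - z| :=
  hS.norm_image_sub_le_of_norm_hasDerivWithin_le hu hC hz hx

/-- The mean value inequality for `s ↦ u s - s * u' z`, whose derivative `u' s - u' z` only has to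
be bounded between `z` and `x`. -/
lemma abs_sub_sub_le_of_hasDerivWithinAt {S : Set ℝ} (hS : Convex ℝ S) {u u' : ℝ → ℝ}
    (hu : ∀ x ∈ S, HasDerivWithinAt u (u' x) S x) {x z C : ℝ} (hx : x ∈ S) (hz : z ∈ S)
    (hC : ∀ s ∈ S, |s - z| ≤ |x - z| → |u' s - u' z| ≤ C) :
    |u x - u z - (x - z) * u' z| ≤ C * |x - z| := by
  have hsub : uIcc z x ⊆ S := hS.ordConnected.uIcc_subset hz hx
  have h := abs_sub_le_of_hasDerivWithinAt (S := uIcc z x) (convex_uIcc z x)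
    (u := fun s => u s - s * u' z) (u' := fun s => u' s - u' z)
    (fun s hs => by
      have := ((hu s (hsub hs)).mono hsub).sub ((hasDerivWithinAt_id s _).mul_const (u' z))
      rw [one_mul] at this
      exact this)
    (fun s hs => hC s (hsub hs) (abs_sub_left_of_mem_uIcc hs)) right_mem_uIcc left_mem_uIcc
  convert h using 2
  ring

/-- A quadratic bound on the remainder survives integration over a parameter; differentiation under
the integral sign rests on this. -/
lemma hasDerivWithinAt_of_quadratic {S : Set ℝ} {u : ℝ → ℝ} {a t C : ℝ}
    (h : ∀ᶠ s in 𝓝[S] t, |u s - u t - (s - t) * a| ≤ C * (s - t) ^ 2) :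
    HasDerivWithinAt u a S t := by
  rw [hasDerivWithinAt_iff_isLittleO]
  have h1 : (fun s => u s - u t - (s - t) • a) =O[𝓝[S] t] fun s => (s - t) ^ 2 := by
    refine Asymptotics.IsBigO.of_bound C (h.mono fun s hs => ?_)
    simpa [abs_of_nonneg (sq_nonneg (s - t))] using hs
  have h2 : (fun s => (s - t) ^ 2) =o[𝓝 t] fun s : ℝ => s - t := by
    have := (Asymptotics.isLittleO_pow_pow (𝕜 := ℝ) (m := 1) (n := 2) (by norm_num)).comp_tendsto
      (show Tendsto (fun s : ℝ => s - t) (𝓝 t) (𝓝 0) by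
        simpa using (continuous_id.sub continuous_const).tendsto (f := fun s : ℝ => s - t) t)
    simpa [Function.comp_def] using this
  exact h1.trans_isLittleO (h2.mono nhdsWithin_le_nhds)

lemma hasDerivAt_of_quadratic {u : ℝ → ℝ} {a t C : ℝ}
    (h : ∀ s, |u s - u t - (s - t) * a| ≤ C * (s - t) ^ 2) : HasDerivAt u a t :=
  (hasDerivWithinAt_of_quadratic (S := univ) (C := C) (Eventually.of_forall h)).hasDerivAt
    univ_mem

/-- Two applications of the mean value inequality, first along `b` and then along `a`; the Lipschitz
bound on `u₁₂` over a square of side `k` makes the error cubic. -/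
lemma rectangle_estimate {A B : Set ℝ} (hA : Convex ℝ A) (hB : Convex ℝ B)
    {u u₁ u₁₂ : ℝ → ℝ → ℝ} (h1 : ∀ a ∈ A, ∀ b ∈ B, HasDerivWithinAt (fun s => u s b) (u₁ a b) A a)
    (h12 : ∀ a ∈ A, ∀ b ∈ B, HasDerivWithinAt (fun s => u₁ a s) (u₁₂ a b) B b) {C : ℝ}
    (hC : ∀ a ∈ A, ∀ b ∈ B, ∀ a' ∈ A, ∀ b' ∈ B,
      |u₁₂ a b - u₁₂ a' b'| ≤ C * (|a - a'| + |b - b'|)) (hC0 : 0 ≤ C)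
    {a b k : ℝ} (hk : 0 ≤ k) (ha : a ∈ A) (hb : b ∈ B) (hak : a + k ∈ A) (hbk : b + k ∈ B) :
    |u (a + k) (b + k) - u (a + k) b - u a (b + k) + u a b - k ^ 2 * u₁₂ a b| ≤
      2 * C * k ^ 3 := by
  have hsA : Icc a (a + k) ⊆ A := hA.ordConnected.out ha hak
  have hsB : Icc b (b + k) ⊆ B := hB.ordConnected.out hb hbk
  have hin : ∀ s ∈ Icc a (a + k), |u₁ s (b + k) - u₁ s b - k * u₁₂ a b| ≤ 2 * C * k * k := by
    intro s hs
    have h := abs_sub_le_of_hasDerivWithinAt (S := Icc b (b + k)) (convex_Icc _ _)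
      (u := fun x => u₁ s x - x * u₁₂ a b) (u' := fun x => u₁₂ s x - u₁₂ a b) (C := 2 * C * k)
      (fun x hx => by
        have := ((h12 s (hsA hs) x (hsB hx)).mono hsB).sub
          ((hasDerivWithinAt_id x _).mul_const (u₁₂ a b))
        rw [one_mul] at this
        exact this)
      (fun x hx => by
        refine (hC s (hsA hs) x (hsB hx) a ha b hb).trans ?_
        rw [abs_of_nonneg (sub_nonneg.2 hs.1), abs_of_nonneg (sub_nonneg.2 hx.1)]
        have := hs.2; have := hx.2
        nlinarith) (right_mem_Icc.2 (by linarith)) (left_mem_Icc.2 (by linarith))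
    rw [show b + k - b = k by ring, abs_of_nonneg hk] at h
    convert h using 2
    ring
  have h := abs_sub_le_of_hasDerivWithinAt (S := Icc a (a + k)) (convex_Icc _ _)
      (u := fun s => u s (b + k) - u s b - s * (k * u₁₂ a b))
      (u' := fun s => u₁ s (b + k) - u₁ s b - k * u₁₂ a b)
      (fun s hs => by
        have := (((h1 s (hsA hs) _ hbk).mono hsA).sub ((h1 s (hsA hs) _ hb).mono hsA)).sub
          ((hasDerivWithinAt_id s _).mul_const (k * u₁₂ a b))
        rw [one_mul] at this
        exact this)
      hin (right_mem_Icc.2 (by linarith)) (left_mem_Icc.2 (by linarith))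
  rw [show a + k - a = k by ring, abs_of_nonneg hk] at h
  calc _ = |u (a + k) (b + k) - u (a + k) b - (a + k) * (k * u₁₂ a b) -
        (u a (b + k) - u a b - a * (k * u₁₂ a b))| := by congr 1; ring
    _ ≤ _ := h
    _ = _ := by ring

/-- Both mixed derivatives are limits of the same double difference divided by `k ^ 2`. Only squares
to the upper right of `(a, b)` are used, so `a` may be the end point `t = 0` of a time interval. -/
lemma mixed_partials_eq {A B : Set ℝ} (hA : Convex ℝ A) (hB : Convex ℝ B)
    {u u₁ u₂ u₁₂ u₂₁ : ℝ → ℝ → ℝ}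
    (h1 : ∀ a ∈ A, ∀ b ∈ B, HasDerivWithinAt (fun s => u s b) (u₁ a b) A a)
    (h2 : ∀ a ∈ A, ∀ b ∈ B, HasDerivWithinAt (fun s => u a s) (u₂ a b) B b)
    (h12 : ∀ a ∈ A, ∀ b ∈ B, HasDerivWithinAt (fun s => u₁ a s) (u₁₂ a b) B b)
    (h21 : ∀ a ∈ A, ∀ b ∈ B, HasDerivWithinAt (fun s => u₂ s b) (u₂₁ a b) A a) {C C' : ℝ}
    (hC : ∀ a ∈ A, ∀ b ∈ B, ∀ a' ∈ A, ∀ b' ∈ B,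
      |u₁₂ a b - u₁₂ a' b'| ≤ C * (|a - a'| + |b - b'|)) (hC0 : 0 ≤ C)
    (hC' : ∀ a ∈ A, ∀ b ∈ B, ∀ a' ∈ A, ∀ b' ∈ B,
      |u₂₁ a b - u₂₁ a' b'| ≤ C' * (|a - a'| + |b - b'|)) (hC0' : 0 ≤ C')
    {a b : ℝ} (hab : ∀ k ∈ Icc (0 : ℝ) 1, a + k ∈ A ∧ b + k ∈ B) : u₁₂ a b = u₂₁ a b := by
  have ha : a ∈ A := by simpa using (hab 0 (by simp)).1
  have hb : b ∈ B := by simpa using (hab 0 (by simp)).2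
  have key : ∀ k ∈ Ioc (0 : ℝ) 1, |u₁₂ a b - u₂₁ a b| ≤ 2 * (C + C') * k := by
    intro k hk
    have hk' := hab k ⟨hk.1.le, hk.2⟩
    have e1 := rectangle_estimate hA hB h1 h12 hC hC0 hk.1.le ha hb hk'.1 hk'.2
    have e2 := rectangle_estimate hB hA (u := fun b a => u a b) (u₁ := fun b a => u₂ a b)
      (u₁₂ := fun b a => u₂₁ a b) (fun b hb a ha => h2 a ha b hb) (fun b hb a ha => h21 a ha b hb)
      (fun b hb a ha b' hb' a' ha' => by rw [add_comm |b - b'|]; exact hC' a ha b hb a' ha' b' hb')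
      hC0' hk.1.le hb ha hk'.2 hk'.1
    have h3 : |k ^ 2 * (u₁₂ a b - u₂₁ a b)| ≤ 2 * C * k ^ 3 + 2 * C' * k ^ 3 := by
      rw [abs_le] at e1 e2 ⊢
      constructor <;> nlinarith [e1.1, e1.2, e2.1, e2.2]
    rw [abs_mul, abs_of_nonneg (sq_nonneg k)] at h3
    have : k ^ 2 * |u₁₂ a b - u₂₁ a b| ≤ k ^ 2 * (2 * (C + C') * k) := by
      calc _ ≤ _ := h3
        _ = _ := by ring
    exact le_of_mul_le_mul_left this (pow_pos hk.1 2)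
  have hlim : Tendsto (fun k : ℝ => 2 * (C + C') * k) (𝓝[>] 0) (𝓝 0) := by
    have : Tendsto (fun k : ℝ => 2 * (C + C') * k) (𝓝 0) (𝓝 (2 * (C + C') * 0)) :=
      (continuous_const.mul continuous_id).tendsto 0
    rw [mul_zero] at this
    exact this.mono_left nhdsWithin_le_nhds
  have hle : |u₁₂ a b - u₂₁ a b| ≤ 0 := by
    refine ge_of_tendsto hlim ?_
    filter_upwards [Ioc_mem_nhdsGT (zero_lt_one' ℝ)] with k hk using key k hk
  exact sub_eq_zero.1 (abs_nonpos_iff.1 hle)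

end Calculus

/-! ### Slow profiles: bounds in time and space, smoothness. -/

/-- Smooth in time with values in `H^∞`, on every compact time interval. -/
def Slow (f : ℝ≥0 → Cyl) : Prop :=
  Reg (range fun T : ℝ≥0 => {p : Unit × ℝ≥0 | p.2 ≤ T}) {0} (fun _ => f)

/-- The derivative of a profile in `t`, `θ`, `y` for `d = 0, 1, 2`. -/
def D (d : Fin 3) (f : ℝ≥0 → Cyl) : ℝ≥0 → Cyl := der d (fun _ : Unit => f) ()

/-- Every exponential is bounded on `[0, T]`, so one rate of any sign is enough. -/
lemma Reg.slow {E : Type*} {ℐ : Set (Set (E × ℝ≥0))} {Δ : Set ℝ} {F : E → ℝ≥0 → Cyl}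
    (h : Reg ℐ Δ F) (e : E) (hI : ∀ T : ℝ≥0, ∃ I ∈ ℐ, ∀ t ≤ T, (e, t) ∈ I) (hΔ : Δ.Nonempty) :
    Slow (F e) := by
  refine h.mono (fun _ => e) ?_
  rintro _ ⟨T, rfl⟩ δ' rfl
  obtain ⟨I, hI, ht⟩ := hI T
  obtain ⟨δ, hδ⟩ := hΔ
  refine ⟨I, hI, δ, hδ, Real.exp (|δ| * T), (Real.exp_pos _).le, fun _ t (htT : t ≤ T) =>
    ⟨ht t htT, ?_⟩⟩
  rw [← Real.exp_add]
  gcongr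
  have h1 : -δ * t ≤ |δ| * t := mul_le_mul_of_nonneg_right (neg_le_abs δ) t.2
  have h2 : |δ| * t ≤ |δ| * T := mul_le_mul_of_nonneg_left (by exact_mod_cast htT) (abs_nonneg δ)
  linarith

namespace Slow

variable {f g : ℝ≥0 → Cyl}

lemma D (h : Slow f) (d : Fin 3) : Slow (D d f) := Reg.der h d

lemma hasDeriv_t (h : Slow f) (t : ℝ≥0) (θ y : ℝ) :
    HasDerivWithinAt (fun s : ℝ => f s.toNNReal θ y) (OscFlow.D 0 f t θ y) (Ici 0) t :=
  Reg.hasDer h 0 () t θ y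

lemma hasDeriv_x (h : Slow f) (t : ℝ≥0) (θ y : ℝ) :
    HasDerivAt (fun s => f t s y) (OscFlow.D 1 f t θ y) θ := Reg.hasDer h 1 () t θ y

lemma hasDeriv_y (h : Slow f) (t : ℝ≥0) (θ y : ℝ) :
    HasDerivAt (fun s => f t θ s) (OscFlow.D 2 f t θ y) y := Reg.hasDer h 2 () t θ y

lemma per (h : Slow f) (t : ℝ≥0) (θ y : ℝ) : f t (θ + 1) y = f t θ y := Reg.per h () t θ y

lemma maj (h : Slow f) (T : ℝ≥0) : ∃ g, Maj g ∧ ∀ t ≤ T, ∀ θ y, |f t θ y| ≤ g y := by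
  obtain ⟨g, hg, hb⟩ := h.ub _ ⟨T, rfl⟩ 0 rfl
  exact ⟨g, hg, fun t ht θ y => by simpa using hb () t ht θ y⟩

lemma bdd (h : Slow f) (T : ℝ≥0) : ∃ C, 0 ≤ C ∧ ∀ t ≤ T, ∀ θ y, |f t θ y| ≤ C := by
  obtain ⟨g, hg, hb⟩ := h.maj T
  obtain ⟨C, hC, hgC⟩ := hg.bdd
  exact ⟨C, hC, fun t ht θ y => (hb t ht θ y).trans (hgC y)⟩

lemma maj_sub_t (h : Slow f) (T : ℝ≥0) : ∃ g, Maj g ∧ ∀ t ≤ T, ∀ s ≤ T, ∀ θ y,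
    |f s θ y - f t θ y| ≤ g y * |(s : ℝ) - t| := by
  obtain ⟨g, hg, hb⟩ := (h.D 0).maj T
  refine ⟨g, hg, fun t ht s hs θ y => ?_⟩
  have := abs_sub_le_of_hasDerivWithinAt (S := Icc (0 : ℝ) T) (convex_Icc _ _)
    (u := fun s : ℝ => f s.toNNReal θ y) (u' := fun s => OscFlow.D 0 f s.toNNReal θ y) (C := g y)
    (fun x hx => by
      have := (h.hasDeriv_t x.toNNReal θ y).mono (s := Icc 0 ↑T) (fun _ hz => hz.1)
      rwa [Real.coe_toNNReal _ hx.1] at this)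
    (fun x hx => hb _ (Real.toNNReal_le_iff_le_coe.2 hx.2) θ y)
    (x := s) (z := t) ⟨s.2, by exact_mod_cast hs⟩ ⟨t.2, by exact_mod_cast ht⟩
  simpa using this

/-- The remainder is bounded by a majorant in `y` and not only by a constant, so that difference
quotients in time converge in the `H^m` norms. -/
lemma maj_quad_t (h : Slow f) (T : ℝ≥0) : ∃ g, Maj g ∧ ∀ t ≤ T, ∀ s ≤ T, ∀ θ y,
    |f s θ y - f t θ y - ((s : ℝ) - t) * OscFlow.D 0 f t θ y| ≤ g y * ((s : ℝ) - t) ^ 2 := by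
  obtain ⟨g, hg, hb⟩ := (h.D 0).maj_sub_t T
  refine ⟨g, hg, fun t ht s hs θ y => ?_⟩
  have := abs_sub_sub_le_of_hasDerivWithinAt (S := Icc (0 : ℝ) T) (convex_Icc _ _)
    (u := fun s : ℝ => f s.toNNReal θ y) (u' := fun s => OscFlow.D 0 f s.toNNReal θ y)
    (C := g y * |(s : ℝ) - t|) (x := s) (z := t)
    (fun x hx => by
      have := (h.hasDeriv_t x.toNNReal θ y).mono (s := Icc 0 ↑T) (fun _ hz => hz.1)
      rwa [Real.coe_toNNReal _ hx.1] at this)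
    ⟨s.2, by exact_mod_cast hs⟩ ⟨t.2, by exact_mod_cast ht⟩
    (fun x hx hle => by
      have := hb t ht _ (Real.toNNReal_le_iff_le_coe.2 hx.2) θ y
      rw [Real.coe_toNNReal _ hx.1] at this
      simp only [Real.toNNReal_coe]
      exact this.trans (mul_le_mul_of_nonneg_left hle (hg.nonneg y)))
  simpa [mul_assoc, abs_mul_abs_self, ← pow_two] using this

lemma lip_x (h : Slow f) (T : ℝ≥0) : ∃ C, 0 ≤ C ∧ ∀ t ≤ T, ∀ θ θ' y,
    |f t θ' y - f t θ y| ≤ C * |θ' - θ| := by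
  obtain ⟨C, hC, hb⟩ := (h.D 1).bdd T
  exact ⟨C, hC, fun t ht θ θ' y => abs_sub_le_of_hasDerivWithinAt convex_univ
    (fun x _ => (h.hasDeriv_x t x y).hasDerivWithinAt) (fun x _ => hb t ht x y) (mem_univ _)
    (mem_univ _)⟩

lemma lip_y (h : Slow f) (T : ℝ≥0) : ∃ C, 0 ≤ C ∧ ∀ t ≤ T, ∀ θ y y',
    |f t θ y' - f t θ y| ≤ C * |y' - y| := by
  obtain ⟨C, hC, hb⟩ := (h.D 2).bdd T
  exact ⟨C, hC, fun t ht θ y y' => abs_sub_le_of_hasDerivWithinAt convex_univ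
    (fun x _ => (h.hasDeriv_y t θ x).hasDerivWithinAt) (fun x _ => hb t ht θ x) (mem_univ _)
    (mem_univ _)⟩

lemma quad_x (h : Slow f) (T : ℝ≥0) : ∃ C, 0 ≤ C ∧ ∀ t ≤ T, ∀ θ θ' y,
    |f t θ' y - f t θ y - (θ' - θ) * OscFlow.D 1 f t θ y| ≤ C * (θ' - θ) ^ 2 := by
  obtain ⟨C, hC, hb⟩ := (h.D 1).lip_x T
  refine ⟨C, hC, fun t ht θ θ' y => ?_⟩
  have := abs_sub_sub_le_of_hasDerivWithinAt convex_univ (C := C * |θ' - θ|) (z := θ) (x := θ')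
    (fun x _ => (h.hasDeriv_x t x y).hasDerivWithinAt) (mem_univ _) (mem_univ _)
    (fun x _ hle => (hb t ht θ x y).trans (mul_le_mul_of_nonneg_left hle hC))
  simpa [mul_assoc, abs_mul_abs_self, ← pow_two] using this

lemma quad_y (h : Slow f) (T : ℝ≥0) : ∃ C, 0 ≤ C ∧ ∀ t ≤ T, ∀ θ y y',
    |f t θ y' - f t θ y - (y' - y) * OscFlow.D 2 f t θ y| ≤ C * (y' - y) ^ 2 := by
  obtain ⟨C, hC, hb⟩ := (h.D 2).lip_y T
  refine ⟨C, hC, fun t ht θ y y' => ?_⟩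
  have := abs_sub_sub_le_of_hasDerivWithinAt convex_univ (C := C * |y' - y|) (z := y) (x := y')
    (fun x _ => (h.hasDeriv_y t θ x).hasDerivWithinAt) (mem_univ _) (mem_univ _)
    (fun x _ hle => (hb t ht θ y x).trans (mul_le_mul_of_nonneg_left hle hC))
  simpa [mul_assoc, abs_mul_abs_self, ← pow_two] using this

lemma lip (h : Slow f) (T : ℝ≥0) : ∃ C, 0 ≤ C ∧ ∀ t ≤ T, ∀ s ≤ T, ∀ θ θ' y y',
    |f s θ' y' - f t θ y| ≤ C * (|(s : ℝ) - t| + |θ' - θ| + |y' - y|) := by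
  obtain ⟨g, hg, h0⟩ := h.maj_sub_t T
  obtain ⟨C₀, hC₀, hgC⟩ := hg.bdd
  obtain ⟨C₁, hC₁, h1⟩ := h.lip_x T
  obtain ⟨C₂, hC₂, h2⟩ := h.lip_y T
  refine ⟨C₀ + C₁ + C₂, by positivity, fun t ht s hs θ θ' y y' => ?_⟩
  have e0 := (h0 t ht s hs θ y).trans (mul_le_mul_of_nonneg_right (hgC y) (abs_nonneg _))
  have e1 := h1 s hs θ θ' y
  have e2 := h2 s hs θ' y y'
  calc _ = |(f s θ' y' - f s θ' y) + (f s θ' y - f s θ y) + (f s θ y - f t θ y)| := by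
        congr 1; ring
    _ ≤ _ := abs_add_three _ _ _
    _ ≤ _ := by
      have := abs_nonneg ((s : ℝ) - t)
      have := abs_nonneg (θ' - θ)
      have := abs_nonneg (y' - y)
      nlinarith

lemma continuous (h : Slow f) : Continuous fun p : ℝ≥0 × ℝ × ℝ => f p.1 p.2.1 p.2.2 := by
  rw [continuous_iff_continuousAt]
  rintro ⟨t, θ, y⟩
  obtain ⟨C, hC, hl⟩ := h.lip (t + 1)
  have hlim : Tendsto (fun p : ℝ≥0 × ℝ × ℝ => C * (|(p.1 : ℝ) - t| + |p.2.1 - θ| + |p.2.2 - y|))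
      (𝓝 (t, θ, y)) (𝓝 0) := by
    have : Continuous (fun p : ℝ≥0 × ℝ × ℝ =>
      C * (|(p.1 : ℝ) - t| + |p.2.1 - θ| + |p.2.2 - y|)) := by fun_prop
    simpa using this.tendsto (t, θ, y)
  refine tendsto_iff_norm_sub_tendsto_zero.2 (squeeze_zero' (Eventually.of_forall fun _ =>
    norm_nonneg _) ?_ hlim)
  have hn : ∀ᶠ p : ℝ≥0 × ℝ × ℝ in 𝓝 (t, θ, y), p.1 < t + 1 :=
    (continuous_fst.tendsto (t, θ, y)).eventually (gt_mem_nhds (by simp))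
  filter_upwards [hn] with p hp
  exact hl t (by simp) p.1 hp.le θ p.2.1 y p.2.2

lemma continuous_comp (h : Slow f) {X : Type*} [TopologicalSpace X] {a : X → ℝ≥0} {b c : X → ℝ}
    (ha : Continuous a) (hb : Continuous b) (hc : Continuous c) :
    Continuous fun x => f (a x) (b x) (c x) :=
  h.continuous.comp (ha.prodMk (hb.prodMk hc))

lemma D_comm_tx (h : Slow f) : OscFlow.D 0 (OscFlow.D 1 f) = OscFlow.D 1 (OscFlow.D 0 f) := by
  funext t θ y
  -- Bounds hold on compact time intervals only; `[0, t + 1]` leaves room for squares of side at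
  -- most `1` to the right of `t`.
  obtain ⟨C, hC, hl⟩ := ((h.D 1).D 0).lip (t + 1)
  obtain ⟨C', hC', hl'⟩ := ((h.D 0).D 1).lip (t + 1)
  have hle : ∀ a ∈ Icc (0 : ℝ) ↑(t + 1), a.toNNReal ≤ t + 1 := fun a ha =>
    Real.toNNReal_le_iff_le_coe.2 ha.2
  have ht : ∀ {f : ℝ≥0 → Cyl}, Slow f → ∀ a ∈ Icc (0 : ℝ) ↑(t + 1), ∀ b, HasDerivWithinAt
      (fun s : ℝ => f s.toNNReal b y) (OscFlow.D 0 f a.toNNReal b y) (Icc 0 ↑(t + 1)) a := by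
    intro f h a ha b
    have := (h.hasDeriv_t a.toNNReal b y).mono (s := Icc 0 ↑(t + 1)) (fun _ hz => hz.1)
    rwa [Real.coe_toNNReal _ ha.1] at this
  have := mixed_partials_eq (A := Icc (0 : ℝ) ↑(t + 1)) (B := univ) (convex_Icc _ _) convex_univ
    (u := fun a b => f a.toNNReal b y) (u₁ := fun a b => OscFlow.D 0 f a.toNNReal b y)
    (u₂ := fun a b => OscFlow.D 1 f a.toNNReal b y)
    (u₁₂ := fun a b => OscFlow.D 1 (OscFlow.D 0 f) a.toNNReal b y)
    (u₂₁ := fun a b => OscFlow.D 0 (OscFlow.D 1 f) a.toNNReal b y) (C := C') (C' := C)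
    (fun a ha b _ => ht h a ha b)
    (fun a _ b _ => (h.hasDeriv_x _ b y).hasDerivWithinAt)
    (fun a _ b _ => ((h.D 0).hasDeriv_x _ b y).hasDerivWithinAt)
    (fun a ha b _ => ht (h.D 1) a ha b)
    (fun a ha b _ a' ha' b' _ => by
      simpa [Real.coe_toNNReal _ ha.1, Real.coe_toNNReal _ ha'.1]
        using hl' _ (hle a' ha') _ (hle a ha) b' b y y) hC'
    (fun a ha b _ a' ha' b' _ => by
      simpa [Real.coe_toNNReal _ ha.1, Real.coe_toNNReal _ ha'.1]
        using hl _ (hle a' ha') _ (hle a ha) b' b y y) hC (a := t) (b := θ)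
    (fun k hk => ⟨⟨add_nonneg t.2 hk.1, by push_cast; linarith [hk.2]⟩, mem_univ _⟩)
  simpa using this.symm

lemma D_comm_ty (h : Slow f) : OscFlow.D 0 (OscFlow.D 2 f) = OscFlow.D 2 (OscFlow.D 0 f) := by
  funext t θ y
  obtain ⟨C, hC, hl⟩ := ((h.D 2).D 0).lip (t + 1)
  obtain ⟨C', hC', hl'⟩ := ((h.D 0).D 2).lip (t + 1)
  have hle : ∀ a ∈ Icc (0 : ℝ) ↑(t + 1), a.toNNReal ≤ t + 1 := fun a ha =>
    Real.toNNReal_le_iff_le_coe.2 ha.2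
  have ht : ∀ {f : ℝ≥0 → Cyl}, Slow f → ∀ a ∈ Icc (0 : ℝ) ↑(t + 1), ∀ b, HasDerivWithinAt
      (fun s : ℝ => f s.toNNReal θ b) (OscFlow.D 0 f a.toNNReal θ b) (Icc 0 ↑(t + 1)) a := by
    intro f h a ha b
    have := (h.hasDeriv_t a.toNNReal θ b).mono (s := Icc 0 ↑(t + 1)) (fun _ hz => hz.1)
    rwa [Real.coe_toNNReal _ ha.1] at this
  have := mixed_partials_eq (A := Icc (0 : ℝ) ↑(t + 1)) (B := univ) (convex_Icc _ _) convex_univ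
    (u := fun a b => f a.toNNReal θ b) (u₁ := fun a b => OscFlow.D 0 f a.toNNReal θ b)
    (u₂ := fun a b => OscFlow.D 2 f a.toNNReal θ b)
    (u₁₂ := fun a b => OscFlow.D 2 (OscFlow.D 0 f) a.toNNReal θ b)
    (u₂₁ := fun a b => OscFlow.D 0 (OscFlow.D 2 f) a.toNNReal θ b) (C := C') (C' := C)
    (fun a ha b _ => ht h a ha b)
    (fun a _ b _ => (h.hasDeriv_y _ θ b).hasDerivWithinAt)
    (fun a _ b _ => ((h.D 0).hasDeriv_y _ θ b).hasDerivWithinAt)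
    (fun a ha b _ => ht (h.D 2) a ha b)
    (fun a ha b _ a' ha' b' _ => by
      simpa [Real.coe_toNNReal _ ha.1, Real.coe_toNNReal _ ha'.1]
        using hl' _ (hle a' ha') _ (hle a ha) θ θ b' b) hC'
    (fun a ha b _ a' ha' b' _ => by
      simpa [Real.coe_toNNReal _ ha.1, Real.coe_toNNReal _ ha'.1]
        using hl _ (hle a' ha') _ (hle a ha) θ θ b' b) hC (a := t) (b := y)
    (fun k hk => ⟨⟨add_nonneg t.2 hk.1, by push_cast; linarith [hk.2]⟩, mem_univ _⟩)
  simpa using this.symm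

lemma D_comm_xy (h : Slow f) : OscFlow.D 1 (OscFlow.D 2 f) = OscFlow.D 2 (OscFlow.D 1 f) := by
  funext t θ y
  obtain ⟨C, hC, hl⟩ := ((h.D 2).D 1).lip t
  obtain ⟨C', hC', hl'⟩ := ((h.D 1).D 2).lip t
  exact (mixed_partials_eq (A := univ) (B := univ) convex_univ convex_univ
    (u := fun a b => f t a b) (u₁ := fun a b => OscFlow.D 1 f t a b)
    (u₂ := fun a b => OscFlow.D 2 f t a b)
    (u₁₂ := fun a b => OscFlow.D 2 (OscFlow.D 1 f) t a b)
    (u₂₁ := fun a b => OscFlow.D 1 (OscFlow.D 2 f) t a b) (C := C') (C' := C)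
    (fun a _ b _ => (h.hasDeriv_x _ a b).hasDerivWithinAt)
    (fun a _ b _ => (h.hasDeriv_y _ a b).hasDerivWithinAt)
    (fun a _ b _ => ((h.D 1).hasDeriv_y _ a b).hasDerivWithinAt)
    (fun a _ b _ => ((h.D 2).hasDeriv_x _ a b).hasDerivWithinAt)
    (fun a _ b _ a' _ b' _ => by simpa using hl' t le_rfl t le_rfl a' a b' b) hC'
    (fun a _ b _ a' _ b' _ => by simpa using hl t le_rfl t le_rfl a' a b' b) hC (a := θ) (b := y)
    (fun k hk => ⟨mem_univ _, mem_univ _⟩)).symm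

/-- Continuous partial derivatives give a Fréchet derivative, and they are slow profiles again, so
the order can be raised by induction. -/
lemma contDiff (h : Slow f) (t : ℝ≥0) : ContDiff ℝ ∞ fun p : ℝ × ℝ => f t p.1 p.2 := by
  rw [contDiff_infty]
  intro n
  induction n generalizing f with
  | zero =>
    exact contDiff_zero.2 (h.continuous_comp continuous_const continuous_fst continuous_snd)
  | succ n ih =>
    push_cast
    rw [contDiff_succ_iff_hasFDerivAt]
    refine ⟨fun p => (ContinuousLinearMap.toSpanSingleton ℝ (OscFlow.D 1 f t p.1 p.2)).coprod
      (ContinuousLinearMap.toSpanSingleton ℝ (OscFlow.D 2 f t p.1 p.2)), ?_, fun p => ?_⟩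
    · have h1 := ih (h.D 1)
      have h2 := ih (h.D 2)
      have e : (fun p : ℝ × ℝ => (ContinuousLinearMap.toSpanSingleton ℝ
          (OscFlow.D 1 f t p.1 p.2)).coprod (ContinuousLinearMap.toSpanSingleton ℝ
          (OscFlow.D 2 f t p.1 p.2))) = fun p : ℝ × ℝ =>
          OscFlow.D 1 f t p.1 p.2 • ContinuousLinearMap.fst ℝ ℝ ℝ +
          OscFlow.D 2 f t p.1 p.2 • ContinuousLinearMap.snd ℝ ℝ ℝ := by
        funext p
        ext <;> simp
      rw [e]
      exact (h1.smul contDiff_const).add (h2.smul contDiff_const)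
    · refine (hasStrictFDerivAt_uncurry_coprod (u := p) (f := fun a b => f t a b)
        (f₁ := fun a b => ContinuousLinearMap.toSpanSingleton ℝ (OscFlow.D 1 f t a b))
        (f₂ := fun a b => ContinuousLinearMap.toSpanSingleton ℝ (OscFlow.D 2 f t a b))
        (Eventually.of_forall fun v => (h.hasDeriv_x t v.1 v.2).hasFDerivAt)
        (Eventually.of_forall fun v => (h.hasDeriv_y t v.1 v.2).hasFDerivAt)
        ?_ ?_).hasFDerivAt
      · exact ((ContinuousLinearMap.toSpanSingletonCLE (𝕜 := ℝ) (E := ℝ)).continuous.comp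
          ((h.D 1).continuous_comp continuous_const continuous_fst continuous_snd)).continuousAt
      · exact ((ContinuousLinearMap.toSpanSingletonCLE (𝕜 := ℝ) (E := ℝ)).continuous.comp
          ((h.D 2).continuous_comp continuous_const continuous_fst continuous_snd)).continuousAt

end Slow

end

end OscFlow

namespace OscFlow

noncomputable section

/-! ### Mixed derivatives of smooth functions on the cylinder. -/

section SmoothCyl

/-- Joint smoothness of a function of `(θ, y)`. -/
def SmoothCyl (u : Cyl) : Prop := ContDiff ℝ ∞ (fun p : ℝ × ℝ => u p.1 p.2)

variable {u v : Cyl}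

lemma SmoothCyl.hasDerivAt_x (hu : SmoothCyl u) (θ y : ℝ) :
    HasDerivAt (fun s => u s y) (fderiv ℝ (fun p : ℝ × ℝ => u p.1 p.2) (θ, y) (1, 0)) θ := by
  have h1 : HasFDerivAt (fun p : ℝ × ℝ => u p.1 p.2) _ (θ, y) :=
    (ContDiff.differentiable hu (by simp)).differentiableAt.hasFDerivAt
  exact HasFDerivAt.comp_hasDerivAt (f := fun s : ℝ => (s, y)) θ h1
    ((hasDerivAt_id θ).prodMk (hasDerivAt_const θ y))

lemma SmoothCyl.hasDerivAt_y (hu : SmoothCyl u) (θ y : ℝ) :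
    HasDerivAt (fun s => u θ s) (fderiv ℝ (fun p : ℝ × ℝ => u p.1 p.2) (θ, y) (0, 1)) y := by
  have h1 : HasFDerivAt (fun p : ℝ × ℝ => u p.1 p.2) _ (θ, y) :=
    (ContDiff.differentiable hu (by simp)).differentiableAt.hasFDerivAt
  exact HasFDerivAt.comp_hasDerivAt (f := fun s : ℝ => (θ, s)) y h1
    ((hasDerivAt_const y θ).prodMk (hasDerivAt_id y))

lemma SmoothCyl.dTheta (hu : SmoothCyl u) : SmoothCyl (dTheta u) := by
  have : (fun p : ℝ × ℝ => OscFlow.dTheta u p.1 p.2) =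
      fun p => fderiv ℝ (fun p : ℝ × ℝ => u p.1 p.2) p (1, 0) :=
    funext fun p => (hu.hasDerivAt_x p.1 p.2).deriv
  rw [SmoothCyl, this]
  exact (ContDiff.fderiv_right hu (m := ∞) (by simp)).clm_apply contDiff_const

lemma SmoothCyl.dY (hu : SmoothCyl u) : SmoothCyl (dY u) := by
  have : (fun p : ℝ × ℝ => OscFlow.dY u p.1 p.2) =
      fun p => fderiv ℝ (fun p : ℝ × ℝ => u p.1 p.2) p (0, 1) :=
    funext fun p => (hu.hasDerivAt_y p.1 p.2).deriv
  rw [SmoothCyl, this]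
  exact (ContDiff.fderiv_right hu (m := ∞) (by simp)).clm_apply contDiff_const

lemma SmoothCyl.dTheta_dY (hu : SmoothCyl u) :
    OscFlow.dTheta (OscFlow.dY u) = OscFlow.dY (OscFlow.dTheta u) := by
  funext θ y
  set U : ℝ × ℝ → ℝ := fun p => u p.1 p.2 with hU
  have hd : Differentiable ℝ (fderiv ℝ U) :=
    (ContDiff.fderiv_right hu (m := ∞) (by simp)).differentiable (by simp)
  have e1 : OscFlow.dTheta (OscFlow.dY u) θ y = fderiv ℝ (fderiv ℝ U) (θ, y) (1, 0) (0, 1) := by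
    have h1 := (hu.dY.hasDerivAt_x θ y).deriv
    have : (fun p : ℝ × ℝ => OscFlow.dY u p.1 p.2) = fun p => fderiv ℝ U p (0, 1) :=
      funext fun p => (hu.hasDerivAt_y p.1 p.2).deriv
    rw [this] at h1
    rw [OscFlow.dTheta, h1, fderiv_clm_apply (hd _) (differentiableAt_const _)]
    simp
  have e2 : OscFlow.dY (OscFlow.dTheta u) θ y = fderiv ℝ (fderiv ℝ U) (θ, y) (0, 1) (1, 0) := by
    have h1 := (hu.dTheta.hasDerivAt_y θ y).deriv
    have : (fun p : ℝ × ℝ => OscFlow.dTheta u p.1 p.2) = fun p => fderiv ℝ U p (1, 0) :=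
      funext fun p => (hu.hasDerivAt_x p.1 p.2).deriv
    rw [this] at h1
    rw [OscFlow.dY, h1, fderiv_clm_apply (hd _) (differentiableAt_const _)]
    simp
  rw [e1, e2]
  have hs : IsSymmSndFDerivAt ℝ U (θ, y) :=
    (ContDiff.contDiffAt hu).isSymmSndFDerivAt (by simp [ENat.LEInfty.out])
  exact hs _ _

lemma SmoothCyl.iterate_dY (hu : SmoothCyl u) (b : ℕ) : SmoothCyl (OscFlow.dY^[b] u) := by
  induction b with
  | zero => exact hu
  | succ b ih => rw [Function.iterate_succ_apply']; exact ih.dY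

lemma dMulti_succ (a b : ℕ) (u : Cyl) : dMulti (a + 1) b u = dTheta (dMulti a b u) := by
  rw [dMulti, dMulti, Function.iterate_succ_apply']

lemma SmoothCyl.dMulti (hu : SmoothCyl u) (a b : ℕ) : SmoothCyl (dMulti a b u) := by
  induction a with
  | zero => exact hu.iterate_dY b
  | succ a ih =>
    rw [dMulti_succ]; exact ih.dTheta

lemma SmoothCyl.dMulti_dTheta (a b : ℕ) (hu : SmoothCyl u) :
    OscFlow.dMulti a b (OscFlow.dTheta u) = OscFlow.dMulti (a + 1) b u := by
  have : OscFlow.dY^[b] (OscFlow.dTheta u) = OscFlow.dTheta (OscFlow.dY^[b] u) := by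
    induction b with
    | zero => rfl
    | succ b ih =>
      rw [Function.iterate_succ_apply', ih, ← (hu.iterate_dY b).dTheta_dY,
        Function.iterate_succ_apply']
  rw [OscFlow.dMulti, this, OscFlow.dMulti, Function.iterate_succ_apply]

lemma dMulti_dY (a b : ℕ) (u : Cyl) : dMulti a b (dY u) = dMulti a (b + 1) u := by
  rw [dMulti, dMulti, Function.iterate_succ_apply]

lemma SmoothCyl.sub_smul (hu : SmoothCyl u) (hv : SmoothCyl v) (c : ℝ) :
    SmoothCyl (fun θ y => c * u θ y - v θ y) :=
  ContDiff.sub (contDiff_const.mul hu) hv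

lemma SmoothCyl.dMulti_smul_sub (hu : SmoothCyl u) (hv : SmoothCyl v) (c : ℝ) (a b : ℕ) :
    OscFlow.dMulti a b (fun θ y => c * u θ y - v θ y) =
      fun θ y => c * OscFlow.dMulti a b u θ y - OscFlow.dMulti a b v θ y := by
  have h1 : OscFlow.dY^[b] (fun θ y => c * u θ y - v θ y) =
      fun θ y => c * OscFlow.dY^[b] u θ y - OscFlow.dY^[b] v θ y := by
    induction b with
    | zero => rfl
    | succ b ih =>
      simp only [Function.iterate_succ_apply', ih]
      funext θ y
      exact ((((hu.iterate_dY b).hasDerivAt_y θ y).differentiableAt.hasDerivAt.const_mul c).sub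
        ((hv.iterate_dY b).hasDerivAt_y θ y).differentiableAt.hasDerivAt).deriv
  induction a with
  | zero => exact h1
  | succ a ih =>
    rw [dMulti_succ, dMulti_succ, dMulti_succ, ih]
    funext θ y
    exact ((((hu.dMulti a b).hasDerivAt_x θ y).differentiableAt.hasDerivAt.const_mul c).sub
        ((hv.dMulti a b).hasDerivAt_x θ y).differentiableAt.hasDerivAt).deriv

end SmoothCyl

/-! ### From majorants to `H^m` norms. -/

section Norms

instance : IsProbabilityMeasure ((volume : Measure ℝ).restrict (Ioc 0 1)) :=
  ⟨by simp⟩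

lemma Maj.sum {κ : Type*} (s : Finset κ) {g : κ → ℝ → ℝ} (h : ∀ k ∈ s, Maj (g k)) :
    Maj (fun y => ∑ k ∈ s, g k y) := by
  classical
  induction s using Finset.induction_on with
  | empty => simpa using Maj.zero
  | insert a s ha ih =>
    simp only [Finset.sum_insert ha]
    exact (h a (Finset.mem_insert_self a s)).add
      (ih fun k hk => h k (Finset.mem_insert_of_mem hk))

lemma iterate_der_apply {E : Type*} (F : E → ℝ≥0 → Cyl) (a b : ℕ) (e : E) (t : ℝ≥0) :
    (der 1)^[a] ((der 2)^[b] F) e t = dMulti a b (F e t) := by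
  have h1 : ((der 2)^[b] F) e t = dY^[b] (F e t) := by
    induction b with
    | zero => rfl
    | succ b ih => rw [Function.iterate_succ_apply', Function.iterate_succ_apply', ← ih]; rfl
  induction a with
  | zero => exact h1
  | succ a ih =>
    rw [Function.iterate_succ_apply', dMulti, Function.iterate_succ_apply']
    rw [dMulti] at ih
    rw [← ih]; rfl

lemma Reg.iterate_der {E : Type*} {ℐ : Set (Set (E × ℝ≥0))} {Δ : Set ℝ} {F : E → ℝ≥0 → Cyl}
    (h : Reg ℐ Δ F) (d : Fin 3) (n : ℕ) : Reg ℐ Δ ((OscFlow.der d)^[n] F) := by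
  induction n with
  | zero => exact h
  | succ n ih => rw [Function.iterate_succ_apply']; exact ih.der d

/-- Finitely many majorants are dominated by their sum. -/
lemma exists_maj_of_forall_le {α : Type*} (P : ℕ → ℕ → α → ℝ → ℝ → ℝ) (w : α → ℝ)
    (hw : ∀ i, 0 ≤ w i)
    (h : ∀ a b, ∃ g, Maj g ∧ ∀ i θ y, |P a b i θ y| ≤ w i * g y) (m : ℕ) :
    ∃ g, Maj g ∧ ∀ a ≤ m, ∀ b ≤ m, ∀ i θ y, |P a b i θ y| ≤ w i * g y := by
  choose g hg hb using h
  refine ⟨_, Maj.sum (Finset.range (m + 1) ×ˢ Finset.range (m + 1))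
    (g := fun k => g k.1 k.2) (fun k _ => hg k.1 k.2), fun a ha b hb' i θ y => ?_⟩
  refine (hb a b i θ y).trans (mul_le_mul_of_nonneg_left ?_ (hw i))
  exact Finset.single_le_sum (f := fun k : ℕ × ℕ => g k.1 k.2 y)
    (fun k _ => (hg k.1 k.2).nonneg y) (a := (a, b)) (by simp; omega)

lemma Reg.dMulti_maj {E : Type*} {ℐ : Set (Set (E × ℝ≥0))} {Δ : Set ℝ} {F : E → ℝ≥0 → Cyl}
    (h : Reg ℐ Δ F) {I : Set (E × ℝ≥0)} (hI : I ∈ ℐ) {δ : ℝ} (hδ : δ ∈ Δ) (m : ℕ) :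
    ∃ g, Maj g ∧ ∀ a ≤ m, ∀ b ≤ m, ∀ e t, (e, t) ∈ I → ∀ θ y,
      |dMulti a b (F e t) θ y| ≤ Real.exp (-(δ * t)) * g y := by
  obtain ⟨g, hg, hb⟩ := exists_maj_of_forall_le (α := I)
    (fun a b i => dMulti a b (F i.1.1 i.1.2)) (fun i => Real.exp (-(δ * i.1.2)))
    (fun i => (Real.exp_pos _).le) (fun a b => by
      obtain ⟨g, hg, hb⟩ := ((h.iterate_der 2 b).iterate_der 1 a).ub I hI δ hδ
      refine ⟨g, hg, fun i θ y => ?_⟩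
      rw [← iterate_der_apply]
      exact hb _ _ i.2 θ y) m
  exact ⟨g, hg, fun a ha b hb' e t he θ y => hb a ha b hb' ⟨(e, t), he⟩ θ y⟩

/-- The `H^m` norm of the majorant. -/
def majNorm (m : ℕ) (g : ℝ → ℝ) : ℝ≥0∞ :=
  ∑ k ∈ Finset.range (m + 1), ∑ _α ∈ Finset.HasAntidiagonal.antidiagonal k, eLpNorm g 2 volume

lemma Maj.majNorm_lt_top {g : ℝ → ℝ} (hg : Maj g) (m : ℕ) : majNorm m g < ⊤ :=
  ENNReal.sum_lt_top.2 fun _ _ => ENNReal.sum_lt_top.2 fun _ _ => hg.memLp.2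

/-- The circle has mass one, so the projection to `y` preserves measure and a bound uniform in `θ`
costs nothing in `L²`. -/
lemma eLpNorm_cyl_le {g : ℝ → ℝ} (hg : Maj g) {u : Cyl} {c : ℝ} (hc : 0 ≤ c)
    (hu : ∀ θ y, |u θ y| ≤ c * g y) :
    eLpNorm (fun p : ℝ × ℝ => u p.1 p.2) 2 cylMeasure ≤ ENNReal.ofReal c * eLpNorm g 2 volume := by
  calc _ ≤ eLpNorm (fun p : ℝ × ℝ => c * g p.2) 2 cylMeasure :=
        eLpNorm_mono_real fun p => hu p.1 p.2
    _ = ENNReal.ofReal c * eLpNorm (fun p : ℝ × ℝ => g p.2) 2 cylMeasure := by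
        have := eLpNorm_const_smul c (fun p : ℝ × ℝ => g p.2) 2 cylMeasure
        rw [← ofReal_norm, Real.norm_of_nonneg hc] at this
        exact this
    _ = _ := by
        rw [cylMeasure]
        congr 1
        exact eLpNorm_comp_measurePreserving (f := Prod.snd) hg.meas.aestronglyMeasurable
          measurePreserving_snd

lemma hNorm_le {g : ℝ → ℝ} (hg : Maj g) {m : ℕ} {u : Cyl} {c : ℝ} (hc : 0 ≤ c)
    (hu : ∀ a ≤ m, ∀ b ≤ m, ∀ θ y, |dMulti a b u θ y| ≤ c * g y) :
    hNorm m u ≤ ENNReal.ofReal c * majNorm m g := by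
  rw [hNorm, majNorm, Finset.mul_sum]
  refine Finset.sum_le_sum fun k hk => ?_
  rw [Finset.mul_sum]
  refine Finset.sum_le_sum fun α hα => eLpNorm_cyl_le hg hc ?_
  rw [Finset.HasAntidiagonal.mem_antidiagonal] at hα
  rw [Finset.mem_range] at hk
  exact hu _ (by omega) _ (by omega)

variable {f : ℝ≥0 → Cyl}

lemma Slow.smoothCyl (h : Slow f) (t : ℝ≥0) : SmoothCyl (f t) := h.contDiff t

lemma Slow.iterate_D (h : Slow f) (d : Fin 3) (n : ℕ) : Slow ((OscFlow.D d)^[n] f) := by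
  induction n with
  | zero => exact h
  | succ n ih => rw [Function.iterate_succ_apply']; exact ih.D d

lemma iterate_D_apply (f : ℝ≥0 → Cyl) (a b : ℕ) (t : ℝ≥0) :
    (D 1)^[a] ((D 2)^[b] f) t = dMulti a b (f t) := by
  have h1 : ((D 2)^[b] f) t = dY^[b] (f t) := by
    induction b with
    | zero => rfl
    | succ b ih => rw [Function.iterate_succ_apply', Function.iterate_succ_apply', ← ih]; rfl
  induction a with
  | zero => exact h1
  | succ a ih =>
    rw [Function.iterate_succ_apply', dMulti, Function.iterate_succ_apply']
    rw [dMulti] at ih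
    rw [← ih]; rfl

lemma Slow.D_t_iterate (h : Slow f) (a b : ℕ) :
    OscFlow.D 0 ((OscFlow.D 1)^[a] ((OscFlow.D 2)^[b] f)) =
      (OscFlow.D 1)^[a] ((OscFlow.D 2)^[b] (OscFlow.D 0 f)) := by
  have h1 : OscFlow.D 0 ((OscFlow.D 2)^[b] f) = (OscFlow.D 2)^[b] (OscFlow.D 0 f) := by
    induction b with
    | zero => rfl
    | succ b ih =>
      rw [Function.iterate_succ_apply', Function.iterate_succ_apply', ← ih,
        (h.iterate_D 2 b).D_comm_ty]
  induction a with
  | zero => exact h1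
  | succ a ih =>
    rw [Function.iterate_succ_apply', Function.iterate_succ_apply', ← ih,
        ((h.iterate_D 2 b).iterate_D 1 a).D_comm_tx]

lemma Slow.memLp (h : Slow f) (t : ℝ≥0) :
    MemLp (fun p : ℝ × ℝ => f t p.1 p.2) 2 cylMeasure := by
  obtain ⟨g, hg, hb⟩ := h.maj t
  refine ⟨(h.contDiff t).continuous.aestronglyMeasurable, ?_⟩
  refine (eLpNorm_cyl_le hg zero_le_one (fun θ y => by simpa using hb t le_rfl θ y)).trans_lt ?_
  exact ENNReal.mul_lt_top (by simp) hg.memLp.2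

lemma Slow.memHInf (h : Slow f) (t : ℝ≥0) : MemHInf (f t) := by
  refine ⟨h.per t, h.contDiff t, fun a b => ?_⟩
  rw [← iterate_D_apply]
  exact ((h.iterate_D 2 b).iterate_D 1 a).memLp t

lemma Slow.dMulti_sub_maj (h : Slow f) (T : ℝ≥0) (m : ℕ) : ∃ g, Maj g ∧ ∀ t ≤ T, ∀ s ≤ T,
    ∀ a ≤ m, ∀ b ≤ m, ∀ θ y,
      |dMulti a b (f s) θ y - dMulti a b (f t) θ y| ≤ |(s : ℝ) - t| * g y := by
  obtain ⟨g, hg, hb⟩ := exists_maj_of_forall_le (α := Iic T × Iic T)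
    (fun a b i θ y => dMulti a b (f i.2) θ y - dMulti a b (f i.1) θ y)
    (fun i => |((i.2 : ℝ≥0) : ℝ) - (i.1 : ℝ≥0)|) (fun i => abs_nonneg _) (fun a b => by
      obtain ⟨g, hg, hb⟩ := ((h.iterate_D 2 b).iterate_D 1 a).maj_sub_t T
      refine ⟨g, hg, fun i θ y => ?_⟩
      rw [← iterate_D_apply, ← iterate_D_apply, mul_comm]
      exact hb _ i.1.2 _ i.2.2 θ y) m
  exact ⟨g, hg, fun t ht s hs a ha b hb' => hb a ha b hb' ⟨⟨t, ht⟩, ⟨s, hs⟩⟩⟩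

lemma Slow.dMulti_quad_maj (h : Slow f) (T : ℝ≥0) (m : ℕ) : ∃ g, Maj g ∧ ∀ t ≤ T, ∀ s ≤ T,
    ∀ a ≤ m, ∀ b ≤ m, ∀ θ y,
      |dMulti a b (f s) θ y - dMulti a b (f t) θ y
        - ((s : ℝ) - t) * dMulti a b (OscFlow.D 0 f t) θ y| ≤ ((s : ℝ) - t) ^ 2 * g y := by
  obtain ⟨g, hg, hb⟩ := exists_maj_of_forall_le (α := Iic T × Iic T)
    (fun a b i θ y => dMulti a b (f i.2) θ y - dMulti a b (f i.1) θ y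
      - (((i.2 : ℝ≥0) : ℝ) - (i.1 : ℝ≥0)) * dMulti a b (OscFlow.D 0 f i.1) θ y)
    (fun i => (((i.2 : ℝ≥0) : ℝ) - (i.1 : ℝ≥0)) ^ 2) (fun i => sq_nonneg _) (fun a b => by
      obtain ⟨g, hg, hb⟩ := ((h.iterate_D 2 b).iterate_D 1 a).maj_quad_t T
      refine ⟨g, hg, fun i θ y => ?_⟩
      rw [← iterate_D_apply, ← iterate_D_apply, ← iterate_D_apply, ← h.D_t_iterate,
        mul_comm _ (g y)]
      exact hb _ i.1.2 _ i.2.2 θ y) m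
  exact ⟨g, hg, fun t ht s hs a ha b hb' => hb a ha b hb' ⟨⟨t, ht⟩, ⟨s, hs⟩⟩⟩

lemma tendsto_hNorm_zero {m : ℕ} {g : ℝ → ℝ} (hg : Maj g) {u : ℝ → Cyl} {l : Filter ℝ} {t : ℝ}
    (hl : l ≤ 𝓝 t) (hu : ∀ᶠ s in l, ∀ a ≤ m, ∀ b ≤ m, ∀ θ y,
      |dMulti a b (u s) θ y| ≤ |s - t| * g y) :
    Tendsto (fun s => hNorm m (u s)) l (𝓝 0) := by
  have hlim : Tendsto (fun s : ℝ => ENNReal.ofReal |s - t| * majNorm m g) l (𝓝 0) := by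
    have h1 : Tendsto (fun s : ℝ => ENNReal.ofReal |s - t|) l (𝓝 0) := by
      have : Continuous fun s : ℝ => ENNReal.ofReal |s - t| :=
        ENNReal.continuous_ofReal.comp (by fun_prop)
      simpa using (this.tendsto t).mono_left hl
    simpa using ENNReal.Tendsto.mul_const h1 (Or.inr (hg.majNorm_lt_top m).ne)
  exact tendsto_of_tendsto_of_tendsto_of_le_of_le' tendsto_const_nhds hlim
    (Eventually.of_forall fun _ => zero_le) (hu.mono fun s hs => hNorm_le hg (abs_nonneg _) hs)

/-- The curves asked for are the iterated time derivatives. Lipschitz bounds in time give their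
continuity, and quadratic remainders the convergence of the difference quotients. -/
lemma Slow.memHT (h : Slow f) (n : ℕ∞) (T : ℝ) : MemHT n T (fun t => f t.toNNReal) := by
  refine ⟨fun j t => (OscFlow.D 0)^[j] f t.toNNReal, fun t _ => rfl,
    fun j _ t ht => ⟨(h.iterate_D 0 j).memHInf _, fun m => ?_⟩, fun j _ t ht m => ?_⟩
  · have hj := h.iterate_D 0 j
    obtain ⟨g, hg, hb⟩ := hj.dMulti_sub_maj T.toNNReal m
    refine tendsto_hNorm_zero hg (t := t) nhdsWithin_le_nhds ?_
    filter_upwards [self_mem_nhdsWithin] with s hs a ha b hb' θ y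
    have := (hj.smoothCyl s.toNNReal).dMulti_smul_sub (hj.smoothCyl t.toNNReal) 1 a b
    have e : ((OscFlow.D 0)^[j] f s.toNNReal - (OscFlow.D 0)^[j] f t.toNNReal) =
      fun θ y => 1 * (OscFlow.D 0)^[j] f s.toNNReal θ y - (OscFlow.D 0)^[j] f t.toNNReal θ y := by
      funext θ y; simp
    rw [e, this]
    have := hb _ (Real.toNNReal_le_toNNReal ht.2) _ (Real.toNNReal_le_toNNReal hs.2)
      a ha b hb' θ y
    rw [Real.coe_toNNReal _ hs.1, Real.coe_toNNReal _ ht.1] at this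
    simpa using this
  · have hj := h.iterate_D 0 j
    obtain ⟨g, hg, hb⟩ := hj.dMulti_quad_maj T.toNNReal m
    refine tendsto_hNorm_zero hg (t := t) nhdsWithin_le_nhds ?_
    filter_upwards [self_mem_nhdsWithin] with s hs a ha b hb' θ y
    have hst : s - t ≠ 0 := sub_ne_zero.2 hs.2
    have e1 := (hj.smoothCyl s.toNNReal).dMulti_smul_sub (hj.smoothCyl t.toNNReal) 1 a b
    have e2 := ((hj.smoothCyl s.toNNReal).sub_smul (hj.smoothCyl t.toNNReal) 1).dMulti_smul_sub
      ((hj.D 0).smoothCyl t.toNNReal) (s - t)⁻¹ a b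
    have e : ((s - t)⁻¹ • ((OscFlow.D 0)^[j] f s.toNNReal - (OscFlow.D 0)^[j] f t.toNNReal)
        - (OscFlow.D 0)^[j + 1] f t.toNNReal) = fun θ y => (s - t)⁻¹ *
          (1 * (OscFlow.D 0)^[j] f s.toNNReal θ y - (OscFlow.D 0)^[j] f t.toNNReal θ y)
          - OscFlow.D 0 ((OscFlow.D 0)^[j] f) t.toNNReal θ y := by
      funext θ y
      simp [Function.iterate_succ_apply' (OscFlow.D 0)]
    rw [e, e2, e1]
    have := hb _ (Real.toNNReal_le_toNNReal ht.2) _ (Real.toNNReal_le_toNNReal hs.1.2)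
      a ha b hb' θ y
    rw [Real.coe_toNNReal _ hs.1.1, Real.coe_toNNReal _ ht.1] at this
    have hpos : 0 < |s - t| := abs_pos.2 hst
    have h3 : |s - t| * |(s - t)⁻¹ * (1 * dMulti a b ((OscFlow.D 0)^[j] f s.toNNReal) θ y
        - dMulti a b ((OscFlow.D 0)^[j] f t.toNNReal) θ y)
          - dMulti a b (OscFlow.D 0 ((OscFlow.D 0)^[j] f) t.toNNReal) θ y| ≤
        |s - t| * (|s - t| * g y) := by
      rw [← abs_mul, ← mul_assoc, abs_mul_abs_self, ← pow_two]
      refine le_trans (le_of_eq ?_) this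
      congr 1
      field_simp
    exact le_of_mul_le_mul_left h3 hpos

end Norms

/-! ### Multiplication by smooth functions of `θ`. -/

section Multipliers

/-- Smooth functions on the circle. -/
def SmoothPer (c : ℝ → ℝ) : Prop := ContDiff ℝ ∞ c ∧ Function.Periodic c 1

lemma SmoothPer.deriv {c : ℝ → ℝ} (hc : SmoothPer c) : SmoothPer (deriv c) := by
  refine ⟨(contDiff_infty_iff_deriv.1 hc.1).2, fun x => ?_⟩
  rw [← deriv_comp_add_const]
  congr 1
  exact funext hc.2

lemma SmoothPer.hasDerivAt {c : ℝ → ℝ} (hc : SmoothPer c) (x : ℝ) :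
    HasDerivAt c (_root_.deriv c x) x :=
  (hc.1.differentiable (by simp)).differentiableAt.hasDerivAt

lemma SmoothPer.continuous {c : ℝ → ℝ} (hc : SmoothPer c) : Continuous c := hc.1.continuous

lemma SmoothPer.bdd {c : ℝ → ℝ} (hc : SmoothPer c) : ∃ C, ∀ x, |c x| ≤ C := by
  obtain ⟨C, hC⟩ := isCompact_Icc.exists_bound_of_continuousOn (s := Icc (0 : ℝ) 1)
    hc.continuous.continuousOn
  refine ⟨C, fun x => ?_⟩
  obtain ⟨y, hy, hxy⟩ := hc.2.exists_mem_Ico₀ one_pos x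
  rw [hxy]
  exact hC y ⟨hy.1, hy.2.le⟩

variable {E : Type*} {ℐ : Set (Set (E × ℝ≥0))} {Δ : Set ℝ} {F : E → ℝ≥0 → Cyl}

lemma Reg.theta_mul (h : Reg ℐ Δ F) {c : ℝ → ℝ} (hc : SmoothPer c) :
    Reg ℐ Δ (fun e t θ y => c θ * F e t θ y) := by
  have base : ∀ {F : E → ℝ≥0 → Cyl} {c : ℝ → ℝ}, Reg ℐ Δ F → SmoothPer c →
      UB ℐ Δ (fun e t θ y => c θ * F e t θ y) ∧
      ∀ e t θ y, c (θ + 1) * F e t (θ + 1) y = c θ * F e t θ y := by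
    intro F c h hc
    obtain ⟨C, hC⟩ := hc.bdd
    refine ⟨h.ub.of_le (abs_nonneg C) fun e t θ y => ?_, fun e t θ y => by rw [hc.2, h.per]⟩
    rw [abs_mul]
    exact mul_le_mul_of_nonneg_right ((hC θ).trans (le_abs_self C)) (abs_nonneg _)
  intro n
  induction n generalizing F c with
  | zero => exact base h hc
  | succ n ih =>
    refine ⟨base h hc, fun d => ?_⟩
    have hd := h.hasDer d
    fin_cases d
    · exact ⟨_, fun e t θ y => (hd e t θ y).const_mul (c θ), ih (h.der 0) hc⟩
    · exact ⟨_, fun e t θ y => (hc.hasDerivAt θ).mul (hd e t θ y),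
        (ih h hc.deriv).add (ih (h.der 1) hc)⟩
    · exact ⟨_, fun e t θ y => (hd e t θ y).const_mul (c θ), ih (h.der 2) hc⟩

end Multipliers

end

end OscFlow

/-! ### Averages in `θ`: mean and primitive of mean zero. -/

namespace OscFlow

noncomputable section

/-- An operator that commutes with the three derivatives only has to be checked at order zero. -/
lemma Reg.of_commute {ℐ : Set (Set (Unit × ℝ≥0))} {Δ : Set ℝ} {C : (ℝ≥0 → Cyl) → Prop}
    {A : (ℝ≥0 → Cyl) → ℝ≥0 → Cyl} (hC : ∀ f, C f → ∀ d, C (D d f))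
    (hub : ∀ f, C f → UB ℐ Δ (fun _ : Unit => A f))
    (hper : ∀ f, C f → ∀ t θ y, A f t (θ + 1) y = A f t θ y)
    (hder : ∀ f, C f → ∀ d, Der d (fun _ : Unit => A f) (fun _ => A (D d f))) :
    ∀ {f}, C f → Reg ℐ Δ (fun _ : Unit => A f) := by
  intro f hf n
  induction n generalizing f with
  | zero => exact ⟨hub f hf, fun _ => hper f hf⟩
  | succ n ih => exact ⟨⟨hub f hf, fun _ => hper f hf⟩, fun d => ⟨_, hder f hf d, ih (hC f hf d)⟩⟩

lemma integral_sub_sub_const_mul {X : Type*} [MeasurableSpace X] {κ : Measure X} {u v w : X → ℝ}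
    (hu : Integrable u κ) (hv : Integrable v κ) (hw : Integrable w κ) (c : ℝ) :
    (∫ x, u x ∂κ) - (∫ x, v x ∂κ) - c * ∫ x, w x ∂κ = ∫ x, (u x - v x - c * w x) ∂κ := by
  rw [integral_sub (f := fun x => u x - v x) (hu.sub hv) (hw.const_mul _), integral_sub hu hv,
    integral_const_mul]

lemma hasDerivWithinAt_integral {X : Type*} [MeasurableSpace X] {κ : Measure X} {S : Set ℝ} {t : ℝ}
    {u : ℝ → X → ℝ} {u' b : X → ℝ} (hb : Integrable b κ) (hu : ∀ s ∈ S, Integrable (u s) κ)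
    (ht : t ∈ S) (hu' : Integrable u' κ)
    (hq : ∀ᶠ s in 𝓝[S] t, ∀ x, |u s x - u t x - (s - t) * u' x| ≤ b x * (s - t) ^ 2) :
    HasDerivWithinAt (fun s => ∫ x, u s x ∂κ) (∫ x, u' x ∂κ) S t := by
  refine hasDerivWithinAt_of_quadratic (C := ∫ x, b x ∂κ) ?_
  filter_upwards [hq, self_mem_nhdsWithin] with s hs hsS
  rw [integral_sub_sub_const_mul (hu s hsS) (hu t ht) hu', ← integral_mul_const]
  exact norm_integral_le_of_norm_le (f := fun x => u s x - u t x - (s - t) * u' x)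
    (hb.mul_const _) (Eventually.of_forall hs)

lemma Slow.integrable_comp {f : ℝ≥0 → Cyl} (h : Slow f) {X : Type*} [MeasurableSpace X]
    {κ : Measure X} {k : X → ℝ} (hk : Integrable k κ) {φ : X → ℝ≥0} {α β : X → ℝ}
    (hφ : Measurable φ) (hα : Measurable α) (hβ : Measurable β) {T : ℝ≥0} (hT : ∀ x, φ x ≤ T) :
    Integrable (fun x => k x * f (φ x) (α x) (β x)) κ := by
  obtain ⟨C, hC, hb⟩ := h.bdd T
  exact hk.mul_bdd (c := C)
    (h.continuous.measurable.comp (hφ.prodMk (hα.prodMk hβ))).aestronglyMeasurable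
    (Eventually.of_forall fun x => hb _ (hT x) _ _)

/-- Weighted average of translates in `θ`. -/
def av (k : ℝ → ℝ) (f : ℝ≥0 → Cyl) : ℝ≥0 → Cyl :=
  fun t θ y => ∫ x in Ioc (0 : ℝ) 1, k x * f t (θ + x) y

lemma integrable_av {f : ℝ≥0 → Cyl} (h : Slow f) {k : ℝ → ℝ} (hk : Continuous k) (t : ℝ≥0)
    (θ y : ℝ) : Integrable (fun x => k x * f t (θ + x) y) (volume.restrict (Ioc 0 1)) :=
  h.integrable_comp (hk.integrableOn_Ioc) measurable_const (measurable_const_add θ)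
    measurable_const (T := t) fun _ => le_rfl

lemma av_hasDer {f : ℝ≥0 → Cyl} (h : Slow f) {k : ℝ → ℝ} (hk : Continuous k) (d : Fin 3) :
    Der d (fun _ : Unit => av k f) (fun _ => av k (D d f)) := by
  have hki : Integrable (fun x => |k x|) (volume.restrict (Ioc (0 : ℝ) 1)) :=
    hk.abs.integrableOn_Ioc
  match d with
  | 0 =>
    intro _ t θ y
    obtain ⟨g, hg, hq⟩ := h.maj_quad_t (t + 1)
    refine hasDerivWithinAt_integral (b := fun x => |k x| * g y) (hki.mul_const _)
      (fun s _ => integrable_av h hk s.toNNReal θ y) t.2 (integrable_av (h.D 0) hk t θ y) ?_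
    have hn : ∀ᶠ s : ℝ in 𝓝[Ici 0] (t : ℝ), s < t + 1 :=
      mem_nhdsWithin_of_mem_nhds (gt_mem_nhds (by simp))
    filter_upwards [hn, self_mem_nhdsWithin] with s hs hs0 x
    have h2 := hq t (by simp) s.toNNReal (Real.toNNReal_le_iff_le_coe.2 (by exact_mod_cast hs.le))
      (θ + x) y
    rw [Real.coe_toNNReal _ hs0] at h2
    simp only [Real.toNNReal_coe]
    calc _ = |k x| * |f s.toNNReal (θ + x) y - f t (θ + x) y
          - (s - t) * D 0 f t (θ + x) y| := by
          rw [← abs_mul]; congr 1; ring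
      _ ≤ _ := by
          rw [mul_assoc]; exact mul_le_mul_of_nonneg_left h2 (abs_nonneg _)
  | 1 =>
    intro _ t θ y
    obtain ⟨C, hC, hq⟩ := h.quad_x t
    refine (hasDerivWithinAt_integral (S := univ) (b := fun x => |k x| * C) (hki.mul_const _)
      (fun s _ => integrable_av h hk t s y) (mem_univ _) (integrable_av (h.D 1) hk t θ y)
      (Eventually.of_forall fun s x => ?_)).hasDerivAt univ_mem
    have h2 := hq t le_rfl (θ + x) (s + x) y
    calc _ = |k x| * |f t (s + x) y - f t (θ + x) y
          - (s + x - (θ + x)) * D 1 f t (θ + x) y| := by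
          rw [← abs_mul]; congr 1; ring
      _ ≤ _ := mul_le_mul_of_nonneg_left h2 (abs_nonneg _)
      _ = _ := by ring
  | 2 =>
    intro _ t θ y
    obtain ⟨C, hC, hq⟩ := h.quad_y t
    refine (hasDerivWithinAt_integral (S := univ) (b := fun x => |k x| * C) (hki.mul_const _)
      (fun s _ => integrable_av h hk t θ s) (mem_univ _) (integrable_av (h.D 2) hk t θ y)
      (Eventually.of_forall fun s x => ?_)).hasDerivAt univ_mem
    have h2 := hq t le_rfl (θ + x) y s
    calc _ = |k x| * |f t (θ + x) s - f t (θ + x) y - (s - y) * D 2 f t (θ + x) y| := by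
          rw [← abs_mul]; congr 1; ring
      _ ≤ _ := mul_le_mul_of_nonneg_left h2 (abs_nonneg _)
      _ = _ := by ring

lemma abs_av_le {f : ℝ≥0 → Cyl} {k : ℝ → ℝ} (hk : Continuous k) {t : ℝ≥0} {y B : ℝ}
    (hB : ∀ θ, |f t θ y| ≤ B) (θ : ℝ) : |av k f t θ y| ≤ (∫ x in Ioc (0 : ℝ) 1, |k x|) * B := by
  rw [← integral_mul_const]
  have hki : Integrable (fun x => |k x|) (volume.restrict (Ioc (0 : ℝ) 1)) :=
    hk.abs.integrableOn_Ioc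
  refine norm_integral_le_of_norm_le (f := fun x => k x * f t (θ + x) y) (hki.mul_const _)
    (Eventually.of_forall fun x => ?_)
  rw [Real.norm_eq_abs, abs_mul]
  exact mul_le_mul_of_nonneg_left (hB _) (abs_nonneg _)

lemma D_av {f : ℝ≥0 → Cyl} (h : Slow f) {k : ℝ → ℝ} (hk : Continuous k) (d : Fin 3) :
    D d (av k f) = av k (D d f) :=
  congrFun (av_hasDer h hk d).eq ()

lemma Reg.avg {ℐ : Set (Set (Unit × ℝ≥0))} {Δ : Set ℝ} {f : ℝ≥0 → Cyl}
    (h : Reg ℐ Δ (fun _ : Unit => f)) (hs : Slow f) {k : ℝ → ℝ} (hk : Continuous k) :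
    Reg ℐ Δ (fun _ : Unit => av k f) := by
  refine Reg.of_commute (C := fun f => Slow f ∧ Reg ℐ Δ (fun _ : Unit => f))
    (A := av k) (fun f hf d => ⟨hf.1.D d, hf.2.der d⟩) ?_ ?_
    (fun f hf d => av_hasDer hf.1 hk d) ⟨hs, h⟩
  · intro f hf I hI δ hδ
    obtain ⟨g, hg, hb⟩ := hf.2.ub I hI δ hδ
    refine ⟨_, hg.const_mul (c := ∫ x in Ioc (0 : ℝ) 1, |k x|)
      (integral_nonneg fun x => abs_nonneg _), fun e t he θ y => ?_⟩
    rw [mul_left_comm]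
    exact abs_av_le hk (fun θ => hb e t he θ y) θ
  · intro f hf t θ y
    simp only [av]
    congr 1
    funext x
    rw [show θ + 1 + x = θ + x + 1 by ring, hf.1.per]

lemma Slow.avg {f : ℝ≥0 → Cyl} (h : Slow f) {k : ℝ → ℝ} (hk : Continuous k) : Slow (av k f) :=
  Reg.avg h h hk

/-- The mean in `θ`. -/
def Mn (f : ℝ≥0 → Cyl) : ℝ≥0 → Cyl := av (fun _ => 1) f

/-- The mean-zero primitive in `θ` of `f - Mn f`. -/
def Pr (f : ℝ≥0 → Cyl) : ℝ≥0 → Cyl := av (fun x => x - 1 / 2) f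

lemma Slow.mn {f : ℝ≥0 → Cyl} (h : Slow f) : Slow (Mn f) := h.avg continuous_const

lemma Slow.pr {f : ℝ≥0 → Cyl} (h : Slow f) : Slow (Pr f) := h.avg (by fun_prop)

lemma D_Mn {f : ℝ≥0 → Cyl} (h : Slow f) (d : Fin 3) : D d (Mn f) = Mn (D d f) :=
  D_av h continuous_const d

lemma D_Pr {f : ℝ≥0 → Cyl} (h : Slow f) (d : Fin 3) : D d (Pr f) = Pr (D d f) :=
  D_av h (by fun_prop) d

lemma Mn_apply_of_per {f : ℝ≥0 → Cyl} (hper : ∀ t θ y, f t (θ + 1) y = f t θ y) (t : ℝ≥0) (θ y : ℝ) :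
    Mn f t θ y = mean (f t) y := by
  have hp : Function.Periodic (fun x => f t x y) 1 := fun x => hper t x y
  have := hp.intervalIntegral_add_eq θ 0
  rw [zero_add] at this
  rw [mean, ← this, Mn, av, ← intervalIntegral.integral_of_le zero_le_one]
  simp [intervalIntegral.integral_comp_add_left (fun x => f t x y)]

lemma Slow.Mn_apply {f : ℝ≥0 → Cyl} (h : Slow f) (t : ℝ≥0) (θ y : ℝ) :
    Mn f t θ y = mean (f t) y := Mn_apply_of_per h.per t θ y

lemma Slow.Mn_theta {f : ℝ≥0 → Cyl} (h : Slow f) (t : ℝ≥0) (θ θ' y : ℝ) :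
    Mn f t θ y = Mn f t θ' y := by rw [h.Mn_apply, h.Mn_apply]

lemma Mn_of_const {f : ℝ≥0 → Cyl} (hf : ∀ t θ θ' y, f t θ y = f t θ' y) : Mn f = f := by
  funext t θ y
  simp only [Mn, av, one_mul, hf t (θ + _) θ y]
  simp

lemma D_x_of_const {f : ℝ≥0 → Cyl} (hf : ∀ t θ θ' y, f t θ y = f t θ' y) :
    D 1 f = fun _ _ _ => 0 := by
  funext t θ y
  have : (fun s => f t s y) = fun _ => f t 0 y := funext fun s => hf t s 0 y
  show deriv (fun s => f t s y) θ = 0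
  rw [this, deriv_const]

lemma Slow.integral_D_x {f : ℝ≥0 → Cyl} (h : Slow f) (t : ℝ≥0) (y a b : ℝ) :
    ∫ x in a..b, OscFlow.D 1 f t x y = f t b y - f t a y :=
  intervalIntegral.integral_eq_sub_of_hasDerivAt (fun x _ => h.hasDeriv_x t x y)
    (((h.D 1).continuous_comp continuous_const continuous_id continuous_const).intervalIntegrable
      _ _)

lemma Slow.Mn_D_x {f : ℝ≥0 → Cyl} (h : Slow f) : Mn (OscFlow.D 1 f) = fun _ _ _ => 0 := by
  funext t θ y
  rw [(h.D 1).Mn_apply, mean, h.integral_D_x]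
  have := h.per t 0 y
  rw [zero_add] at this
  rw [this, sub_self]

/-- Integration by parts against the weight `x - 1/2`: by periodicity the boundary terms add up to
`f` itself, and the derivative `1` of the weight leaves the mean. -/
lemma Slow.D_x_Pr {f : ℝ≥0 → Cyl} (h : Slow f) :
    OscFlow.D 1 (Pr f) = fun t θ y => f t θ y - Mn f t θ y := by
  rw [D_Pr h]
  funext t θ y
  have hd : ∀ x, HasDerivAt (fun x => f t (θ + x) y) (OscFlow.D 1 f t (θ + x) y) x := fun x => by
    simpa using (h.hasDeriv_x t (θ + x) y).comp_const_add θ x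
  have hc : ∀ {f : ℝ≥0 → Cyl}, Slow f → Continuous fun x => f t (θ + x) y := fun h =>
    h.continuous_comp continuous_const (continuous_const.add continuous_id) continuous_const
  have := intervalIntegral.integral_mul_deriv_eq_deriv_mul (a := 0) (b := 1)
    (u := fun x : ℝ => x - 1 / 2) (u' := fun _ => 1) (v := fun x => f t (θ + x) y)
    (v' := fun x => OscFlow.D 1 f t (θ + x) y)
    (fun x _ => (hasDerivAt_id x).sub_const _) (fun x _ => hd x)
    intervalIntegrable_const ((hc (h.D 1)).intervalIntegrable _ _)
  rw [Pr, av, Mn, av, ← intervalIntegral.integral_of_le zero_le_one,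
    ← intervalIntegral.integral_of_le zero_le_one, this, h.per]
  ring_nf

lemma Mn_add {f g : ℝ≥0 → Cyl} (hf : Slow f) (hg : Slow g) :
    Mn (fun t θ y => f t θ y + g t θ y) = fun t θ y => Mn f t θ y + Mn g t θ y := by
  funext t θ y
  simp only [Mn, av, mul_add]
  exact integral_add (integrable_av hf continuous_const t θ y)
    (integrable_av hg continuous_const t θ y)

lemma Mn_sub {f g : ℝ≥0 → Cyl} (hf : Slow f) (hg : Slow g) :
    Mn (fun t θ y => f t θ y - g t θ y) = fun t θ y => Mn f t θ y - Mn g t θ y := by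
  funext t θ y
  simp only [Mn, av, mul_sub]
  exact integral_sub (integrable_av hf continuous_const t θ y)
    (integrable_av hg continuous_const t θ y)

lemma Mn_const_mul (f : ℝ≥0 → Cyl) (c : ℝ) :
    Mn (fun t θ y => c * f t θ y) = fun t θ y => c * Mn f t θ y := by
  funext t θ y
  simp only [Mn, av, one_mul]
  exact integral_const_mul _ _

lemma Mn_Mn {f : ℝ≥0 → Cyl} (hf : Slow f) : Mn (Mn f) = Mn f := Mn_of_const hf.Mn_theta

/-- After exchanging the integrals the inner one is the mean of `f`, and the weight `x - 1/2` has
mean zero. -/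
lemma Slow.Mn_Pr {f : ℝ≥0 → Cyl} (h : Slow f) : Mn (Pr f) = fun _ _ _ => 0 := by
  funext t θ y
  have hc : Continuous fun p : ℝ × ℝ => (p.2 - 1 / 2) * f t (θ + p.1 + p.2) y :=
    (by fun_prop : Continuous fun p : ℝ × ℝ => p.2 - 1 / 2).mul
      (h.continuous_comp continuous_const (by fun_prop) continuous_const)
  have hi : Integrable (Function.uncurry fun x z : ℝ => (z - 1 / 2) * f t (θ + x + z) y)
      ((volume.restrict (Ioc (0 : ℝ) 1)).prod (volume.restrict (Ioc (0 : ℝ) 1))) := by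
    rw [Measure.prod_restrict]
    exact (hc.continuousOn.integrableOn_compact (isCompact_Icc.prod isCompact_Icc)).mono_set
      (prod_mono Ioc_subset_Icc_self Ioc_subset_Icc_self)
  simp only [Mn, Pr, av, one_mul]
  rw [integral_integral_swap hi]
  have : ∀ z : ℝ, ∫ x in Ioc (0 : ℝ) 1, (z - 1 / 2) * f t (θ + x + z) y =
      (z - 1 / 2) * mean (f t) y := by
    intro z
    rw [integral_const_mul, ← h.Mn_apply t (θ + z) y, Mn, av]
    simp only [one_mul, add_right_comm]
  simp only [this]
  rw [integral_mul_const, ← intervalIntegral.integral_of_le zero_le_one]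
  have : ∫ x in (0 : ℝ)..1, (x - 1 / 2) = 0 := by
    rw [intervalIntegral.integral_sub intervalIntegral.intervalIntegrable_id
      intervalIntegrable_const]
    simp
  rw [this, zero_mul]

section Frozen

variable {f : ℝ≥0 → Cyl}

lemma Slow.frozen (h : Slow f) (s : ℝ≥0) {ℐ : Set (Set (Unit × ℝ≥0))} {a : ℝ} (ha : a ≤ 0) :
    Reg ℐ (Iic a) (fun _ : Unit => fun _ => f s) := by
  intro n
  have base : ∀ {f : ℝ≥0 → Cyl}, Slow f → UB ℐ (Iic a) (fun _ : Unit => fun _ => f s) := by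
    intro f h I _ δ (hδ : δ ≤ a)
    obtain ⟨g, hg, hb⟩ := h.maj s
    refine ⟨g, hg, fun _ t _ θ y => (hb s le_rfl θ y).trans ?_⟩
    refine le_mul_of_one_le_left (hg.nonneg y) (Real.one_le_exp ?_)
    have := mul_nonneg (neg_nonneg.2 (hδ.trans ha)) (NNReal.coe_nonneg t)
    linarith
  induction n generalizing f with
  | zero => exact ⟨base h, fun _ _ => h.per s⟩
  | succ n ih =>
    refine ⟨⟨base h, fun _ _ => h.per s⟩, fun d => ?_⟩
    fin_cases d
    · exact ⟨_, fun _ t θ y => hasDerivWithinAt_const _ _ _, Reg.zero n⟩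
    · exact ⟨_, fun _ t θ y => h.hasDeriv_x s θ y, ih (h.D 1)⟩
    · exact ⟨_, fun _ t θ y => h.hasDeriv_y s θ y, ih (h.D 2)⟩

lemma Slow.freeze (h : Slow f) (s : ℝ≥0) : Slow (fun _ => f s) :=
  Reg.slow (ℐ := {univ}) (h.frozen s le_rfl) () (fun _ => ⟨univ, rfl, fun _ _ => mem_univ _⟩)
    ⟨0, mem_Iic.2 le_rfl⟩

end Frozen

end

end OscFlow

/-! ### The heat semigroup as a Gaussian average. -/

namespace OscFlow

noncomputable section

/-- The standard Gaussian measure. -/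
abbrev gauss : Measure ℝ := ProbabilityTheory.gaussianReal 0 1

lemma hasDerivAt_gaussianPDFReal (z : ℝ) :
    HasDerivAt (ProbabilityTheory.gaussianPDFReal 0 1)
      (-(z * ProbabilityTheory.gaussianPDFReal 0 1 z)) z := by
  have e : ProbabilityTheory.gaussianPDFReal 0 1 =
      fun x => (√(2 * Real.pi))⁻¹ * Real.exp (-x ^ 2 / 2) := by
    funext x
    simp [ProbabilityTheory.gaussianPDFReal_def]
  have h1 : HasDerivAt (fun x : ℝ => -x ^ 2 / 2) (-z) z :=
    ((hasDerivAt_pow 2 z).fun_neg.div_const 2).congr_deriv (by ring)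
  rw [e]
  exact (h1.exp.const_mul (√(2 * Real.pi))⁻¹).congr_deriv (by ring)

lemma integral_gauss (v : ℝ → ℝ) :
    ∫ z, v z ∂gauss = ∫ z, ProbabilityTheory.gaussianPDFReal 0 1 z * v z := by
  rw [ProbabilityTheory.integral_gaussianReal_eq_integral_smul one_ne_zero]
  rfl

lemma integrable_gauss_iff (v : ℝ → ℝ) :
    Integrable v gauss ↔ Integrable (fun z => ProbabilityTheory.gaussianPDFReal 0 1 z * v z) := by
  rw [gauss, ProbabilityTheory.gaussianReal_of_var_ne_zero 0 one_ne_zero,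
    integrable_withDensity_iff_integrable_smul₀'
    (ProbabilityTheory.measurable_gaussianPDF 0 1).aemeasurable
    (Eventually.of_forall fun _ => ProbabilityTheory.gaussianPDF_lt_top)]
  simp only [ProbabilityTheory.toReal_gaussianPDF, smul_eq_mul]

lemma integrable_abs_gauss : Integrable (fun z : ℝ => |z|) gauss :=
  ((ProbabilityTheory.memLp_id_gaussianReal (μ := 0) (v := 1) 1).integrable le_rfl).abs

lemma integrable_sq_gauss : Integrable (fun z : ℝ => z ^ 2) gauss :=
  (ProbabilityTheory.memLp_id_gaussianReal (μ := 0) (v := 1) 2).integrable_sq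

lemma integrable_gauss_of_bdd {v : ℝ → ℝ} (hv : Continuous v) {C : ℝ} (hC : ∀ z, |v z| ≤ C) :
    Integrable v gauss :=
  (integrable_const C).mono' hv.aestronglyMeasurable (Eventually.of_forall hC)

lemma integrable_mul_gauss_of_bdd {v : ℝ → ℝ} (hv : Continuous v) {C : ℝ} (hC : ∀ z, |v z| ≤ C) :
    Integrable (fun z => z * v z) gauss := by
  refine (integrable_abs_gauss.mul_const C).mono' (continuous_id.mul hv).aestronglyMeasurable
    (Eventually.of_forall fun z => ?_)
  rw [Real.norm_eq_abs, abs_mul]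
  exact mul_le_mul_of_nonneg_left (hC z) (abs_nonneg z)

/-- Gaussian integration by parts. -/
lemma integral_mul_gauss {v v' : ℝ → ℝ} (hv : ∀ z, HasDerivAt v (v' z) z) (hv' : Continuous v')
    {C : ℝ} (hC : ∀ z, |v z| ≤ C) (hC' : ∀ z, |v' z| ≤ C) :
    ∫ z, z * v z ∂gauss = ∫ z, v' z ∂gauss := by
  have hc : Continuous v := continuous_iff_continuousAt.2 fun z => (hv z).continuousAt
  have i1 := (integrable_gauss_iff _).1 (integrable_mul_gauss_of_bdd hc hC)
  have i2 := (integrable_gauss_iff _).1 (integrable_gauss_of_bdd hc hC)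
  have i3 := (integrable_gauss_iff _).1 (integrable_gauss_of_bdd hv' hC')
  have := integral_mul_deriv_eq_deriv_mul_of_integrable
    (u := ProbabilityTheory.gaussianPDFReal 0 1) (v := v) (v' := v')
    (fun x _ => hasDerivAt_gaussianPDFReal x) (fun x _ => hv x) i3
    (by
      refine i1.neg.congr (Eventually.of_forall fun z => ?_)
      simp only [Pi.neg_apply, Pi.mul_apply]; ring) i2
  rw [integral_gauss, integral_gauss, this, ← integral_neg]
  congr 1
  funext z
  ring

/-- Averages over the Gaussian measure of variance `2κr` solve the heat equation. -/
lemma integral_gauss_sub_eq {u u' u'' : ℝ → ℝ} (hu : ∀ z, HasDerivAt u (u' z) z)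
    (hu' : ∀ z, HasDerivAt u' (u'' z) z) (hc : Continuous u'') {C : ℝ} (hC : ∀ z, |u z| ≤ C)
    (hC' : ∀ z, |u' z| ≤ C) (hC'' : ∀ z, |u'' z| ≤ C) {κ : ℝ} (hκ : 0 < κ) {r : ℝ} (hr : 0 ≤ r) :
    (∫ z, u (√(2 * κ * r) * z) ∂gauss) - u 0 =
      ∫ s in (0 : ℝ)..r, κ * ∫ z, u'' (√(2 * κ * s) * z) ∂gauss := by
  have hcu : Continuous u := continuous_iff_continuousAt.2 fun z => (hu z).continuousAt
  have hcu' : Continuous u' := continuous_iff_continuousAt.2 fun z => (hu' z).continuousAt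
  have hcont : ∀ {v : ℝ → ℝ}, Continuous v → (∀ z, |v z| ≤ C) →
      Continuous fun s : ℝ => ∫ z, v (√(2 * κ * s) * z) ∂gauss := by
    intro v hv hvC
    refine continuous_of_dominated (bound := fun _ => C)
      (fun s => (hv.comp (by fun_prop)).aestronglyMeasurable)
      (fun s => Eventually.of_forall fun z => hvC _) (integrable_const C)
      (Eventually.of_forall fun z => hv.comp (by fun_prop))
  -- In terms of the standard deviation `ρ` the average is differentiable everywhere, and Gaussian
  -- integration by parts turns `z u'` into `ρ u''`.
  have hΨ : ∀ ρ : ℝ, HasDerivAt (fun ρ : ℝ => ∫ z, u (ρ * z) ∂gauss)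
      (ρ * ∫ z, u'' (ρ * z) ∂gauss) ρ := by
    intro ρ
    have h1 : HasDerivAt (fun ρ : ℝ => ∫ z, u (ρ * z) ∂gauss) (∫ z, z * u' (ρ * z) ∂gauss) ρ := by
      refine (hasDerivWithinAt_integral (S := univ) (b := fun z => C * z ^ 2)
        (integrable_sq_gauss.const_mul C)
        (fun s _ => integrable_gauss_of_bdd (hcu.comp (by fun_prop)) (fun z => hC _)) (mem_univ _)
        (integrable_mul_gauss_of_bdd (hcu'.comp (by fun_prop)) (fun z => hC' _))
        (Eventually.of_forall fun s z => ?_)).hasDerivAt univ_mem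
      have := abs_sub_sub_le_of_hasDerivWithinAt convex_univ (u := u) (u' := u') (x := s * z)
        (z := ρ * z) (C := C * |s * z - ρ * z|) (fun x _ => (hu x).hasDerivWithinAt) (mem_univ _)
        (mem_univ _) (fun x _ hle => by
          refine (abs_sub_le_of_hasDerivWithinAt convex_univ
            (fun x _ => (hu' x).hasDerivWithinAt) (fun x _ => hC'' x) (mem_univ _)
            (mem_univ _)).trans (mul_le_mul_of_nonneg_left hle ((abs_nonneg _).trans (hC 0))))
      calc _ = |u (s * z) - u (ρ * z) - (s * z - ρ * z) * u' (ρ * z)| := by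
            congr 1; simp only [Function.comp]; ring
        _ ≤ _ := this
        _ = C * (s * z - ρ * z) ^ 2 := by rw [mul_assoc, abs_mul_abs_self, pow_two]
        _ = _ := by ring
    have h2 := integral_mul_gauss (v := fun z => u' (ρ * z)) (v' := fun z => ρ * u'' (ρ * z))
      (C := max C (|ρ| * C))
      (fun z => by
        have := (hu' (ρ * z)).comp z ((hasDerivAt_id z).const_mul ρ)
        simpa [Function.comp_def, mul_comm] using this)
      (continuous_const.mul (hc.comp (by fun_prop))) (fun z => (hC' _).trans (le_max_left _ _))
      (fun z => by
        rw [abs_mul]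
        exact (mul_le_mul_of_nonneg_left (hC'' _) (abs_nonneg ρ)).trans (le_max_right _ _))
    rw [h2, integral_const_mul] at h1
    exact h1
  -- With `ρ = √(2κs)` one has `ρ ρ' = κ`. The root is not differentiable at `s = 0`; continuity
  -- there and the derivative inside suffice.
  have hmain := intervalIntegral.integral_eq_sub_of_hasDerivAt_of_le hr
    (f := fun s => ∫ z, u (√(2 * κ * s) * z) ∂gauss)
    (f' := fun s => κ * ∫ z, u'' (√(2 * κ * s) * z) ∂gauss)
    (hcont hcu hC).continuousOn (fun s hs => ?_)
    ((continuous_const.mul (hcont hc hC'')).intervalIntegrable _ _)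
  · rw [hmain]
    simp
  · have hpos : 0 < 2 * κ * s := by have := hs.1; positivity
    have hsq : HasDerivAt (fun s : ℝ => √(2 * κ * s)) (2 * κ / (2 * √(2 * κ * s))) s := by
      have := (((hasDerivAt_id s).const_mul (2 * κ)).sqrt hpos.ne')
      simpa using this
    refine (HasDerivAt.comp s (hΨ (√(2 * κ * s))) hsq).congr_deriv ?_
    have hne : √(2 * κ * s) ≠ 0 := (Real.sqrt_pos.2 hpos).ne'
    generalize (∫ z, u'' (√(2 * κ * s) * z) ∂gauss) = I
    field_simp

/-- The coordinate directions: `dir 1`, `dir 2` are the `θ` and `y` directions. -/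
def dir : Fin 3 → ℝ × ℝ
  | 1 => (1, 0)
  | _ => (0, 1)

lemma Slow.hasDeriv_dir {f : ℝ≥0 → Cyl} (h : Slow f) {d : Fin 3} (hd : d ≠ 0) (t : ℝ≥0)
    (θ y s : ℝ) : HasDerivAt (fun s => f t (θ + s * (dir d).1) (y + s * (dir d).2))
      (OscFlow.D d f t (θ + s * (dir d).1) (y + s * (dir d).2)) s := by
  match d with
  | 0 => exact absurd rfl hd
  | 1 => simpa [dir] using (h.hasDeriv_x t (θ + s) y).comp_const_add θ s
  | 2 => simpa [dir] using (h.hasDeriv_y t θ (y + s)).comp_const_add y s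

/-- The heat semigroup at time `r` in direction `d`, with diffusivity `κ`. -/
def heatAvg (κ : ℝ) (d : Fin 3) (r : ℝ) (u : Cyl) : Cyl := fun θ y =>
  ∫ z, u (θ + √(2 * κ * r) * z * (dir d).1) (y + √(2 * κ * r) * z * (dir d).2) ∂gauss

lemma heatAvg_zero (κ : ℝ) (d : Fin 3) (u : Cyl) : heatAvg κ d 0 u = u := by
  funext θ y
  simp [heatAvg]

section HeatAvg

variable {f : ℝ≥0 → Cyl} {κ : ℝ} {d : Fin 3}

lemma Slow.integrable_heatAvg (h : Slow f) (κ : ℝ) (d : Fin 3) (t : ℝ≥0) (r θ y : ℝ) :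
    Integrable (fun z => f t (θ + √(2 * κ * r) * z * (dir d).1)
      (y + √(2 * κ * r) * z * (dir d).2)) gauss := by
  obtain ⟨C, hC, hb⟩ := h.bdd t
  exact integrable_gauss_of_bdd (h.continuous_comp continuous_const (by fun_prop) (by fun_prop))
    fun z => hb t le_rfl _ _

lemma abs_heatAvg_le {u : Cyl} {C : ℝ} (hC : ∀ θ y, |u θ y| ≤ C) (r θ y : ℝ) :
    |heatAvg κ d r u θ y| ≤ C := by
  simpa [heatAvg] using norm_integral_le_of_norm_le_const (μ := gauss)
    (f := fun z => u (θ + √(2 * κ * r) * z * (dir d).1) (y + √(2 * κ * r) * z * (dir d).2))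
    (Eventually.of_forall fun z => hC _ _)

lemma abs_heatAvg_x_le {u : Cyl} {C y : ℝ} (hC : ∀ θ, |u θ y| ≤ C) (r θ : ℝ) :
    |heatAvg κ 1 r u θ y| ≤ C := by
  simpa [heatAvg, dir] using norm_integral_le_of_norm_le_const (μ := gauss)
    (f := fun z => u (θ + √(2 * κ * r) * z) y) (Eventually.of_forall fun z => hC _)

lemma Slow.heatAvg_eq (h : Slow f) (hd : d ≠ 0) (hκ : 0 < κ) (t : ℝ≥0) {r : ℝ} (hr : 0 ≤ r)
    (θ y : ℝ) : heatAvg κ d r (f t) θ y = f t θ y +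
      ∫ s in (0 : ℝ)..r, κ * heatAvg κ d s (OscFlow.D d (OscFlow.D d f) t) θ y := by
  obtain ⟨C, hC, hb⟩ := h.bdd t
  obtain ⟨C', hC', hb'⟩ := (h.D d).bdd t
  obtain ⟨C'', hC'', hb''⟩ := ((h.D d).D d).bdd t
  have := integral_gauss_sub_eq (C := C + C' + C'')
    (fun z => h.hasDeriv_dir hd t θ y z) (fun z => (h.D d).hasDeriv_dir hd t θ y z)
    (((h.D d).D d).continuous_comp continuous_const (by fun_prop) (by fun_prop))
    (fun z => (hb t le_rfl _ _).trans (by linarith))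
    (fun z => (hb' t le_rfl _ _).trans (by linarith))
    (fun z => (hb'' t le_rfl _ _).trans (by linarith)) hκ hr
  rw [sub_eq_iff_eq_add'] at this
  simpa [heatAvg] using this

lemma Slow.continuous_heatAvg (h : Slow f) (κ : ℝ) (d : Fin 3) :
    Continuous fun p : ℝ × ℝ≥0 × ℝ × ℝ => heatAvg κ d p.1 (f p.2.1) p.2.2.1 p.2.2.2 := by
  rw [continuous_iff_continuousAt]
  rintro ⟨r, t, θ, y⟩
  obtain ⟨C, hC, hb⟩ := h.bdd (t + 1)
  have hn : ∀ᶠ p : ℝ × ℝ≥0 × ℝ × ℝ in 𝓝 (r, t, θ, y), p.2.1 < t + 1 :=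
    ((by fun_prop : Continuous fun p : ℝ × ℝ≥0 × ℝ × ℝ => p.2.1).tendsto
      (r, t, θ, y)).eventually (gt_mem_nhds (by simp))
  refine continuousAt_of_dominated (bound := fun _ => C)
    (Eventually.of_forall fun p => (h.integrable_heatAvg κ d p.2.1 p.1 p.2.2.1
      p.2.2.2).aestronglyMeasurable)
    (hn.mono fun p hp => Eventually.of_forall fun z => hb _ hp.le _ _) (integrable_const C)
    (Eventually.of_forall fun z => (h.continuous_comp (by fun_prop) (by fun_prop)
      (by fun_prop)).continuousAt)

lemma Slow.hasDeriv_heatAvg_x (h : Slow f) (κ : ℝ) (d : Fin 3) (t : ℝ≥0) (r θ y : ℝ) :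
    HasDerivAt (fun s => heatAvg κ d r (f t) s y) (heatAvg κ d r (OscFlow.D 1 f t) θ y) θ := by
  obtain ⟨C, hC, hq⟩ := h.quad_x t
  refine (hasDerivWithinAt_integral (S := univ) (b := fun _ => C) (integrable_const C)
    (fun s _ => h.integrable_heatAvg κ d t r s y) (mem_univ _)
    ((h.D 1).integrable_heatAvg κ d t r θ y) (Eventually.of_forall fun s x => ?_)).hasDerivAt
    univ_mem
  have := hq t le_rfl (θ + √(2 * κ * r) * x * (dir d).1) (s + √(2 * κ * r) * x * (dir d).1)
    (y + √(2 * κ * r) * x * (dir d).2)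
  rwa [add_sub_add_right_eq_sub] at this

lemma Slow.hasDeriv_heatAvg_y (h : Slow f) (κ : ℝ) (d : Fin 3) (t : ℝ≥0) (r θ y : ℝ) :
    HasDerivAt (fun s => heatAvg κ d r (f t) θ s) (heatAvg κ d r (OscFlow.D 2 f t) θ y) y := by
  obtain ⟨C, hC, hq⟩ := h.quad_y t
  refine (hasDerivWithinAt_integral (S := univ) (b := fun _ => C) (integrable_const C)
    (fun s _ => h.integrable_heatAvg κ d t r θ s) (mem_univ _)
    ((h.D 2).integrable_heatAvg κ d t r θ y) (Eventually.of_forall fun s x => ?_)).hasDerivAt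
    univ_mem
  have := hq t le_rfl (θ + √(2 * κ * r) * x * (dir d).1) (y + √(2 * κ * r) * x * (dir d).2)
    (s + √(2 * κ * r) * x * (dir d).2)
  rwa [add_sub_add_right_eq_sub] at this

end HeatAvg

/-! ### Duhamel's integral and its regularity. -/

/-- Duhamel's integral for the heat equation in direction `d`. -/
def duhamel (κ : ℝ) (d : Fin 3) (f : ℝ≥0 → Cyl) : ℝ≥0 → Cyl := fun t θ y =>
  ∫ r in (0 : ℝ)..t, heatAvg κ d r (f ((t : ℝ) - r).toNNReal) θ y

/-- Fubini on the triangle `0 < σ < s ≤ t`, written with an indicator function. -/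
lemma integral_triangle {G : ℝ → ℝ → ℝ} (hG : Continuous (Function.uncurry G)) {t : ℝ}
    (ht : 0 ≤ t) : ∫ σ in (0 : ℝ)..t, ∫ s in σ..t, G s σ = ∫ s in (0 : ℝ)..t, ∫ σ in (0 : ℝ)..s,
      G s σ := by
  have hi : Integrable (Function.uncurry fun σ s => indicator {p : ℝ × ℝ | p.1 < p.2}
      (fun p => G p.2 p.1) (σ, s))
      ((volume.restrict (Ioc (0 : ℝ) t)).prod (volume.restrict (Ioc (0 : ℝ) t))) := by
    have hc : Continuous fun p : ℝ × ℝ => G p.2 p.1 := hG.comp continuous_swap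
    have : Integrable (fun p : ℝ × ℝ => G p.2 p.1)
        ((volume.restrict (Ioc (0 : ℝ) t)).prod (volume.restrict (Ioc (0 : ℝ) t))) := by
      rw [Measure.prod_restrict]
      exact (hc.continuousOn.integrableOn_compact (isCompact_Icc.prod isCompact_Icc)).mono_set
        (prod_mono Ioc_subset_Icc_self Ioc_subset_Icc_self)
    exact this.indicator (measurableSet_lt measurable_fst measurable_snd)
  rw [intervalIntegral.integral_of_le ht, intervalIntegral.integral_of_le ht]
  have e1 : ∫ σ in Ioc 0 t, ∫ s in σ..t, G s σ = ∫ σ in Ioc 0 t, ∫ s in Ioc 0 t,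
      indicator {p : ℝ × ℝ | p.1 < p.2} (fun p => G p.2 p.1) (σ, s) := by
    refine setIntegral_congr_fun measurableSet_Ioc fun σ hσ => ?_
    have : (fun s => indicator {p : ℝ × ℝ | p.1 < p.2} (fun p => G p.2 p.1) (σ, s)) =
        indicator (Ioi σ) (fun s => G s σ) := by
      funext s; simp [indicator]
    simp only [this]
    rw [setIntegral_indicator measurableSet_Ioi, intervalIntegral.integral_of_le hσ.2]
    congr 2
    ext s
    simp only [mem_Ioc, mem_inter_iff, mem_Ioi]
    exact ⟨fun h => ⟨⟨hσ.1.trans h.1, h.2⟩, h.1⟩, fun h => ⟨h.2, h.1.2⟩⟩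
  have e2 : ∫ s in Ioc 0 t, ∫ σ in (0 : ℝ)..s, G s σ = ∫ s in Ioc 0 t, ∫ σ in Ioc 0 t,
      indicator {p : ℝ × ℝ | p.1 < p.2} (fun p => G p.2 p.1) (σ, s) := by
    refine setIntegral_congr_fun measurableSet_Ioc fun s hs => ?_
    have : (fun σ => indicator {p : ℝ × ℝ | p.1 < p.2} (fun p => G p.2 p.1) (σ, s)) =
        indicator (Iio s) (fun σ => G s σ) := by
      funext σ; simp [indicator]
    simp only [this]
    rw [setIntegral_indicator measurableSet_Iio, intervalIntegral.integral_of_le hs.1.le,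
      integral_Ioc_eq_integral_Ioo]
    congr 2
    ext σ
    simp only [mem_Ioc, mem_inter_iff, mem_Iio, mem_Ioo]
    exact ⟨fun h => ⟨⟨h.1, h.2.le.trans hs.2⟩, h.2⟩, fun h => ⟨h.1.1, h.2⟩⟩
  rw [e1, e2, integral_integral_swap hi]

section Duhamel

variable {f : ℝ≥0 → Cyl} {κ : ℝ} {d : Fin 3}

lemma duhamel_eq (κ : ℝ) (d : Fin 3) (f : ℝ≥0 → Cyl) (t : ℝ≥0) (θ y : ℝ) :
    duhamel κ d f t θ y = ∫ σ in (0 : ℝ)..t, heatAvg κ d (t - σ) (f σ.toNNReal) θ y := by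
  have := intervalIntegral.integral_comp_sub_left (a := 0) (b := (t : ℝ))
    (fun σ : ℝ => heatAvg κ d (t - σ) (f σ.toNNReal) θ y) (t : ℝ)
  simp only [sub_sub_cancel, sub_self, sub_zero] at this
  exact this

lemma Slow.continuous_heatAvg_comp (h : Slow f) (κ : ℝ) (d : Fin 3) {X : Type*}
    [TopologicalSpace X] {a : X → ℝ} {b : X → ℝ} (ha : Continuous a) (hb : Continuous b)
    (θ y : ℝ) : Continuous fun x => heatAvg κ d (a x) (f (b x).toNNReal) θ y :=
  (h.continuous_heatAvg κ d).comp (ha.prodMk ((continuous_real_toNNReal.comp hb).prodMk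
    (continuous_const (y := θ) |>.prodMk (continuous_const (y := y)))))

lemma Slow.continuous_duhamel (h : Slow f) (κ : ℝ) (d : Fin 3) (θ y : ℝ) :
    Continuous fun s : ℝ => ∫ r in (0 : ℝ)..s, heatAvg κ d r (f (s - r).toNNReal) θ y :=
  intervalIntegral.continuous_parametric_intervalIntegral_of_continuous
    (f := fun s r => heatAvg κ d r (f (s - r).toNNReal) θ y)
    (h.continuous_heatAvg_comp κ d (by fun_prop) (by fun_prop) θ y) continuous_id

/-- Inserting `heatAvg_eq` and exchanging the two time integrals gives the heat equation in
integrated form. The fundamental theorem of calculus then yields the time derivative, one-sided at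
`0`. -/
lemma Slow.duhamel_eq_integral (h : Slow f) (hd : d ≠ 0) (hκ : 0 < κ) (t : ℝ≥0) (θ y : ℝ) :
    duhamel κ d f t θ y = ∫ s in (0 : ℝ)..t, (f s.toNNReal θ y +
      κ * ∫ r in (0 : ℝ)..s,
        heatAvg κ d r (OscFlow.D d (OscFlow.D d f) (s - r).toNNReal) θ y) := by
  set f2 := OscFlow.D d (OscFlow.D d f) with hf2
  have h2 : Slow f2 := (h.D d).D d
  have hcf : Continuous fun s : ℝ => f s.toNNReal θ y :=
    h.continuous_comp continuous_real_toNNReal continuous_const continuous_const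
  have hG : Continuous (Function.uncurry fun s σ : ℝ =>
      κ * heatAvg κ d (s - σ) (f2 σ.toNNReal) θ y) :=
    continuous_const.mul (h2.continuous_heatAvg_comp κ d (by fun_prop) (by fun_prop) θ y)
  have e1 : ∀ σ ∈ uIcc (0 : ℝ) t, heatAvg κ d (t - σ) (f σ.toNNReal) θ y =
      f σ.toNNReal θ y + ∫ s in σ..t, κ * heatAvg κ d (s - σ) (f2 σ.toNNReal) θ y := by
    intro σ hσ
    rw [uIcc_of_le t.coe_nonneg] at hσ
    rw [h.heatAvg_eq hd hκ σ.toNNReal (sub_nonneg.2 hσ.2),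
      intervalIntegral.integral_comp_sub_right
        (fun s => κ * heatAvg κ d s (f2 σ.toNNReal) θ y) σ, sub_self]
  have hc2 : Continuous fun σ : ℝ => ∫ s in σ..t, κ * heatAvg κ d (s - σ) (f2 σ.toNNReal) θ y := by
    have := intervalIntegral.continuous_parametric_intervalIntegral_of_continuous (μ := volume)
      (a₀ := (t : ℝ))
      (f := fun σ s => κ * heatAvg κ d (s - σ) (f2 σ.toNNReal) θ y)
      (hG.comp continuous_swap) continuous_id
    simp only [intervalIntegral.integral_symm (t : ℝ)]
    exact this.neg
  have hc3 : Continuous fun s : ℝ => κ * ∫ r in (0 : ℝ)..s,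
      heatAvg κ d r (f2 (s - r).toNNReal) θ y :=
    continuous_const.mul (h2.continuous_duhamel κ d θ y)
  rw [duhamel_eq, intervalIntegral.integral_congr e1,
    intervalIntegral.integral_add (hcf.intervalIntegrable _ _) (hc2.intervalIntegrable _ _),
    integral_triangle hG t.coe_nonneg, intervalIntegral.integral_add (hcf.intervalIntegrable _ _)
      (hc3.intervalIntegrable _ _)]
  congr 1
  refine intervalIntegral.integral_congr fun s hs => ?_
  rw [uIcc_of_le t.coe_nonneg] at hs
  have := duhamel_eq κ d f2 s.toNNReal θ y
  rw [duhamel, Real.coe_toNNReal _ hs.1] at this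
  simp only [this, intervalIntegral.integral_const_mul]

lemma Slow.hasDeriv_duhamel_t (h : Slow f) (hd : d ≠ 0) (hκ : 0 < κ) (t : ℝ≥0) (θ y : ℝ) :
    HasDerivWithinAt (fun s : ℝ => duhamel κ d f s.toNNReal θ y)
      (f t θ y + κ * duhamel κ d (OscFlow.D d (OscFlow.D d f)) t θ y) (Ici 0) t := by
  have hc : Continuous fun s : ℝ => f s.toNNReal θ y + κ * ∫ r in (0 : ℝ)..s,
        heatAvg κ d r (OscFlow.D d (OscFlow.D d f) (s - r).toNNReal) θ y :=
    (h.continuous_comp continuous_real_toNNReal continuous_const continuous_const).add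
      (continuous_const.mul (((h.D d).D d).continuous_duhamel κ d θ y))
  have h1 := intervalIntegral.integral_hasDerivAt_right (hc.intervalIntegrable 0 (t : ℝ))
    (hc.stronglyMeasurableAtFilter _ _) hc.continuousAt
  have h2 := h1.hasDerivWithinAt (s := Ici 0)
  simp only [Real.toNNReal_coe] at h2
  refine h2.congr (fun s hs => ?_) ?_
  · rw [h.duhamel_eq_integral hd hκ, Real.coe_toNNReal _ hs]
  · rw [h.duhamel_eq_integral hd hκ, Real.toNNReal_coe]

lemma Slow.quad_heatAvg_x (h : Slow f) (κ : ℝ) (d : Fin 3) (T : ℝ≥0) : ∃ C, 0 ≤ C ∧ ∀ t ≤ T,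
    ∀ r θ θ' y, |heatAvg κ d r (f t) θ' y - heatAvg κ d r (f t) θ y -
      (θ' - θ) * heatAvg κ d r (OscFlow.D 1 f t) θ y| ≤ C * (θ' - θ) ^ 2 := by
  obtain ⟨C, hC, hb⟩ := ((h.D 1).D 1).bdd T
  refine ⟨C, hC, fun t ht r θ θ' y => ?_⟩
  have := abs_sub_sub_le_of_hasDerivWithinAt convex_univ (C := C * |θ' - θ|) (z := θ) (x := θ')
    (fun x _ => (h.hasDeriv_heatAvg_x κ d t r x y).hasDerivWithinAt) (mem_univ _) (mem_univ _)
    (fun x _ hle => (abs_sub_le_of_hasDerivWithinAt convex_univ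
      (fun x _ => ((h.D 1).hasDeriv_heatAvg_x κ d t r x y).hasDerivWithinAt)
      (fun x _ => abs_heatAvg_le (hb t ht) r x y) (mem_univ _)
      (mem_univ _)).trans (mul_le_mul_of_nonneg_left hle hC))
  simpa [mul_assoc, abs_mul_abs_self, ← pow_two] using this

lemma Slow.quad_heatAvg_y (h : Slow f) (κ : ℝ) (d : Fin 3) (T : ℝ≥0) : ∃ C, 0 ≤ C ∧ ∀ t ≤ T,
    ∀ r θ y y', |heatAvg κ d r (f t) θ y' - heatAvg κ d r (f t) θ y -
      (y' - y) * heatAvg κ d r (OscFlow.D 2 f t) θ y| ≤ C * (y' - y) ^ 2 := by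
  obtain ⟨C, hC, hb⟩ := ((h.D 2).D 2).bdd T
  refine ⟨C, hC, fun t ht r θ y y' => ?_⟩
  have := abs_sub_sub_le_of_hasDerivWithinAt convex_univ (C := C * |y' - y|) (z := y) (x := y')
    (fun x _ => (h.hasDeriv_heatAvg_y κ d t r θ x).hasDerivWithinAt) (mem_univ _) (mem_univ _)
    (fun x _ hle => (abs_sub_le_of_hasDerivWithinAt convex_univ
      (fun x _ => ((h.D 2).hasDeriv_heatAvg_y κ d t r θ x).hasDerivWithinAt)
      (fun x _ => abs_heatAvg_le (hb t ht) r θ x) (mem_univ _)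
      (mem_univ _)).trans (mul_le_mul_of_nonneg_left hle hC))
  simpa [mul_assoc, abs_mul_abs_self, ← pow_two] using this

lemma Slow.integrable_heatAvg_Ioc (h : Slow f) (κ : ℝ) (d : Fin 3) (t : ℝ≥0) (θ y : ℝ) :
    Integrable (fun r : ℝ => heatAvg κ d r (f ((t : ℝ) - r).toNNReal) θ y)
      (volume.restrict (Ioc 0 (t : ℝ))) :=
  (h.continuous_heatAvg_comp κ d continuous_id (by fun_prop) θ y).integrableOn_Ioc

lemma toNNReal_sub_le (t : ℝ≥0) {r : ℝ} (hr : 0 ≤ r) : ((t : ℝ) - r).toNNReal ≤ t :=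
  Real.toNNReal_le_iff_le_coe.2 (by linarith)

lemma Slow.hasDeriv_duhamel_x (h : Slow f) (κ : ℝ) (d : Fin 3) (t : ℝ≥0) (θ y : ℝ) :
    HasDerivAt (fun s => duhamel κ d f t s y) (duhamel κ d (OscFlow.D 1 f) t θ y) θ := by
  obtain ⟨C, hC, hq⟩ := h.quad_heatAvg_x κ d t
  simp only [duhamel, intervalIntegral.integral_of_le t.coe_nonneg]
  refine hasDerivAt_of_quadratic (C := C * t) fun s => ?_
  rw [integral_sub_sub_const_mul (h.integrable_heatAvg_Ioc κ d t s y)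
    (h.integrable_heatAvg_Ioc κ d t θ y) ((h.D 1).integrable_heatAvg_Ioc κ d t θ y)]
  have := norm_setIntegral_le_of_norm_le_const (μ := volume) (s := Ioc 0 (t : ℝ))
    (C := C * (s - θ) ^ 2) (f := fun r => heatAvg κ d r (f ((t : ℝ) - r).toNNReal) s y -
      heatAvg κ d r (f ((t : ℝ) - r).toNNReal) θ y -
      (s - θ) * heatAvg κ d r (OscFlow.D 1 f ((t : ℝ) - r).toNNReal) θ y) (by simp)
    (fun r hr => hq _ (toNNReal_sub_le t hr.1.le) r θ s y)
  refine this.trans_eq ?_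
  simp
  ring

lemma Slow.hasDeriv_duhamel_y (h : Slow f) (κ : ℝ) (d : Fin 3) (t : ℝ≥0) (θ y : ℝ) :
    HasDerivAt (fun s => duhamel κ d f t θ s) (duhamel κ d (OscFlow.D 2 f) t θ y) y := by
  obtain ⟨C, hC, hq⟩ := h.quad_heatAvg_y κ d t
  simp only [duhamel, intervalIntegral.integral_of_le t.coe_nonneg]
  refine hasDerivAt_of_quadratic (C := C * t) fun s => ?_
  rw [integral_sub_sub_const_mul (h.integrable_heatAvg_Ioc κ d t θ s)
    (h.integrable_heatAvg_Ioc κ d t θ y) ((h.D 2).integrable_heatAvg_Ioc κ d t θ y)]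
  have := norm_setIntegral_le_of_norm_le_const (μ := volume) (s := Ioc 0 (t : ℝ))
    (C := C * (s - y) ^ 2) (f := fun r => heatAvg κ d r (f ((t : ℝ) - r).toNNReal) θ s -
      heatAvg κ d r (f ((t : ℝ) - r).toNNReal) θ y -
      (s - y) * heatAvg κ d r (OscFlow.D 2 f ((t : ℝ) - r).toNNReal) θ y) (by simp)
    (fun r hr => hq _ (toNNReal_sub_le t hr.1.le) r θ y s)
  refine this.trans_eq ?_
  simp
  ring

lemma heatAvg_per {u : Cyl} (hu : ∀ θ y, u (θ + 1) y = u θ y) (r θ y : ℝ) :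
    heatAvg κ d r u (θ + 1) y = heatAvg κ d r u θ y := by
  simp only [heatAvg, add_right_comm θ 1, hu]

lemma duhamel_per (h : Slow f) (t : ℝ≥0) (θ y : ℝ) :
    duhamel κ d f t (θ + 1) y = duhamel κ d f t θ y := by
  simp only [duhamel, heatAvg_per (h.per _)]

/-- The time derivative consists of a multiple of the source and a multiple of another Duhamel
integral. Carrying the factor `c` makes the class of multiples closed under differentiation up to
regular terms, as `Reg.of_closed` requires. -/
lemma Slow.duhamel_hasDer (h : Slow f) (hd : d ≠ 0) (hκ : 0 < κ) (c : ℝ) (i : Fin 3) :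
    ∃ G H : Unit → ℝ≥0 → Cyl, Der i (fun _ t θ y => c * duhamel κ d f t θ y)
      (fun e t θ y => G e t θ y + H e t θ y) ∧
      ((i = 0 ∧ G = (fun _ t θ y => c * f t θ y) ∧
        H = fun _ t θ y => (c * κ) * duhamel κ d (OscFlow.D d (OscFlow.D d f)) t θ y) ∨
      (G = (fun _ _ _ _ => 0) ∧ H = fun _ t θ y => c * duhamel κ d (OscFlow.D i f) t θ y)) := by
  match i with
  | 0 =>
    refine ⟨_, _, ?_, Or.inl ⟨rfl, rfl, rfl⟩⟩
    intro _ t θ y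
    exact ((h.hasDeriv_duhamel_t hd hκ t θ y).const_mul c).congr_deriv (by ring)
  | 1 =>
    refine ⟨_, _, ?_, Or.inr ⟨rfl, rfl⟩⟩
    intro _ t θ y
    exact ((h.hasDeriv_duhamel_x κ d t θ y).const_mul c).congr_deriv (by ring)
  | 2 =>
    refine ⟨_, _, ?_, Or.inr ⟨rfl, rfl⟩⟩
    intro _ t θ y
    exact ((h.hasDeriv_duhamel_y κ d t θ y).const_mul c).congr_deriv (by ring)

/-- Regularity of Duhamel's integral in a class of sources `P` for which it has majorants. -/
lemma Slow.duhamel_reg_of {ℐ : Set (Set (Unit × ℝ≥0))} {Δ : Set ℝ} {P : (ℝ≥0 → Cyl) → Prop}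
    (hP : ∀ f, P f → Slow f) (hreg : ∀ f, P f → Reg ℐ Δ (fun _ : Unit => f))
    (hPD : ∀ f, P f → ∀ i, P (OscFlow.D i f)) (hd : d ≠ 0) (hκ : 0 < κ)
    (hub : ∀ f, P f → UB ℐ Δ (fun _ : Unit => duhamel κ d f)) (hf : P f) :
    Reg ℐ Δ (fun _ : Unit => duhamel κ d f) := by
  have := Reg.of_closed (ℐ := ℐ) (Δ := Δ) (fun F => ∃ c f, P f ∧
    F = fun (_ : Unit) t θ y => c * duhamel κ d f t θ y) ?_ ?_ ?_ _ ⟨1, f, hf, rfl⟩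
  · simpa using this
  · rintro _ ⟨c, f, hf, rfl⟩
    exact (hub f hf).of_le (abs_nonneg c) fun e t θ y => (abs_mul _ _).le
  · rintro _ ⟨c, f, hf, rfl⟩ e t θ y
    simp only [duhamel_per (hP f hf)]
  · rintro _ ⟨c, f, hf, rfl⟩ i
    obtain ⟨G, H, hder, ⟨-, rfl, rfl⟩ | ⟨rfl, rfl⟩⟩ := (hP f hf).duhamel_hasDer hd hκ c i
    · exact ⟨_, _, hder, (hreg f hf).const_mul c, ⟨_, _, hPD _ (hPD _ hf d) d, rfl⟩⟩
    · exact ⟨_, _, hder, Reg.zero, ⟨_, _, hPD _ hf i, rfl⟩⟩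

lemma Maj.integrable_comp {g : ℝ → ℝ} (hg : Maj g) {X : Type*} [MeasurableSpace X] (ν : Measure X)
    [IsFiniteMeasure ν] {σ : X → ℝ} (hσ : Measurable σ) (y : ℝ) :
    Integrable (fun x => g (y + σ x)) ν := by
  obtain ⟨C, hC, hb⟩ := hg.bdd
  exact (integrable_const C).mono' (hg.meas.comp (measurable_const.add hσ)).aestronglyMeasurable
    (Eventually.of_forall fun x => by
      rw [Real.norm_eq_abs, abs_of_nonneg (hg.nonneg _)]; exact hb _)

/-- Averages of translates of a majorant are majorants. -/
lemma Maj.average {g : ℝ → ℝ} (hg : Maj g) {X : Type*} [MeasurableSpace X] (ν : Measure X)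
    [IsFiniteMeasure ν] {σ : X → ℝ} (hσ : Measurable σ) :
    Maj (fun y => ∫ x, g (y + σ x) ∂ν) := by
  obtain ⟨C, hC, hb⟩ := hg.bdd
  have hm : Measurable fun p : ℝ × X => g (p.1 + σ p.2) :=
    hg.meas.comp (measurable_fst.add (hσ.comp measurable_snd))
  have hmeas : StronglyMeasurable fun y => ∫ x, g (y + σ x) ∂ν :=
    hm.stronglyMeasurable.integral_prod_right
  refine ⟨fun y => integral_nonneg fun x => hg.nonneg _, hmeas.measurable,
    ⟨ν.real univ * C, by positivity, fun y => ?_⟩, ?_⟩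
  · refine (integral_mono (hg.integrable_comp ν hσ y) (integrable_const C)
      fun x => hb _).trans_eq ?_
    simp
  · refine (memLp_two_iff_integrable_sq hmeas.aestronglyMeasurable).2 ?_
    have hsq : Integrable (fun y => g y ^ 2) := hg.memLp.integrable_sq
    have hi : Integrable (fun p : ℝ × X => g (p.1 + σ p.2) ^ 2) (volume.prod ν) := by
      refine (integrable_prod_iff' (hm.pow_const 2).aestronglyMeasurable).2
        ⟨Eventually.of_forall fun x => hsq.comp_add_right (σ x), ?_⟩
      have : ∀ x, ∫ y, ‖g (y + σ x) ^ 2‖ = ∫ y, g y ^ 2 := by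
        intro x
        simp only [norm_pow, Real.norm_eq_abs, sq_abs]
        exact integral_add_right_eq_self (fun y => g y ^ 2) (σ x)
      simp only [this]
      exact integrable_const _
    refine (hi.integral_prod_left.const_mul (ν.real univ)).mono'
      (hmeas.measurable.pow_const 2).aestronglyMeasurable (Eventually.of_forall fun y => ?_)
    rw [Real.norm_eq_abs, abs_of_nonneg (sq_nonneg _)]
    have hig := hg.integrable_comp ν hσ y
    have hig2 : Integrable (fun x => g (y + σ x) ^ 2) ν := by
      refine (integrable_const (C ^ 2)).mono'
        ((hg.meas.comp (measurable_const.add hσ)).pow_const 2).aestronglyMeasurable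
        (Eventually.of_forall fun x => ?_)
      rw [Real.norm_eq_abs, abs_of_nonneg (sq_nonneg _)]
      exact pow_le_pow_left₀ (hg.nonneg _) (hb _) 2
    set m := ∫ x, g (y + σ x) ∂ν with hmdef
    set N := ν.real univ with hN
    -- `0 ≤ ∫ (N g - m)² = N (N ∫ g² - m²)`
    have hexp : ∫ x, (N * g (y + σ x) - m) ^ 2 ∂ν =
        N * (N * ∫ x, g (y + σ x) ^ 2 ∂ν - m ^ 2) := by
      have : ∀ x, (N * g (y + σ x) - m) ^ 2 =
          N ^ 2 * g (y + σ x) ^ 2 - 2 * N * m * g (y + σ x) + m ^ 2 := fun x => by ring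
      simp only [this]
      rw [integral_add (f := fun x => N ^ 2 * g (y + σ x) ^ 2 - 2 * N * m * g (y + σ x))
        ((hig2.const_mul _).sub (hig.const_mul _)) (integrable_const _),
        integral_sub (hig2.const_mul _) (hig.const_mul _), integral_const_mul, integral_const_mul,
        integral_const, ← hmdef, smul_eq_mul, ← hN]
      ring
    have hpos : 0 ≤ N * (N * ∫ x, g (y + σ x) ^ 2 ∂ν - m ^ 2) := by
      rw [← hexp]; exact integral_nonneg fun x => sq_nonneg _
    -- The mass `N` can be cancelled only if it is positive; the zero measure is treated apart.
    rcases (measureReal_nonneg (μ := ν) (s := univ)).eq_or_lt with h0 | h0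
    · have hν : ν = 0 := by
        have := (measureReal_eq_zero_iff (μ := ν) (s := univ)).1 h0.symm
        exact Measure.measure_univ_eq_zero.1 this
      have : m = 0 := by rw [hmdef, hν, integral_zero_measure]
      rw [this]
      have : N = 0 := h0.symm
      rw [this]; simp
    · have := nonneg_of_mul_nonneg_right hpos h0
      linarith

/-- The heat flow in `y` moves mass along the line, so a majorant of the source need not bound the
solution. Its translates, integrated over the times up to `T` and the Gaussian variable, do. -/
lemma Slow.duhamel_y (h : Slow f) (hκ : 0 < κ) : Slow (duhamel κ 2 f) := by
  refine Slow.duhamel_reg_of (P := Slow) (fun f hf => hf) (fun f hf => hf) (fun f hf i => hf.D i)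
    (by decide) hκ (fun f hf => ?_) h
  rintro _ ⟨T, rfl⟩ δ rfl
  obtain ⟨g, hg, hb⟩ := hf.maj T
  have hσ : Measurable fun p : ℝ × ℝ => √(2 * κ * p.1) * p.2 := by fun_prop
  refine ⟨_, hg.average ((volume.restrict (Ioc (0 : ℝ) T)).prod gauss) hσ,
    fun _ t (ht : t ≤ T) θ y => ?_⟩
  simp only [zero_mul, neg_zero, Real.exp_zero, one_mul]
  have hint := hg.integrable_comp ((volume.restrict (Ioc (0 : ℝ) T)).prod gauss) hσ y
  rw [integral_prod _ hint, duhamel, intervalIntegral.integral_of_le t.coe_nonneg]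
  have hint2 := hint.integral_prod_left
  have hsub : Ioc (0 : ℝ) t ⊆ Ioc (0 : ℝ) T := Ioc_subset_Ioc_right (by exact_mod_cast ht)
  refine (norm_integral_le_of_norm_le (μ := volume.restrict (Ioc 0 (t : ℝ)))
    (f := fun r => heatAvg κ 2 r (f ((t : ℝ) - r).toNNReal) θ y)
    (hint2.mono_measure (Measure.restrict_mono hsub le_rfl)) ?_).trans (setIntegral_mono_set hint2 (Eventually.of_forall fun r =>
      integral_nonneg fun z => hg.nonneg _) hsub.eventuallyLE)
  refine (ae_restrict_iff' measurableSet_Ioc).2 (Eventually.of_forall fun r hr => ?_)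
  have hr' := (toNNReal_sub_le t hr.1.le).trans ht
  refine norm_integral_le_of_norm_le (μ := gauss)
    (f := fun z => f ((t : ℝ) - r).toNNReal (θ + √(2 * κ * r) * z * (dir 2).1)
      (y + √(2 * κ * r) * z * (dir 2).2)) (hg.integrable_comp gauss (by fun_prop) y)
    (Eventually.of_forall fun z => ?_)
  simpa [dir] using hb _ hr' θ (y + √(2 * κ * r) * z)

end Duhamel

end

end OscFlow

namespace OscFlow

noncomputable section

/-! ### Calculus rules for slow profiles. -/

section Rules

variable {f g : ℝ≥0 → Cyl}

lemma D_add (hf : Slow f) (hg : Slow g) (d : Fin 3) :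
    D d (fun t θ y => f t θ y + g t θ y) = fun t θ y => D d f t θ y + D d g t θ y :=
  congrFun ((Reg.hasDer hf d).add (Reg.hasDer hg d)).eq ()

lemma D_const_mul (hf : Slow f) (c : ℝ) (d : Fin 3) :
    D d (fun t θ y => c * f t θ y) = fun t θ y => c * D d f t θ y :=
  congrFun ((Reg.hasDer hf d).const_mul (fun _ => c)).eq ()

lemma D_sub (hf : Slow f) (hg : Slow g) (d : Fin 3) :
    D d (fun t θ y => f t θ y - g t θ y) = fun t θ y => D d f t θ y - D d g t θ y := by
  have := congrFun ((Reg.hasDer hf d).add ((Reg.hasDer hg d).const_mul (fun _ => -1))).eq ()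
  simp only [neg_mul, one_mul, ← sub_eq_add_neg] at this
  exact this

lemma D_mul (hf : Slow f) (hg : Slow g) (d : Fin 3) :
    D d (fun t θ y => f t θ y * g t θ y) =
      fun t θ y => D d f t θ y * g t θ y + f t θ y * D d g t θ y :=
  congrFun ((Reg.hasDer hf d).mul (Reg.hasDer hg d)).eq ()

lemma D_zero (d : Fin 3) : D d (fun _ _ _ => 0) = fun _ _ _ => 0 :=
  congrFun (Der.zero (E := Unit) (d := d)).eq ()

lemma Slow.add (hf : Slow f) (hg : Slow g) : Slow (fun t θ y => f t θ y + g t θ y) :=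
  Reg.add hf hg

lemma Slow.sub (hf : Slow f) (hg : Slow g) : Slow (fun t θ y => f t θ y - g t θ y) :=
  Reg.sub hf hg

lemma Slow.const_mul (hf : Slow f) (c : ℝ) : Slow (fun t θ y => c * f t θ y) :=
  Reg.const_mul hf c

lemma Slow.mul (hf : Slow f) (hg : Slow g) : Slow (fun t θ y => f t θ y * g t θ y) :=
  Reg.mul (show RateMul {0} {0} {0} from
    fun δ hδ => ⟨0, rfl, 0, rfl, by simp [mem_singleton_iff.1 hδ]⟩) hf hg

lemma Slow.zero : Slow (fun _ _ _ => 0) := Reg.zero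

lemma eq_initial_of_D_t_eq_zero (hf : Slow f) (h0 : D 0 f = fun _ _ _ => 0) (t : ℝ≥0) :
    f t = f 0 := by
  funext θ y
  have := abs_sub_le_of_hasDerivWithinAt (convex_Ici (0 : ℝ))
    (u := fun s : ℝ => f s.toNNReal θ y) (u' := fun _ => 0) (C := 0) (fun x hx => by
      have := hf.hasDeriv_t x.toNNReal θ y
      rwa [h0, Real.coe_toNNReal _ hx] at this) (fun x _ => by simp) (x := t) (z := 0)
    t.coe_nonneg self_mem_Ici
  simp only [Real.toNNReal_coe, Real.toNNReal_zero, zero_mul] at this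
  exact sub_eq_zero.1 (abs_nonpos_iff.1 this)

end Rules

/-! ### Poincaré inequality and decay of the heat flow on the circle. -/

section Poincare

variable {u : ℝ≥0 → Cyl}

lemma sq_integral_Ioc_le {w : ℝ → ℝ} (hw : Continuous w) :
    (∫ x in Ioc (0 : ℝ) 1, w x) ^ 2 ≤ ∫ x in Ioc (0 : ℝ) 1, w x ^ 2 := by
  have h1 : Integrable w (volume.restrict (Ioc (0 : ℝ) 1)) := hw.integrableOn_Ioc
  have h2 : Integrable (fun x => w x ^ 2) (volume.restrict (Ioc (0 : ℝ) 1)) :=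
    (hw.pow 2).integrableOn_Ioc
  set m := ∫ x in Ioc (0 : ℝ) 1, w x with hm
  have h3 : 0 ≤ ∫ x in Ioc (0 : ℝ) 1, (w x - m) ^ 2 := integral_nonneg fun x => sq_nonneg _
  have h4 : ∀ x, (w x - m) ^ 2 = w x ^ 2 - 2 * m * w x + m ^ 2 := fun x => by ring
  simp only [h4] at h3
  rw [integral_add (f := fun x => w x ^ 2 - 2 * m * w x) (h2.sub (h1.const_mul _))
    (integrable_const _), integral_sub h2 (h1.const_mul _), integral_const_mul, ← hm,
    integral_const] at h3
  simp at h3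
  nlinarith

/-- A function of mean zero differs from its mean by at most `∫ |∂_θ u|`, and Cauchy–Schwarz gives
the square. The constant `1` is not sharp, but it gives exactly the rate `μ` that is needed. -/
lemma Slow.poincare (h : Slow u) (hm : Mn u = fun _ _ _ => 0) (t : ℝ≥0) (θ y : ℝ) :
    u t θ y ^ 2 ≤ Mn (fun t θ y => OscFlow.D 1 u t θ y * OscFlow.D 1 u t θ y) t θ y := by
  have hc : ∀ {f : ℝ≥0 → Cyl}, Slow f → Continuous fun x => f t (θ + x) y := fun h =>
    h.continuous_comp continuous_const (continuous_const.add continuous_id) continuous_const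
  have hi : Integrable (fun x => |OscFlow.D 1 u t (θ + x) y|)
    (volume.restrict (Ioc (0 : ℝ) 1)) := (hc (h.D 1)).abs.integrableOn_Ioc
  have hiu : Integrable (fun x => u t (θ + x) y) (volume.restrict (Ioc (0 : ℝ) 1)) :=
    (hc h).integrableOn_Ioc
  have h1 : ∀ x ∈ Ioc (0 : ℝ) 1, |u t θ y - u t (θ + x) y| ≤
      ∫ x in Ioc (0 : ℝ) 1, |OscFlow.D 1 u t (θ + x) y| := by
    intro x hx
    have e := intervalIntegral.integral_comp_add_left (a := 0) (b := x)
      (fun x => OscFlow.D 1 u t x y) θ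
    rw [h.integral_D_x, add_zero] at e
    rw [abs_sub_comm, ← e, intervalIntegral.integral_of_le hx.1.le]
    refine (abs_integral_le_integral_abs).trans (setIntegral_mono_set hi
      (Eventually.of_forall fun x => abs_nonneg _) ?_)
    exact (Ioc_subset_Ioc_right hx.2).eventuallyLE
  have h2 : |u t θ y| ≤ ∫ x in Ioc (0 : ℝ) 1, |OscFlow.D 1 u t (θ + x) y| := by
    have hm0 : ∫ x in Ioc (0 : ℝ) 1, u t (θ + x) y = 0 := by
      have := congrFun (congrFun (congrFun hm t) θ) y
      simpa [Mn, av] using this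
    have e : u t θ y = ∫ x in Ioc (0 : ℝ) 1, (u t θ y - u t (θ + x) y) := by
      rw [integral_sub (integrable_const _) hiu, hm0]
      simp
    rw [e]
    have := norm_setIntegral_le_of_norm_le_const (μ := volume) (s := Ioc (0 : ℝ) 1)
      (f := fun x => u t θ y - u t (θ + x) y) (by simp) h1
    simpa using this
  calc u t θ y ^ 2 = |u t θ y| ^ 2 := (sq_abs _).symm
    _ ≤ (∫ x in Ioc (0 : ℝ) 1, |OscFlow.D 1 u t (θ + x) y|) ^ 2 :=
      pow_le_pow_left₀ (abs_nonneg _) h2 2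
    _ ≤ ∫ x in Ioc (0 : ℝ) 1, |OscFlow.D 1 u t (θ + x) y| ^ 2 :=
      sq_integral_Ioc_le (hc (h.D 1)).abs
    _ = _ := by simp [Mn, av, pow_two]

lemma Mn_le_of_le {f : ℝ≥0 → Cyl} (hf : Slow f) {t : ℝ≥0} {y B : ℝ} (hB : ∀ θ, f t θ y ≤ B)
    (θ : ℝ) : Mn f t θ y ≤ B := by
  have := integral_mono (μ := volume.restrict (Ioc (0 : ℝ) 1))
    (integrable_av hf continuous_const (k := fun _ => 1) t θ y) (integrable_const B)
    (fun x => by simpa using hB _)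
  simpa [Mn, av] using this

end Poincare

section HeatX

variable {z : ℝ≥0 → Cyl} {κ : ℝ}

/-- The solution of the heat equation in `θ` with initial value `z 0`. -/
def heatX (κ : ℝ) (z : ℝ≥0 → Cyl) : ℝ≥0 → Cyl := fun t => heatAvg κ 1 t (z 0)

lemma Slow.hasDeriv_heatX_t (h : Slow z) (hκ : 0 < κ) (t : ℝ≥0) (θ y : ℝ) :
    HasDerivWithinAt (fun s : ℝ => heatX κ z s.toNNReal θ y)
      (κ * heatX κ (OscFlow.D 1 (OscFlow.D 1 z)) t θ y) (Ici 0) t := by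
  have hc : Continuous fun s : ℝ => κ * heatAvg κ 1 s (OscFlow.D 1 (OscFlow.D 1 z) 0) θ y := by
    have := ((h.D 1).D 1).continuous_heatAvg_comp κ 1 (a := fun s : ℝ => s) (b := fun _ => 0)
      continuous_id continuous_const θ y
    simp only [Real.toNNReal_zero] at this
    exact continuous_const.mul this
  have h1 := intervalIntegral.integral_hasDerivAt_right (hc.intervalIntegrable 0 (t : ℝ))
    (hc.stronglyMeasurableAtFilter _ _) hc.continuousAt
  refine (h1.hasDerivWithinAt.const_add (z 0 θ y)).congr (fun s hs => ?_) ?_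
  · rw [heatX, Real.coe_toNNReal _ hs, h.heatAvg_eq (by decide) hκ 0 hs]
  · rw [heatX, Real.toNNReal_coe, h.heatAvg_eq (by decide) hκ 0 t.coe_nonneg]

/-- Regularity of the heat flow in `θ` in a class of initial data with majorants. -/
lemma Slow.heatX_reg_of {ℐ : Set (Set (Unit × ℝ≥0))} {Δ : Set ℝ} {P : (ℝ≥0 → Cyl) → Prop}
    (hP : ∀ f, P f → Slow f) (hPD : ∀ f, P f → ∀ i, P (OscFlow.D i f)) (hκ : 0 < κ)
    (hub : ∀ f, P f → UB ℐ Δ (fun _ : Unit => heatX κ f)) (hz : P z) :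
    Reg ℐ Δ (fun _ : Unit => heatX κ z) := by
  have := Reg.of_closed (ℐ := ℐ) (Δ := Δ) (fun F => ∃ c f, P f ∧
    F = fun (_ : Unit) t θ y => c * heatX κ f t θ y) ?_ ?_ ?_ _ ⟨1, z, hz, rfl⟩
  · simpa using this
  · rintro _ ⟨c, f, hf, rfl⟩
    exact (hub f hf).of_le (abs_nonneg c) fun e t θ y => (abs_mul _ _).le
  · rintro _ ⟨c, f, hf, rfl⟩ e t θ y
    simp only [heatX, heatAvg_per ((hP f hf).per _)]
  · rintro _ ⟨c, f, hf, rfl⟩ i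
    match i with
    | 0 =>
      refine ⟨_, _, fun _ t θ y => ?_, Reg.zero, ⟨c * κ, _, hPD _ (hPD _ hf 1) 1, rfl⟩⟩
      exact (((hP f hf).hasDeriv_heatX_t hκ t θ y).const_mul c).congr_deriv (by ring)
    | 1 =>
      refine ⟨_, _, fun _ t θ y => ?_, Reg.zero, ⟨c, _, hPD _ hf 1, rfl⟩⟩
      exact (((hP f hf).hasDeriv_heatAvg_x κ 1 0 t θ y).const_mul c).congr_deriv
        (by simp only [heatX, zero_add])
    | 2 =>
      refine ⟨_, _, fun _ t θ y => ?_, Reg.zero, ⟨c, _, hPD _ hf 2, rfl⟩⟩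
      exact (((hP f hf).hasDeriv_heatAvg_y κ 1 0 t θ y).const_mul c).congr_deriv
        (by simp only [heatX, zero_add])

lemma Slow.heatX (h : Slow z) (hκ : 0 < κ) : Slow (heatX κ z) := by
  refine Slow.heatX_reg_of (P := Slow) (fun f hf => hf) (fun f hf i => hf.D i) hκ
    (fun f hf => ?_) h
  rintro _ ⟨T, rfl⟩ δ rfl
  obtain ⟨g, hg, hb⟩ := hf.maj 0
  refine ⟨g, hg, fun _ t _ θ y => ?_⟩
  simpa [OscFlow.heatX] using abs_heatAvg_x_le (fun θ => hb 0 le_rfl θ y) t θ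

lemma Slow.D_x_heatX (h : Slow z) : OscFlow.D 1 (OscFlow.heatX κ z) =
    OscFlow.heatX κ (OscFlow.D 1 z) := by
  funext t θ y
  exact (h.hasDeriv_heatAvg_x κ 1 0 t θ y).deriv

lemma Slow.D_t_heatX (h : Slow z) (hκ : 0 < κ) : OscFlow.D 0 (OscFlow.heatX κ z) =
    fun t θ y => κ * OscFlow.D 1 (OscFlow.D 1 (OscFlow.heatX κ z)) t θ y := by
  rw [h.D_x_heatX, (h.D 1).D_x_heatX]
  funext t θ y
  exact (h.hasDeriv_heatX_t hκ t θ y).derivWithin (uniqueDiffOn_Ici 0 _ t.coe_nonneg)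

lemma Mn_D_eq_zero (h : Slow z) (hm : Mn z = fun _ _ _ => 0) (d : Fin 3) :
    Mn (D d z) = fun _ _ _ => 0 := by
  rw [← D_Mn h, hm, D_zero]

lemma Slow.Mn_heatX (h : Slow z) (hκ : 0 < κ) (hm : Mn z = fun _ _ _ => 0) :
    Mn (OscFlow.heatX κ z) = fun _ _ _ => 0 := by
  have hs := h.heatX hκ
  funext t
  rw [eq_initial_of_D_t_eq_zero hs.mn _ t]
  · have : OscFlow.heatX κ z 0 = z 0 := by
      simp [OscFlow.heatX, heatAvg_zero]
    have h2 : Mn (OscFlow.heatX κ z) 0 = Mn z 0 := by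
      funext θ y; simp only [Mn, av, this]
    rw [h2, hm]
  · rw [D_Mn hs, h.D_t_heatX hκ, Mn_const_mul, ((hs.D 1)).Mn_D_x]
    simp

/-- `∂_t Π(u²) = -2κ Π((∂_θ u)²) ≤ -2κ Π(u²)` by Poincaré, with `y` as a mere parameter; hence
`e^{2κt} Π(u²)` is nonincreasing. -/
lemma Slow.energy_heatX (h : Slow z) (hκ : 0 < κ) (hm : Mn z = fun _ _ _ => 0) (t : ℝ≥0)
    (θ y : ℝ) :
    Mn (fun t θ y => OscFlow.heatX κ z t θ y * OscFlow.heatX κ z t θ y) t θ y ≤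
      Real.exp (-(2 * κ * t)) * Mn (fun t θ y => z t θ y * z t θ y) 0 θ y := by
  set u := OscFlow.heatX κ z with hu
  have hs : Slow u := h.heatX hκ
  have hum : Mn u = fun _ _ _ => 0 := h.Mn_heatX hκ hm
  have huu := hs.mul hs
  have hdd := (hs.D 1).mul (hs.D 1)
  set En := Mn (fun t θ y => u t θ y * u t θ y) with hE
  have hEs : Slow En := huu.mn
  have hDE : OscFlow.D 0 En = fun t θ y => -(2 * κ) *
      Mn (fun t θ y => OscFlow.D 1 u t θ y * OscFlow.D 1 u t θ y) t θ y := by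
    rw [hE, D_Mn huu, D_mul hs hs, h.D_t_heatX hκ, ← hu]
    have e : (fun t θ y => κ * OscFlow.D 1 (OscFlow.D 1 u) t θ y * u t θ y +
        u t θ y * (κ * OscFlow.D 1 (OscFlow.D 1 u) t θ y)) = fun t θ y =>
        2 * κ * (OscFlow.D 1 (fun t θ y => u t θ y * OscFlow.D 1 u t θ y) t θ y
          - OscFlow.D 1 u t θ y * OscFlow.D 1 u t θ y) := by
      rw [D_mul hs (hs.D 1)]
      funext t θ y; ring
    rw [e, Mn_const_mul, Mn_sub ((hs.mul (hs.D 1)).D 1) hdd, (hs.mul (hs.D 1)).Mn_D_x]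
    funext t θ y; ring
  have hle : ∀ t θ y, OscFlow.D 0 En t θ y ≤ -(2 * κ) * En t θ y := by
    intro t θ y
    rw [hDE]
    have : En t θ y ≤ Mn (fun t θ y => OscFlow.D 1 u t θ y * OscFlow.D 1 u t θ y) t θ y :=
      Mn_le_of_le huu (fun θ' => by
        rw [← pow_two, hdd.Mn_theta t θ θ' y]; exact hs.poincare hum t θ' y) θ
    nlinarith
  have hanti : AntitoneOn (fun s : ℝ => Real.exp (2 * κ * s) * En s.toNNReal θ y) (Ici 0) := by
    have hder : ∀ s ∈ Ici (0 : ℝ), HasDerivWithinAt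
        (fun s : ℝ => Real.exp (2 * κ * s) * En s.toNNReal θ y)
        (Real.exp (2 * κ * s) * (2 * κ) * En s.toNNReal θ y +
          Real.exp (2 * κ * s) * OscFlow.D 0 En s.toNNReal θ y) (Ici 0) s := by
      intro s hs0
      have h1 := hEs.hasDeriv_t s.toNNReal θ y
      rw [Real.coe_toNNReal _ hs0] at h1
      have h2 : HasDerivAt (fun s => Real.exp (2 * κ * s)) (Real.exp (2 * κ * s) * (2 * κ)) s := by
        simpa using ((hasDerivAt_id s).const_mul (2 * κ)).exp
      exact h2.hasDerivWithinAt.mul h1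
    refine antitoneOn_of_hasDerivWithinAt_nonpos (convex_Ici 0)
      (fun s hs0 => (hder s hs0).continuousWithinAt)
      (fun s hs0 => (hder s (interior_subset hs0)).mono interior_subset) fun s hs0 => ?_
    have := hle s.toNNReal θ y
    have hp := Real.exp_pos (2 * κ * s)
    nlinarith
  have := hanti self_mem_Ici t.coe_nonneg t.coe_nonneg
  simp only [mul_zero, Real.exp_zero, one_mul, Real.toNNReal_zero, Real.toNNReal_coe] at this
  have h0 : En 0 θ y = Mn (fun t θ y => z t θ y * z t θ y) 0 θ y := by
    have : u 0 = z 0 := by simp [hu, OscFlow.heatX, heatAvg_zero]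
    simp only [hE, Mn, av, this]
  rw [← h0, Real.exp_neg, ← div_eq_inv_mul, le_div_iff₀ (Real.exp_pos _), mul_comm]
  exact this

/-- Exponential decay of the heat flow on the circle, for data of mean zero. -/
lemma Slow.heatAvg_decay (h : Slow z) (hκ : 0 < κ) (hm : Mn z = fun _ _ _ => 0) (s : ℝ≥0) {y B : ℝ}
    (hB : ∀ θ, |OscFlow.D 1 z s θ y| ≤ B) {r : ℝ} (hr : 0 ≤ r) (θ : ℝ) :
    |heatAvg κ 1 r (z s) θ y| ≤ Real.exp (-(κ * r)) * B := by
  have hz := h.freeze s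
  have hzm : Mn (fun _ => z s) = fun _ _ _ => 0 := by
    funext t
    exact congrFun hm s
  have hB0 : 0 ≤ B := (abs_nonneg _).trans (hB 0)
  -- A pointwise bound costs one derivative: Poincaré reduces it to the energy of `∂_θ u`, which
  -- solves the same equation with data of mean zero.
  have e1 := (hz.heatX hκ).poincare (hz.Mn_heatX hκ hzm) r.toNNReal θ y
  rw [hz.D_x_heatX] at e1
  have e2 := (hz.D 1).energy_heatX hκ (Mn_D_eq_zero hz hzm 1) r.toNNReal θ y
  have e3 := Mn_le_of_le ((hz.D 1).mul (hz.D 1)) (t := 0) (y := y) (B := B ^ 2) (fun θ => by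
    show OscFlow.D 1 z s θ y * OscFlow.D 1 z s θ y ≤ B ^ 2
    rw [← pow_two]
    exact sq_le_sq' (abs_le.1 (hB θ)).1 (abs_le.1 (hB θ)).2) θ
  rw [Real.coe_toNNReal _ hr] at e2
  refine abs_le_of_sq_le_sq ?_ (mul_nonneg (Real.exp_pos _).le hB0)
  have e4 : (Real.exp (-(κ * r)) * B) ^ 2 = Real.exp (-(2 * κ * r)) * B ^ 2 := by
    rw [mul_pow, ← Real.exp_nat_mul]; push_cast; ring_nf
  rw [e4]
  have e5 : OscFlow.heatX κ (fun _ => z s) r.toNNReal θ y = heatAvg κ 1 r (z s) θ y := by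
    rw [OscFlow.heatX, Real.coe_toNNReal _ hr]
  rw [e5] at e1
  exact e1.trans (e2.trans (mul_le_mul_of_nonneg_left e3 (Real.exp_pos _).le))

end HeatX

end

end OscFlow

/-! ### Fast profiles and the fast equation. -/

namespace OscFlow

noncomputable section

/-- Smooth profiles with all derivatives `O(e^{-δt})` on `[0, ∞[`, for every `δ < μ`. -/
def Fast (μ : ℝ) (f : ℝ≥0 → Cyl) : Prop := Reg {univ} (Iio μ) (fun _ : Unit => f)

section FastRules

variable {μ : ℝ} {f g : ℝ≥0 → Cyl}

lemma RateMul.Iio_Iio (hμ : 0 < μ) : RateMul (Iio μ) (Iio μ) (Iio μ) := fun δ (hδ : δ < μ) =>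
  ⟨max δ 0, max_lt hδ hμ, 0, hμ, by simp⟩

/-- The growth rate `(μ - δ)/2` of one factor is paid by the decay rate `(δ + μ)/2 < μ` of the
other. This is why fast profiles carry all rates below `μ` instead of a single one. -/
lemma RateMul.Iio_zero (μ : ℝ) : RateMul (Iio 0) (Iio μ) (Iio μ) := fun δ (hδ : δ < μ) =>
  ⟨(δ - μ) / 2, by simp only [mem_Iio]; linarith, (δ + μ) / 2, by simp only [mem_Iio]; linarith,
    by linarith⟩

lemma Fast.slow (h : Fast μ f) : Slow f :=
  Reg.slow h () (fun _ => ⟨univ, rfl, fun _ _ => mem_univ _⟩) nonempty_Iio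

lemma Fast.D (h : Fast μ f) (d : Fin 3) : Fast μ (D d f) := Reg.der h d

lemma Fast.add (hf : Fast μ f) (hg : Fast μ g) : Fast μ (fun t θ y => f t θ y + g t θ y) :=
  Reg.add hf hg

lemma Fast.sub (hf : Fast μ f) (hg : Fast μ g) : Fast μ (fun t θ y => f t θ y - g t θ y) :=
  Reg.sub hf hg

lemma Fast.zero : Fast μ (fun _ _ _ => 0) := Reg.zero

lemma Fast.mn (h : Fast μ f) : Fast μ (Mn f) := Reg.avg h h.slow continuous_const

lemma Fast.maj (h : Fast μ f) {δ : ℝ} (hδ : δ < μ) :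
    ∃ g, Maj g ∧ ∀ t θ y, |f t θ y| ≤ Real.exp (-(δ * t)) * g y := by
  obtain ⟨g, hg, hb⟩ := Reg.ub h univ rfl δ hδ
  exact ⟨g, hg, fun t θ y => hb () t (mem_univ _) θ y⟩

end FastRules

section FastHeat

variable {κ : ℝ} {z f : ℝ≥0 → Cyl}

lemma Slow.fast_heatX (h : Slow z) (hκ : 0 < κ) (hm : Mn z = fun _ _ _ => 0) :
    Fast κ (OscFlow.heatX κ z) := by
  refine Slow.heatX_reg_of (P := fun z => Slow z ∧ Mn z = fun _ _ _ => 0) (fun f hf => hf.1)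
    (fun f hf i => ⟨hf.1.D i, Mn_D_eq_zero hf.1 hf.2 i⟩) hκ (fun f hf => ?_) ⟨h, hm⟩
  intro I _ δ (hδ : δ < κ)
  obtain ⟨g, hg, hb⟩ := (hf.1.D 1).maj 0
  refine ⟨g, hg, fun _ t _ θ y => ?_⟩
  refine (hf.1.heatAvg_decay hκ hf.2 0 (fun θ => hb 0 le_rfl θ y) t.coe_nonneg θ).trans ?_
  have := hg.nonneg y
  gcongr

/-- The flow contributes `e^{-κr}` and the source at time `t - r` contributes `e^{-δ'(t-r)}` with
`δ' < κ`. The integral over `r ≤ t` is at most of order `t e^{-δ't}`, and passing from `δ'` to `δ <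
δ'` absorbs the factor `t`. -/
lemma Fast.duhamel_x (h : Fast κ f) (hκ : 0 < κ) (hm : Mn f = fun _ _ _ => 0) :
    Fast κ (duhamel κ 1 f) := by
  refine Slow.duhamel_reg_of (P := fun z => Fast κ z ∧ Mn z = fun _ _ _ => 0)
    (fun f hf => hf.1.slow) (fun f hf => hf.1)
    (fun f hf i => ⟨hf.1.D i, Mn_D_eq_zero hf.1.slow hf.2 i⟩) (by decide) hκ
    (fun f hf => ?_) ⟨h, hm⟩
  intro I _ δ (hδ : δ < κ)
  set δ' := (δ + κ) / 2 with hδ'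
  obtain ⟨g, hg, hb⟩ := (hf.1.D 1).maj (δ := δ') (by linarith)
  have hlt : 0 < δ' - δ := by linarith
  refine ⟨_, hg.const_mul (inv_nonneg.2 hlt.le), fun _ t _ θ y => ?_⟩
  have hg0 := hg.nonneg y
  have h1 : ∀ r ∈ Ioc (0 : ℝ) t, ‖heatAvg κ 1 r (f ((t : ℝ) - r).toNNReal) θ y‖ ≤
      Real.exp (-(δ' * t)) * g y := by
    intro r hr
    refine (hf.1.slow.heatAvg_decay hκ hf.2 _ (fun θ => hb _ θ y) hr.1.le θ).trans ?_
    rw [← mul_assoc, ← Real.exp_add, Real.coe_toNNReal _ (sub_nonneg.2 hr.2)]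
    gcongr
    nlinarith [hr.1]
  have h2 := intervalIntegral.norm_integral_le_of_norm_le_const (a := 0) (b := (t : ℝ))
    (f := fun r : ℝ => heatAvg κ 1 r (f ((t : ℝ) - r).toNNReal) θ y)
    (C := Real.exp (-(δ' * t)) * g y) (by rwa [uIoc_of_le t.coe_nonneg])
  rw [sub_zero, abs_of_nonneg t.coe_nonneg] at h2
  refine h2.trans ?_
  have h3 : (t : ℝ) ≤ (δ' - δ)⁻¹ * Real.exp ((δ' - δ) * t) := by
    rw [inv_mul_eq_div, le_div_iff₀ hlt]
    linarith [Real.add_one_le_exp ((δ' - δ) * t)]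
  calc Real.exp (-(δ' * t)) * g y * t
      ≤ Real.exp (-(δ' * t)) * g y * ((δ' - δ)⁻¹ * Real.exp ((δ' - δ) * t)) := by gcongr
    _ = (Real.exp (-(δ' * t)) * Real.exp ((δ' - δ) * t)) * ((δ' - δ)⁻¹ * g y) := by ring
    _ = _ := by rw [← Real.exp_add]; ring_nf

end FastHeat

section Tail

variable {μ : ℝ} {f : ℝ≥0 → Cyl}

/-- `∫_t^∞ f(r) dr`. -/
def tail (f : ℝ≥0 → Cyl) : ℝ≥0 → Cyl := fun t θ y =>
  ∫ r in Ioi (0 : ℝ), f (t + r.toNNReal) θ y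

lemma Fast.integrable_tail (h : Fast μ f) (hμ : 0 < μ) (t : ℝ≥0) (θ y : ℝ) :
    IntegrableOn (fun r : ℝ => f (t + r.toNNReal) θ y) (Ioi 0) := by
  obtain ⟨g, hg, hb⟩ := h.maj (half_lt_self hμ)
  refine ((integrableOn_exp_mul_Ioi (a := -(μ / 2)) (by linarith) 0).mul_const (g y)).mono'
    (h.slow.continuous_comp (continuous_const.add continuous_real_toNNReal) continuous_const
      continuous_const).aestronglyMeasurable ?_
  refine (ae_restrict_mem measurableSet_Ioi).mono fun r (hr : 0 < r) => ?_
  refine (hb _ θ y).trans (mul_le_mul_of_nonneg_right (Real.exp_le_exp.2 ?_) (hg.nonneg y))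
  push_cast
  rw [Real.coe_toNNReal _ hr.le]
  nlinarith [mul_nonneg (half_pos hμ).le t.coe_nonneg]

lemma abs_taylor_le {S : Set ℝ} (hS : Convex ℝ S) {u u' u'' : ℝ → ℝ}
    (hu : ∀ x ∈ S, HasDerivWithinAt u (u' x) S x) (hu' : ∀ x ∈ S, HasDerivWithinAt u' (u'' x) S x)
    {C : ℝ} (hC : ∀ x ∈ S, |u'' x| ≤ C) {x z : ℝ} (hx : x ∈ S) (hz : z ∈ S) :
    |u x - u z - (x - z) * u' z| ≤ C * (x - z) ^ 2 := by
  have hC0 : 0 ≤ C := (abs_nonneg _).trans (hC x hx)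
  have := abs_sub_sub_le_of_hasDerivWithinAt hS hu hx hz (C := C * |x - z|) fun s hs hle =>
    (abs_sub_le_of_hasDerivWithinAt hS hu' hC hs hz).trans (by gcongr)
  rwa [mul_assoc, ← pow_two, sq_abs] at this

/-- The second derivative decays exponentially, so the quadratic Taylor bound of the integrand is
integrable up to infinity. -/
lemma Fast.tail_hasDer (h : Fast μ f) (hμ : 0 < μ) (d : Fin 3) :
    Der d (fun _ : Unit => tail f) (fun _ => tail (OscFlow.D d f)) := by
  obtain ⟨g, hg, hb⟩ := ((h.D d).D d).maj (half_lt_self hμ)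
  obtain ⟨B, hB0, hB⟩ := hg.bdd
  have hs := h.slow
  have hbi : Integrable (fun r => Real.exp (-(μ / 2) * r) * B)
      (volume.restrict (Ioi (0 : ℝ))) :=
    (integrableOn_exp_mul_Ioi (a := -(μ / 2)) (by linarith) 0).mul_const B
  have hb' : ∀ (t : ℝ≥0) (r : ℝ), 0 < r → ∀ θ y,
      |OscFlow.D d (OscFlow.D d f) (t + r.toNNReal) θ y| ≤ Real.exp (-(μ / 2) * r) * B := by
    intro t r hr θ y
    refine (hb _ θ y).trans (mul_le_mul (Real.exp_le_exp.2 ?_) (hB y) (hg.nonneg y)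
      (Real.exp_pos _).le)
    push_cast
    rw [Real.coe_toNNReal _ hr.le]
    nlinarith [mul_nonneg (half_pos hμ).le t.coe_nonneg]
  have key : ∀ {S : Set ℝ} {u : ℝ → ℝ → ℝ} {u' : ℝ → ℝ} {x : ℝ}, x ∈ S →
      (∀ s ∈ S, IntegrableOn (u s) (Ioi 0)) → IntegrableOn u' (Ioi 0) →
      (∀ s ∈ S, ∀ r, 0 < r → |u s r - u x r - (s - x) * u' r| ≤
        Real.exp (-(μ / 2) * r) * B * (s - x) ^ 2) →
      HasDerivWithinAt (fun s => ∫ r in Ioi 0, u s r) (∫ r in Ioi 0, u' r) S x := by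
    intro S u u' x hx hu hu' hq
    refine hasDerivWithinAt_of_quadratic
      (C := ∫ r in Ioi 0, Real.exp (-(μ / 2) * r) * B) ?_
    filter_upwards [self_mem_nhdsWithin] with s hs
    rw [integral_sub_sub_const_mul (hu s hs) (hu x hx) hu', ← integral_mul_const, ← Real.norm_eq_abs]
    refine norm_integral_le_of_norm_le ((hbi).mul_const _) ?_
    exact (ae_restrict_mem measurableSet_Ioi).mono fun r hr => hq s hs r hr
  match d with
  | 0 =>
    intro _ t θ y
    have := key (S := Ici 0) (x := t) (u := fun s r => f (s.toNNReal + r.toNNReal) θ y)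
      (u' := fun r => OscFlow.D 0 f (t + r.toNNReal) θ y) t.coe_nonneg
      (fun s _ => h.integrable_tail hμ _ θ y) ((h.D 0).integrable_tail hμ t θ y) ?_
    · exact this
    · intro s hs0 r hr
      have hd : ∀ {f : ℝ≥0 → Cyl}, Slow f → ∀ x ∈ Ici (0 : ℝ), HasDerivWithinAt
          (fun s : ℝ => f (s.toNNReal + r.toNNReal) θ y)
          (OscFlow.D 0 f (x.toNNReal + r.toNNReal) θ y) (Ici 0) x := by
        intro f hf x hx
        have h1 := hf.hasDeriv_t (x.toNNReal + r.toNNReal) θ y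
        have h2 : HasDerivWithinAt (fun s : ℝ => s + r) 1 (Ici 0) x :=
          (hasDerivWithinAt_id x _).add_const r
        have h3 := HasDerivWithinAt.scomp x (t' := Ici 0)
          (by push_cast at h1; rw [Real.coe_toNNReal _ hx, Real.coe_toNNReal _ hr.le] at h1; exact h1)
          h2 (fun s (hs : 0 ≤ s) => add_nonneg hs hr.le)
        rw [one_smul] at h3
        refine h3.congr (fun s hs => ?_) ?_
        · simp [Function.comp, Real.toNNReal_add hs hr.le]
        · simp [Function.comp, Real.toNNReal_add hx hr.le]
      have := abs_taylor_le (convex_Ici 0) (hd h.slow) (hd (h.slow.D 0)) (fun x _ => hb' _ r hr θ y) hs0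
        (mem_Ici.2 t.coe_nonneg)
      simpa only [Real.toNNReal_coe] using this
  | 1 =>
    intro _ t θ y
    have := key (S := univ) (x := θ) (u := fun s r => f (t + r.toNNReal) s y)
      (u' := fun r => OscFlow.D 1 f (t + r.toNNReal) θ y) (mem_univ _)
      (fun s _ => h.integrable_tail hμ _ s y) ((h.D 1).integrable_tail hμ t θ y) ?_
    · exact hasDerivWithinAt_univ.1 this
    · intro s _ r hr
      exact abs_taylor_le convex_univ (fun x _ => (hs.hasDeriv_x _ x y).hasDerivWithinAt)
        (fun x _ => ((hs.D 1).hasDeriv_x _ x y).hasDerivWithinAt) (fun x _ => hb' t r hr x y)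
        (mem_univ _) (mem_univ _)
  | 2 =>
    intro _ t θ y
    have := key (S := univ) (x := y) (u := fun s r => f (t + r.toNNReal) θ s)
      (u' := fun r => OscFlow.D 2 f (t + r.toNNReal) θ y) (mem_univ _)
      (fun s _ => h.integrable_tail hμ _ θ s) ((h.D 2).integrable_tail hμ t θ y) ?_
    · exact hasDerivWithinAt_univ.1 this
    · intro s _ r hr
      exact abs_taylor_le convex_univ (fun x _ => (hs.hasDeriv_y _ θ x).hasDerivWithinAt)
        (fun x _ => ((hs.D 2).hasDeriv_y _ θ x).hasDerivWithinAt) (fun x _ => hb' t r hr θ x)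
        (mem_univ _) (mem_univ _)

lemma Fast.tail (h : Fast μ f) (hμ : 0 < μ) : Fast μ (tail f) := by
  refine Reg.of_commute (C := fun f => Fast μ f) (A := OscFlow.tail) (fun f hf d => hf.D d) ?_ ?_
    (fun f hf d => hf.tail_hasDer hμ d) h
  · intro f hf I _ δ (hδ : δ < μ)
    -- The rate `δ` may be negative; replacing it by a positive rate below `μ` makes the bound
    -- integrable.
    obtain ⟨g, hg, hb⟩ := hf.maj (δ := max δ (μ / 2)) (max_lt hδ (half_lt_self hμ))
    set δ' := max δ (μ / 2) with hδ'
    have h0 : 0 < δ' := (half_pos hμ).trans_le (le_max_right _ _)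
    refine ⟨_, hg.const_mul (inv_nonneg.2 h0.le), fun _ t _ θ y => ?_⟩
    have h1 := norm_integral_le_of_norm_le (μ := volume.restrict (Ioi (0 : ℝ)))
      (f := fun r : ℝ => f (t + r.toNNReal) θ y)
      (g := fun r => Real.exp (-δ' * r) * (Real.exp (-(δ' * t)) * g y))
      ((integrableOn_exp_mul_Ioi (a := -δ') (by linarith) 0).mul_const _) ?_
    · refine h1.trans ?_
      rw [integral_mul_const, integral_exp_mul_Ioi (by linarith)]
      have e : -Real.exp (-δ' * 0) / -δ' = δ'⁻¹ := by simp [neg_div_neg_eq]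
      rw [e]
      have : Real.exp (-(δ' * t)) ≤ Real.exp (-(δ * t)) := by
        have := le_max_left δ (μ / 2)
        gcongr
      calc δ'⁻¹ * (Real.exp (-(δ' * t)) * g y) = Real.exp (-(δ' * t)) * (δ'⁻¹ * g y) := by ring
        _ ≤ _ := mul_le_mul_of_nonneg_right this (mul_nonneg (inv_nonneg.2 h0.le) (hg.nonneg y))
    · refine (ae_restrict_mem measurableSet_Ioi).mono fun r (hr : 0 < r) => ?_
      refine (hb _ θ y).trans (le_of_eq ?_)
      push_cast
      rw [← mul_assoc, ← Real.exp_add, Real.coe_toNNReal _ hr.le]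
      ring_nf
  · intro f hf t θ y
    simp only [OscFlow.tail, hf.slow.per]

lemma Fast.D_tail (h : Fast μ f) (hμ : 0 < μ) (d : Fin 3) :
    OscFlow.D d (OscFlow.tail f) = OscFlow.tail (OscFlow.D d f) :=
  congrFun (h.tail_hasDer hμ d).eq ()

lemma Fast.tendsto_zero (h : Fast μ f) (hμ : 0 < μ) (t : ℝ≥0) (θ y : ℝ) :
    Tendsto (fun r : ℝ => f (t + r.toNNReal) θ y) atTop (𝓝 0) := by
  obtain ⟨g, hg, hb⟩ := h.maj (half_lt_self hμ)
  have h1 : Tendsto (fun r : ℝ => Real.exp (-(μ / 2 * r)) * g y) atTop (𝓝 0) := by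
    have := (Real.tendsto_exp_neg_atTop_nhds_zero.comp
      (tendsto_id.const_mul_atTop (half_pos hμ))).mul_const (g y)
    simpa [Function.comp_def] using this
  refine squeeze_zero_norm' ?_ h1
  filter_upwards [eventually_ge_atTop 0] with r hr
  refine (hb _ θ y).trans (mul_le_mul_of_nonneg_right (Real.exp_le_exp.2 ?_) (hg.nonneg y))
  push_cast
  rw [Real.coe_toNNReal _ hr]
  nlinarith [mul_nonneg (half_pos hμ).le t.coe_nonneg]

lemma Fast.D_t_tail (h : Fast μ f) (hμ : 0 < μ) :
    OscFlow.D 0 (OscFlow.tail f) = fun t θ y => - f t θ y := by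
  rw [h.D_tail hμ]
  funext t θ y
  have hder : ∀ x ∈ Ioi (0 : ℝ), HasDerivAt (fun r : ℝ => f (t + r.toNNReal) θ y)
      (OscFlow.D 0 f (t + x.toNNReal) θ y) x := by
    intro x (hx : 0 < x)
    have h1 := h.slow.hasDeriv_t (t + x.toNNReal) θ y
    push_cast at h1
    rw [Real.coe_toNNReal _ hx.le] at h1
    have h1' := h1.hasDerivAt (Ici_mem_nhds (add_pos_of_nonneg_of_pos t.coe_nonneg hx))
    have h2 := HasDerivAt.comp_const_add (t : ℝ) x h1'
    refine h2.congr_of_eventuallyEq ?_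
    filter_upwards [Ioi_mem_nhds hx] with r (hr : 0 < r)
    simp [Real.toNNReal_add t.coe_nonneg hr.le]
  have hc : Continuous (fun r : ℝ => f (t + r.toNNReal) θ y) :=
    h.slow.continuous_comp (continuous_const.add continuous_real_toNNReal) continuous_const
      continuous_const
  have := integral_Ioi_of_hasDerivAt_of_tendsto hc.continuousWithinAt hder
    ((h.D 0).integrable_tail hμ t θ y) (h.tendsto_zero hμ t θ y)
  simpa [OscFlow.tail] using this

end Tail

section FastSol

variable {κ : ℝ} {Q z : ℝ≥0 → Cyl}

/-- The decaying solution of `∂_t f = κ ∂_θθ f - Q` whose oscillating part at `t = 0` is that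
of `z 0`. -/
def fastSol (κ : ℝ) (Q z : ℝ≥0 → Cyl) : ℝ≥0 → Cyl := fun t θ y =>
  tail (Mn Q) t θ y + (heatX κ (fun t θ y => z t θ y - Mn z t θ y) t θ y
    - duhamel κ 1 (fun t θ y => Q t θ y - Mn Q t θ y) t θ y)

lemma Mn_sub_Mn (h : Slow z) : Mn (fun t θ y => z t θ y - Mn z t θ y) = fun _ _ _ => 0 := by
  rw [Mn_sub h h.mn, Mn_Mn h]
  simp

lemma Fast.fastSol (hQ : Fast κ Q) (hz : Slow z) (hκ : 0 < κ) : Fast κ (fastSol κ Q z) :=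
  (hQ.mn.tail hκ).add (((hz.sub hz.mn).fast_heatX hκ (Mn_sub_Mn hz)).sub
    ((hQ.sub hQ.mn).duhamel_x hκ (Mn_sub_Mn hQ.slow)))

/-- Only the oscillating part of `z` can be prescribed: decay at infinity forces the mean to be the
tail of the mean of the source. The slow mean has to compensate for this at `t = 0`. -/
lemma fastSol_zero (θ y : ℝ) :
    fastSol κ Q z 0 θ y = tail (Mn Q) 0 θ y + (z 0 θ y - Mn z 0 θ y) := by
  simp [fastSol, heatX, heatAvg_zero, duhamel]

lemma D_t_duhamel {f : ℝ≥0 → Cyl} (h : Slow f) (hκ : 0 < κ) {d : Fin 3} (hd : d ≠ 0) :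
    D 0 (duhamel κ d f) = fun t θ y => f t θ y + κ * duhamel κ d (D d (D d f)) t θ y := by
  funext t θ y
  exact (h.hasDeriv_duhamel_t hd hκ t θ y).derivWithin (uniqueDiffOn_Ici 0 _ t.coe_nonneg)

lemma D_x_duhamel {f : ℝ≥0 → Cyl} (h : Slow f) (d : Fin 3) :
    D 1 (duhamel κ d f) = duhamel κ d (D 1 f) := by
  funext t θ y
  exact (h.hasDeriv_duhamel_x κ d t θ y).deriv

lemma D_y_duhamel {f : ℝ≥0 → Cyl} (h : Slow f) (d : Fin 3) :
    D 2 (duhamel κ d f) = duhamel κ d (D 2 f) := by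
  funext t θ y
  exact (h.hasDeriv_duhamel_y κ d t θ y).deriv

lemma Fast.D_t_fastSol (hQ : Fast κ Q) (hz : Slow z) (hκ : 0 < κ) :
    OscFlow.D 0 (OscFlow.fastSol κ Q z) =
      fun t θ y => κ * OscFlow.D 1 (OscFlow.D 1 (OscFlow.fastSol κ Q z)) t θ y - Q t θ y := by
  have hz' := hz.sub hz.mn
  have hQ' := hQ.sub hQ.mn
  have s1 := (hQ.mn.tail hκ).slow
  have s2 := hz'.heatX hκ
  have s3 := (hQ'.duhamel_x hκ (Mn_sub_Mn hQ.slow)).slow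
  have e0 : OscFlow.D 1 (OscFlow.tail (Mn Q)) = fun _ _ _ => 0 :=
    D_x_of_const fun t θ θ' y => by simp only [OscFlow.tail, hQ.slow.Mn_theta _ θ θ' y]
  have e : ∀ d, OscFlow.D d (OscFlow.fastSol κ Q z) = fun t θ y =>
      OscFlow.D d (OscFlow.tail (Mn Q)) t θ y +
        (OscFlow.D d (OscFlow.heatX κ (fun t θ y => z t θ y - Mn z t θ y)) t θ y
        - OscFlow.D d (duhamel κ 1 (fun t θ y => Q t θ y - Mn Q t θ y)) t θ y) := by
    intro d
    have := D_add s1 (s2.sub s3) d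
    rwa [D_sub s2 s3] at this
  rw [e 0, e 1, e0, hQ.mn.D_t_tail hκ, hz'.D_t_heatX hκ, D_t_duhamel hQ'.slow hκ (by decide)]
  simp only [zero_add]
  rw [D_sub (s2.D 1) (s3.D 1), D_x_duhamel hQ'.slow, D_x_duhamel (hQ'.slow.D 1)]
  funext t θ y
  ring

end FastSol

/-! ### The heat equation in `y` with initial data and source. -/

section HeatY

variable {ν : ℝ} {S w0 : ℝ≥0 → Cyl}

/-- The solution of `∂_t w = S + ν ∂_yy w` with `w 0 = w0 0`. -/
def heatSol (ν : ℝ) (S w0 : ℝ≥0 → Cyl) : ℝ≥0 → Cyl := fun t θ y =>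
  w0 0 θ y + duhamel ν 2 (fun t θ y => S t θ y + ν * D 2 (D 2 w0) 0 θ y) t θ y

lemma heatSol_zero : heatSol ν S w0 0 = w0 0 := by
  funext θ y
  simp [heatSol, duhamel]

/-- Subtracting the initial value turns it into a source, so one Duhamel integral with zero initial
value is enough, and it is smooth up to `t = 0`. -/
lemma Slow.heatSol (hS : Slow S) (hw : Slow w0) (hν : 0 < ν) : Slow (heatSol ν S w0) :=
  (hw.freeze 0).add ((hS.add ((((hw.D 2).D 2).freeze 0).const_mul ν)).duhamel_y hν)

lemma heatSol_theta (hS : ∀ t θ θ' y, S t θ y = S t θ' y) (hw : ∀ θ θ' y, w0 0 θ y = w0 0 θ' y)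
    (t : ℝ≥0) (θ θ' y : ℝ) : heatSol ν S w0 t θ y = heatSol ν S w0 t θ' y := by
  have h2 : ∀ θ θ' y, D 2 (D 2 w0) 0 θ y = D 2 (D 2 w0) 0 θ' y := by
    intro θ θ' y
    show deriv (fun s => deriv (fun s => w0 0 θ s) s) y = deriv (fun s => deriv (fun s => w0 0 θ' s) s) y
    simp only [hw θ θ']
  simp only [heatSol, duhamel, heatAvg, hw θ θ', dir, mul_zero, add_zero, hS _ θ θ', h2 θ θ']

lemma D_t_heatSol (hS : Slow S) (hw : Slow w0) (hν : 0 < ν) :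
    D 0 (heatSol ν S w0) = fun t θ y => S t θ y + ν * D 2 (D 2 (heatSol ν S w0)) t θ y := by
  have h0 := hw.freeze 0
  have h2 := ((hw.D 2).D 2).freeze 0
  have hF := hS.add (h2.const_mul ν)
  have hD := hF.duhamel_y hν
  have e : ∀ d, D d (heatSol ν S w0) = fun t θ y => D d (fun _ => w0 0) t θ y +
      D d (duhamel ν 2 (fun t θ y => S t θ y + ν * D 2 (D 2 w0) 0 θ y)) t θ y := by
    intro d
    rw [← D_add h0 hD]
    rfl
  have e0 : D 0 (fun _ => w0 0) = fun _ _ _ => 0 := by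
    funext t θ y
    exact (hasDerivWithinAt_const _ _ _).derivWithin (uniqueDiffOn_Ici 0 _ t.coe_nonneg)
  rw [e 0, e 2, e0, D_t_duhamel hF hν (by decide), D_add (h0.D 2) (hD.D 2), D_y_duhamel hF,
    D_y_duhamel (hF.D 2)]
  funext t θ y
  have : D 2 (D 2 fun _ => w0 0) t θ y = D 2 (D 2 w0) 0 θ y := rfl
  simp only [this]
  ring

end HeatY

end

end OscFlow

namespace OscFlow

noncomputable section

/-! ### Sobolev inequalities: functions in `H^∞` have majorants. -/

section Sobolev

variable {u v : Cyl}

/-- `u(a)² = u(z)² - ∫ 2uu' ≤ u(z)² + ∫ (u² + u'²)`, averaged over `z` in the unit interval. -/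
lemma sq_le_integral_Ioc {u u' : ℝ → ℝ} (hu : ∀ x, HasDerivAt u (u' x) x) (hu' : Continuous u')
    (a : ℝ) : u a ^ 2 ≤ ∫ x in Ioc a (a + 1), (2 * u x ^ 2 + u' x ^ 2) := by
  have hc : Continuous u := continuous_iff_continuousAt.2 fun x => (hu x).continuousAt
  have hi : IntegrableOn (fun x => u x ^ 2 + u' x ^ 2) (Ioc a (a + 1)) :=
    ((hc.pow 2).add (hu'.pow 2)).integrableOn_Ioc
  have h1 : ∀ z ∈ Ioc a (a + 1), u a ^ 2 ≤ u z ^ 2 + ∫ x in Ioc a (a + 1), (u x ^ 2 + u' x ^ 2) := by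
    intro z hz
    have h2 : ∫ x in a..z, 2 * u x * u' x = u z ^ 2 - u a ^ 2 :=
      intervalIntegral.integral_eq_sub_of_hasDerivAt
        (fun x _ => by simpa using (hu x).pow 2)
        (((continuous_const.mul hc).mul hu').intervalIntegrable _ _)
    have h3 : -∫ x in Ioc a z, (u x ^ 2 + u' x ^ 2) ≤ ∫ x in a..z, 2 * u x * u' x := by
      rw [intervalIntegral.integral_of_le hz.1.le, ← integral_neg]
      refine integral_mono (((hc.pow 2).add (hu'.pow 2)).integrableOn_Ioc).neg
        ((continuous_const.mul hc).mul hu').integrableOn_Ioc fun x => ?_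
      show -(u x ^ 2 + u' x ^ 2) ≤ 2 * u x * u' x
      nlinarith [sq_nonneg (u x + u' x)]
    have h4 : ∫ x in Ioc a z, (u x ^ 2 + u' x ^ 2) ≤ ∫ x in Ioc a (a + 1), (u x ^ 2 + u' x ^ 2) :=
      setIntegral_mono_set hi (Eventually.of_forall fun x => by positivity)
        (Ioc_subset_Ioc_right hz.2).eventuallyLE
    linarith
  have hi2 : IntegrableOn (fun x => u x ^ 2) (Ioc a (a + 1)) := (hc.pow 2).integrableOn_Ioc
  have h5 := setIntegral_mono_on (integrable_const (u a ^ 2) : IntegrableOn _ (Ioc a (a + 1)))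
    (hi2.add (integrable_const (∫ x in Ioc a (a + 1), (u x ^ 2 + u' x ^ 2)))) measurableSet_Ioc h1
  rw [integral_add hi2 (integrable_const _), setIntegral_const, setIntegral_const] at h5
  simp only [measureReal_def, Real.volume_Ioc, add_sub_cancel_left, ENNReal.ofReal_one,
    ENNReal.toReal_one, one_smul] at h5
  refine h5.trans_eq ?_
  rw [← integral_add hi2 hi]
  refine integral_congr_ae (Eventually.of_forall fun x => ?_)
  simp only
  ring

lemma MemHInf.dTheta (hu : MemHInf u) : MemHInf (dTheta u) where
  periodic θ y := by
    have h : (fun s => u s y) = fun s => u (s + 1) y := funext fun s => (hu.periodic s y).symm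
    show deriv (fun s => u s y) (θ + 1) = deriv (fun s => u s y) θ
    conv_rhs => rw [h]
    exact (deriv_comp_add_const (fun s => u s y) 1 θ).symm
  smooth := SmoothCyl.dTheta hu.smooth
  memLp a b := by
    rw [SmoothCyl.dMulti_dTheta a b hu.smooth]
    exact hu.memLp _ _

lemma MemHInf.dY (hu : MemHInf u) : MemHInf (dY u) where
  periodic θ y := by
    show deriv (fun s => u (θ + 1) s) y = deriv (fun s => u θ s) y
    simp only [hu.periodic]
  smooth := SmoothCyl.dY hu.smooth
  memLp a b := by
    rw [dMulti_dY]
    exact hu.memLp _ _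

lemma MemHInf.smul_sub (hu : MemHInf u) (hv : MemHInf v) (c : ℝ) :
    MemHInf (fun θ y => c * u θ y - v θ y) where
  periodic θ y := by simp only [hu.periodic, hv.periodic]
  smooth := SmoothCyl.sub_smul hu.smooth hv.smooth c
  memLp a b := by
    rw [SmoothCyl.dMulti_smul_sub hu.smooth hv.smooth]
    exact ((hu.memLp a b).const_mul c).sub (hv.memLp a b)

lemma MemHInf.continuous (hu : MemHInf u) : Continuous fun p : ℝ × ℝ => u p.1 p.2 :=
  hu.smooth.continuous

lemma MemHInf.integrable_sq (hu : MemHInf u) :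
    Integrable (fun p : ℝ × ℝ => u p.1 p.2 ^ 2) cylMeasure :=
  (hu.memLp 0 0).integrable_sq

lemma MemHInf.hasDerivAt_x (hu : MemHInf u) (θ y : ℝ) :
    HasDerivAt (fun s => u s y) (OscFlow.dTheta u θ y) θ := by
  have := SmoothCyl.hasDerivAt_x hu.smooth θ y
  rwa [← this.deriv] at this

lemma MemHInf.hasDerivAt_y (hu : MemHInf u) (θ y : ℝ) :
    HasDerivAt (fun s => u θ s) (OscFlow.dY u θ y) y := by
  have := SmoothCyl.hasDerivAt_y hu.smooth θ y
  rwa [← this.deriv] at this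

/-- `∫_𝕋 (2u² + u_θ²) dθ`. -/
def slice (u : Cyl) : ℝ → ℝ := fun y =>
  ∫ x in Ioc (0 : ℝ) 1, (2 * u x y ^ 2 + dTheta u x y ^ 2)

lemma MemHInf.sq_le_slice (hu : MemHInf u) (θ y : ℝ) : u θ y ^ 2 ≤ slice u y := by
  have hc := hu.dTheta.continuous.comp (Continuous.prodMk continuous_id (continuous_const (y := y)))
  refine (sq_le_integral_Ioc (fun x => hu.hasDerivAt_x x y) hc θ).trans_eq ?_
  have hp : Function.Periodic (fun x => 2 * u x y ^ 2 + OscFlow.dTheta u x y ^ 2) 1 := fun x => by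
    simp only [hu.periodic, hu.dTheta.periodic]
  have := hp.intervalIntegral_add_eq θ 0
  rw [zero_add, intervalIntegral.integral_of_le (by linarith),
    intervalIntegral.integral_of_le zero_le_one] at this
  exact this

lemma MemHInf.integral_sq_le (hu : MemHInf u) (y : ℝ) :
    ∫ x in Ioc (0 : ℝ) 1, u x y ^ 2 ≤
      2 * ∫ p, u p.1 p.2 ^ 2 ∂cylMeasure + ∫ p, OscFlow.dY u p.1 p.2 ^ 2 ∂cylMeasure := by
  have hi : Integrable (fun p : ℝ × ℝ => 2 * u p.1 p.2 ^ 2 + OscFlow.dY u p.1 p.2 ^ 2) cylMeasure :=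
    (hu.integrable_sq.const_mul 2).add hu.dY.integrable_sq
  have hle : ((volume : Measure ℝ).restrict (Ioc 0 1)).prod (volume.restrict (Ioc y (y + 1))) ≤
      cylMeasure := Measure.prod_mono le_rfl Measure.restrict_le_self
  have hi' := hi.mono_measure hle
  have h1 : ∀ x, u x y ^ 2 ≤ ∫ z in Ioc y (y + 1), (2 * u x z ^ 2 + OscFlow.dY u x z ^ 2) := fun x =>
    sq_le_integral_Ioc (fun z => hu.hasDerivAt_y x z)
      (hu.dY.continuous.comp (Continuous.prodMk (continuous_const (y := x)) continuous_id)) y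
  have hc : Continuous fun x => u x y :=
    hu.continuous.comp (Continuous.prodMk continuous_id (continuous_const (y := y)))
  have hi2 : IntegrableOn (fun x => u x y ^ 2) (Ioc 0 1) := (hc.pow 2).integrableOn_Ioc
  calc ∫ x in Ioc (0 : ℝ) 1, u x y ^ 2
      ≤ ∫ x in Ioc (0 : ℝ) 1, ∫ z in Ioc y (y + 1), (2 * u x z ^ 2 + OscFlow.dY u x z ^ 2) :=
        integral_mono hi2 hi'.integral_prod_left h1
    _ = ∫ p, (2 * u p.1 p.2 ^ 2 + OscFlow.dY u p.1 p.2 ^ 2)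
        ∂(((volume : Measure ℝ).restrict (Ioc 0 1)).prod (volume.restrict (Ioc y (y + 1)))) :=
      (integral_prod _ hi').symm
    _ ≤ ∫ p, (2 * u p.1 p.2 ^ 2 + OscFlow.dY u p.1 p.2 ^ 2) ∂cylMeasure :=
      integral_mono_measure hle (Eventually.of_forall fun p => by positivity) hi
    _ = _ := by
      rw [integral_add (hu.integrable_sq.const_mul 2) hu.dY.integrable_sq, integral_const_mul]

lemma MemHInf.slice_le (hu : MemHInf u) (y : ℝ) : slice u y ≤
    4 * ∫ p, u p.1 p.2 ^ 2 ∂cylMeasure + 2 * ∫ p, OscFlow.dY u p.1 p.2 ^ 2 ∂cylMeasure +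
    (2 * ∫ p, OscFlow.dTheta u p.1 p.2 ^ 2 ∂cylMeasure +
      ∫ p, OscFlow.dY (OscFlow.dTheta u) p.1 p.2 ^ 2 ∂cylMeasure) := by
  have hc : ∀ {u : Cyl}, MemHInf u → IntegrableOn (fun x => u x y ^ 2) (Ioc 0 1) := fun hu =>
    ((hu.continuous.comp (Continuous.prodMk continuous_id (continuous_const (y := y)))).pow
      2).integrableOn_Ioc
  have h1 := hu.integral_sq_le y
  have h2 := hu.dTheta.integral_sq_le y
  rw [slice, integral_add ((hc hu).const_mul 2) (hc hu.dTheta), integral_const_mul]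
  linarith

/-- The slice norm over the circle bounds `u` uniformly in `θ`. It is square integrable in `y` by
Fubini, and bounded by the one-dimensional inequality applied in `y`. -/
lemma MemHInf.maj (hu : MemHInf u) : Maj (fun y => √(slice u y)) := by
  have h0 : ∀ y, 0 ≤ slice u y := fun y => (sq_nonneg _).trans (hu.sq_le_slice 0 y)
  have hi : Integrable (fun p : ℝ × ℝ => 2 * u p.1 p.2 ^ 2 + OscFlow.dTheta u p.1 p.2 ^ 2)
      cylMeasure := (hu.integrable_sq.const_mul 2).add hu.dTheta.integrable_sq
  have hm : StronglyMeasurable (slice u) := by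
    refine StronglyMeasurable.integral_prod_right
      (f := fun y x => 2 * u x y ^ 2 + OscFlow.dTheta u x y ^ 2) ?_
    have h1 := hu.continuous.comp continuous_swap
    have h2 := hu.dTheta.continuous.comp continuous_swap
    exact ((continuous_const.mul (h1.pow 2)).add (h2.pow 2)).stronglyMeasurable
  refine ⟨fun y => Real.sqrt_nonneg _, hm.measurable.sqrt, ?_, ?_⟩
  · exact ⟨_, Real.sqrt_nonneg _, fun y => Real.sqrt_le_sqrt (hu.slice_le y)⟩
  · rw [memLp_two_iff_integrable_sq hm.measurable.sqrt.aestronglyMeasurable]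
    simp only [Real.sq_sqrt (h0 _)]
    exact hi.integral_prod_right

lemma MemHInf.abs_le (hu : MemHInf u) (θ y : ℝ) : |u θ y| ≤ √(slice u y) :=
  Real.abs_le_sqrt (hu.sq_le_slice θ y)

/-- `H^∞` is stable under `∂_θ` and `∂_y`, so the slice norms supply majorants for all derivatives;
this is how initial data enter the framework. -/
lemma MemHInf.slow (hu : MemHInf u) : Slow (fun _ => u) := by
  have := Reg.of_closed (ℐ := range fun T : ℝ≥0 => {p : Unit × ℝ≥0 | p.2 ≤ T}) (Δ := {0})
    (fun F => ∃ c u, MemHInf u ∧ F = fun (_ : Unit) (_ : ℝ≥0) θ y => c * u θ y) ?_ ?_ ?_ _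
    ⟨1, u, hu, rfl⟩
  · simp only [one_mul] at this
    exact this
  · rintro _ ⟨c, u, hu, rfl⟩ I _ δ rfl
    refine ⟨_, hu.maj.const_mul (abs_nonneg c), fun _ t _ θ y => ?_⟩
    rw [abs_mul, zero_mul, neg_zero, Real.exp_zero, one_mul]
    exact mul_le_mul_of_nonneg_left (hu.abs_le θ y) (abs_nonneg c)
  · rintro _ ⟨c, u, hu, rfl⟩ e t θ y
    simp only [hu.periodic]
  · rintro _ ⟨c, u, hu, rfl⟩ i
    match i with
    | 0 =>
      refine ⟨_, _, fun _ t θ y => ?_, Reg.zero, ⟨0, u, hu, rfl⟩⟩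
      -- The vanishing time derivative stays in the class as the multiple `0 * u`.
      exact (hasDerivWithinAt_const _ _ _).congr_deriv (by ring)
    | 1 =>
      refine ⟨_, _, fun _ t θ y => ?_, Reg.zero, ⟨c, _, hu.dTheta, rfl⟩⟩
      exact ((hu.hasDerivAt_x θ y).const_mul c).congr_deriv (by ring)
    | 2 =>
      refine ⟨_, _, fun _ t θ y => ?_, Reg.zero, ⟨c, _, hu.dY, rfl⟩⟩
      exact ((hu.hasDerivAt_y θ y).const_mul c).congr_deriv (by ring)

lemma MemHInf.eLpNorm_le_hNorm {m a b : ℕ} (hab : a + b ≤ m) :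
    eLpNorm (fun p : ℝ × ℝ => dMulti a b u p.1 p.2) 2 cylMeasure ≤ hNorm m u := by
  have key : ∀ N : ℕ × ℕ → ℝ≥0∞, N (a, b) ≤
      ∑ k ∈ Finset.range (m + 1), ∑ α ∈ Finset.HasAntidiagonal.antidiagonal k, N α := by
    intro N
    have hm : (a, b) ∈ Finset.HasAntidiagonal.antidiagonal (a + b) :=
      Finset.HasAntidiagonal.mem_antidiagonal.2 rfl
    calc N (a, b) ≤ ∑ α ∈ Finset.HasAntidiagonal.antidiagonal (a + b), N α :=
          Finset.single_le_sum (f := N) (fun _ _ => zero_le) hm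
      _ ≤ _ := Finset.single_le_sum
          (f := fun k => ∑ α ∈ Finset.HasAntidiagonal.antidiagonal k, N α) (fun _ _ => zero_le)
          (Finset.mem_range.2 (Nat.lt_succ_of_le hab))
  exact key fun α => eLpNorm (fun p : ℝ × ℝ => dMulti α.1 α.2 u p.1 p.2) 2 cylMeasure

lemma MemHInf.hNorm_lt_top (hu : MemHInf u) (m : ℕ) : hNorm m u < ⊤ :=
  ENNReal.sum_lt_top.2 fun _ _ => ENNReal.sum_lt_top.2 fun _ _ => (hu.memLp _ _).2

lemma MemHInf.integral_sq_le_hNorm (hu : MemHInf u) {m a b : ℕ} (hab : a + b ≤ m) :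
    ∫ p, dMulti a b u p.1 p.2 ^ 2 ∂cylMeasure ≤ (hNorm m u).toReal ^ 2 := by
  have h1 := ENNReal.toReal_mono (hu.hNorm_lt_top m).ne (MemHInf.eLpNorm_le_hNorm (u := u) hab)
  have h2 : ∫ p, dMulti a b u p.1 p.2 ^ 2 ∂cylMeasure =
      (eLpNorm (fun p : ℝ × ℝ => dMulti a b u p.1 p.2) 2 cylMeasure).toReal ^ 2 := by
    rw [(hu.memLp a b).eLpNorm_eq_integral_rpow_norm two_ne_zero ENNReal.ofNat_ne_top]
    have h0 : 0 ≤ ∫ p, dMulti a b u p.1 p.2 ^ 2 ∂cylMeasure := integral_nonneg fun p => sq_nonneg _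
    simp only [ENNReal.toReal_ofNat, Real.rpow_ofNat, Real.norm_eq_abs, sq_abs]
    rw [ENNReal.toReal_ofReal (Real.rpow_nonneg h0 _), ← Real.rpow_natCast, ← Real.rpow_mul h0]
    norm_num
  rw [h2]
  exact pow_le_pow_left₀ ENNReal.toReal_nonneg h1 2

lemma MemHInf.abs_le_hNorm (hu : MemHInf u) (θ y : ℝ) : |u θ y| ≤ 3 * (hNorm 2 u).toReal := by
  -- The four integrals in `MemHInf.slice_le` have weights `4 + 2 + 2 + 1 = 9 = 3²`.
  refine abs_le_of_sq_le_sq ?_ (by positivity)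
  have h1 := (hu.sq_le_slice θ y).trans (hu.slice_le y)
  have a1 := hu.integral_sq_le_hNorm (m := 2) (a := 0) (b := 0) (by norm_num)
  have a2 := hu.integral_sq_le_hNorm (m := 2) (a := 0) (b := 1) (by norm_num)
  have a3 := hu.integral_sq_le_hNorm (m := 2) (a := 1) (b := 0) (by norm_num)
  have a4 := hu.integral_sq_le_hNorm (m := 2) (a := 1) (b := 1) (by norm_num)
  have e4 : dMulti 1 1 u = OscFlow.dY (OscFlow.dTheta u) := SmoothCyl.dTheta_dY hu.smooth
  rw [e4] at a4
  have b1 : ∫ p, u p.1 p.2 ^ 2 ∂cylMeasure ≤ (hNorm 2 u).toReal ^ 2 := a1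
  have b2 : ∫ p, OscFlow.dY u p.1 p.2 ^ 2 ∂cylMeasure ≤ (hNorm 2 u).toReal ^ 2 := a2
  have b3 : ∫ p, OscFlow.dTheta u p.1 p.2 ^ 2 ∂cylMeasure ≤ (hNorm 2 u).toReal ^ 2 := a3
  nlinarith

end Sobolev

/-! ### Uniqueness for the heat equation by an `L²` energy estimate. -/

section Uniqueness

variable {f : ℝ → Cyl} {T t : ℝ}

lemma tendsto_of_tendsto_hNorm {X : Type*} {l : Filter X} {g : X → Cyl} {m : ℕ}
    (h : Tendsto (fun x => hNorm m (g x)) l (𝓝 0)) :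
    Tendsto (fun x => (hNorm m (g x)).toReal) l (𝓝 0) := by
  have := (ENNReal.tendsto_toReal ENNReal.zero_ne_top).comp h
  rwa [ENNReal.toReal_zero] at this

/-- A curve in `C¹([0,T]; H^∞)` has a derivative, both pointwise and in `L²`. -/
lemma MemHT.exists_deriv (hf : MemHT 1 T f) : ∃ F : ℝ → Cyl, ∀ t ∈ Icc 0 T,
    MemHInf (f t) ∧ MemHInf (F t) ∧
    (∀ θ y, HasDerivWithinAt (fun s => f s θ y) (F t θ y) (Icc 0 T) t) ∧
    Tendsto (fun s => (hNorm 0 (fun θ y => (s - t)⁻¹ * (f s θ y - f t θ y) - F t θ y)).toReal)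
      (𝓝[Icc 0 T \ {t}] t) (𝓝 0) := by
  obtain ⟨F, h0, h1, h2⟩ := hf
  have hm : ∀ t ∈ Icc 0 T, MemHInf (f t) := fun t ht => by
    rw [← h0 t ht]; exact (h1 0 (by simp) t ht).1
  refine ⟨F 1, fun t ht => ⟨hm t ht, (h1 1 le_rfl t ht).1, fun θ y => ?_, ?_⟩⟩
  · rw [hasDerivWithinAt_iff_tendsto_slope, tendsto_iff_norm_sub_tendsto_zero]
    -- The `H²` norm controls the values at points, so convergence of the difference quotients in
    -- `H²` gives the pointwise derivative.
    have h3 := (tendsto_of_tendsto_hNorm (h2 0 (by simp) t ht 2)).const_mul 3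
    rw [mul_zero] at h3
    refine squeeze_zero' (Eventually.of_forall fun s => norm_nonneg _) ?_ h3
    filter_upwards [self_mem_nhdsWithin] with s hs
    have hH : MemHInf ((s - t)⁻¹ • (F 0 s - F 0 t) - F (0 + 1) t) := by
      have := (((h1 0 (by simp) s hs.1).1.smul_sub (h1 0 (by simp) t ht).1 1).smul_sub
        (h1 1 le_rfl t ht).1 (s - t)⁻¹)
      simp only [one_mul] at this
      exact this
    have := hH.abs_le_hNorm θ y
    simpa [slope_def_field, div_eq_inv_mul, h0 s hs.1, h0 t ht] using this
  · refine (tendsto_of_tendsto_hNorm (h2 0 (by simp) t ht 0)).congr' ?_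
    filter_upwards [self_mem_nhdsWithin] with s hs
    rw [h0 s hs.1, h0 t ht]
    rfl

lemma MemHInf.integral_mul_dY_dY_nonpos {u : Cyl} (hu : MemHInf u)
    (hc : ∀ θ θ' y, u θ y = u θ' y) :
    ∫ p, u p.1 p.2 * OscFlow.dY (OscFlow.dY u) p.1 p.2 ∂cylMeasure ≤ 0 := by
  have hmp : MeasurePreserving Prod.snd cylMeasure (volume : Measure ℝ) :=
    ⟨measurable_snd, by simp [cylMeasure]⟩
  have hd : ∀ {u : Cyl}, (∀ θ θ' y, u θ y = u θ' y) → ∀ θ θ' y,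
      OscFlow.dY u θ y = OscFlow.dY u θ' y := fun {u} hc θ θ' y => by
    show deriv (fun s => u θ s) y = deriv (fun s => u θ' s) y
    simp only [hc θ θ']
  have hcont : ∀ {u : Cyl}, MemHInf u → Continuous fun y => u 0 y := fun hu =>
    hu.continuous.comp (Continuous.prodMk continuous_const continuous_id)
  have hi : ∀ {u v : Cyl}, MemHInf u → MemHInf v → (∀ θ θ' y, u θ y = u θ' y) →
      (∀ θ θ' y, v θ y = v θ' y) → Integrable (fun y => u 0 y * v 0 y) := by
    intro u v hu hv h h'
    refine (hmp.integrable_comp (g := fun y => u 0 y * v 0 y)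
      ((hcont hu).mul (hcont hv)).aestronglyMeasurable).1 ?_
    refine ((hu.memLp 0 0).integrable_mul (hv.memLp 0 0)).congr (Eventually.of_forall fun p => ?_)
    show u p.1 p.2 * v p.1 p.2 = u 0 p.2 * v 0 p.2
    rw [h p.1 0, h' p.1 0]
  have c1 := hd hc
  have c2 := hd c1
  have e : ∫ p, u p.1 p.2 * OscFlow.dY (OscFlow.dY u) p.1 p.2 ∂cylMeasure =
      ∫ y, u 0 y * OscFlow.dY (OscFlow.dY u) 0 y := by
    rw [← hmp.map_eq, integral_map (f := fun y => u 0 y * OscFlow.dY (OscFlow.dY u) 0 y)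
      measurable_snd.aemeasurable ((hcont hu).mul (hcont hu.dY.dY)).aestronglyMeasurable]
    refine integral_congr_ae (Eventually.of_forall fun p => ?_)
    simp only [hc p.1 0, c2 p.1 0]
  rw [e, integral_mul_deriv_eq_deriv_mul_of_integrable (fun x _ => hu.hasDerivAt_y 0 x)
    (fun x _ => hu.dY.hasDerivAt_y 0 x) (hi hu hu.dY.dY hc c2) (hi hu.dY hu.dY c1 c1)
    (hi hu hu.dY hc c1)]
  exact neg_nonpos.2 (integral_nonneg fun y => mul_self_nonneg _)

open Classical in
/-- `u` as an element of `L²(𝕋 × ℝ)`. -/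
def toL2 (u : Cyl) : Lp ℝ 2 cylMeasure := if hu : MemHInf u then (hu.memLp 0 0).toLp _ else 0

lemma MemHInf.toL2_eq {u : Cyl} (hu : MemHInf u) : toL2 u = (hu.memLp 0 0).toLp _ := dif_pos hu

lemma MemHInf.toL2_sub {u v : Cyl} (hu : MemHInf u) (hv : MemHInf v) (c : ℝ) :
    toL2 (fun θ y => c * u θ y - v θ y) = c • toL2 u - toL2 v := by
  rw [(hu.smul_sub hv c).toL2_eq, hu.toL2_eq, hv.toL2_eq, ← MemLp.toLp_const_smul,
    ← MemLp.toLp_sub]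
  rfl

lemma hasDerivWithinAt_toL2 {f : ℝ → Cyl} {F : Cyl} {S : Set ℝ} {t : ℝ} (ht : t ∈ S)
    (hf : ∀ s ∈ S, MemHInf (f s)) (hF : MemHInf F)
    (h : Tendsto (fun s => (hNorm 0 (fun θ y => (s - t)⁻¹ * (f s θ y - f t θ y) - F θ y)).toReal)
      (𝓝[S \ {t}] t) (𝓝 0)) :
    HasDerivWithinAt (fun s => toL2 (f s)) (toL2 F) S t := by
  rw [hasDerivWithinAt_iff_tendsto_slope, tendsto_iff_norm_sub_tendsto_zero]
  refine squeeze_zero' (Eventually.of_forall fun s => norm_nonneg _) ?_ h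
  filter_upwards [self_mem_nhdsWithin] with s hs
  have h1 := (hf s hs.1).smul_sub (hf t ht) 1
  have h2 := h1.smul_sub hF (s - t)⁻¹
  have e : slope (fun s => toL2 (f s)) t s - toL2 F =
      toL2 (fun θ y => (s - t)⁻¹ * (1 * f s θ y - f t θ y) - F θ y) := by
    rw [h1.toL2_sub hF, (hf s hs.1).toL2_sub (hf t ht), one_smul, slope_def_module]
  simp only [one_mul] at h2 e
  rw [e, h2.toL2_eq, Lp.norm_toLp]
  exact ENNReal.toReal_mono (h2.hNorm_lt_top 0).ne
    (MemHInf.eLpNorm_le_hNorm (a := 0) (b := 0) le_rfl)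

lemma inner_toL2 {u v : Cyl} (hu : MemHInf u) (hv : MemHInf v) :
    inner ℝ (toL2 u) (toL2 v) = ∫ p, u p.1 p.2 * v p.1 p.2 ∂cylMeasure := by
  rw [L2.inner_def, hu.toL2_eq, hv.toL2_eq]
  refine integral_congr_ae ?_
  filter_upwards [(hu.memLp 0 0).coeFn_toLp, (hv.memLp 0 0).coeFn_toLp] with p h1 h2
  rw [h1, h2]
  exact mul_comm _ _

lemma MemHInf.eq_zero_of_toL2 {u : Cyl} (hu : MemHInf u) (hc : ∀ θ θ' y, u θ y = u θ' y)
    (h0 : toL2 u = 0) (θ y : ℝ) : u θ y = 0 := by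
  have hmp : MeasurePreserving Prod.snd cylMeasure (volume : Measure ℝ) :=
    ⟨measurable_snd, by simp [cylMeasure]⟩
  have h0' : (fun p : ℝ × ℝ => u p.1 p.2) =ᵐ[cylMeasure] 0 := by
    rw [hu.toL2_eq] at h0
    refine (hu.memLp 0 0).coeFn_toLp.symm.trans ?_
    rw [h0]
    exact Lp.coeFn_zero _ _ _
  have hcont : Continuous fun y => u 0 y :=
    hu.continuous.comp (Continuous.prodMk continuous_const continuous_id)
  have h1 : (fun y => u 0 y) =ᵐ[volume] fun _ => 0 := by
    rw [← hmp.map_eq]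
    refine (ae_map_iff measurable_snd.aemeasurable
      (measurableSet_eq_fun hcont.measurable measurable_const)).2 ?_
    filter_upwards [h0'] with p hp
    rw [← hc p.1 0]
    exact hp
  have h2 := (hcont.ae_eq_iff_eq volume continuous_const).1 h1
  rw [hc θ 0]
  exact congrFun h2 y

lemma dT_eq_of_hasDerivWithinAt_Icc {g : ℝ → ℝ} {g' : ℝ} (ht : t ∈ Ico 0 T)
    (h : HasDerivWithinAt g g' (Icc 0 T) t) : dT g t = g' := by
  refine (h.mono_of_mem_nhdsWithin ?_).derivWithin (uniqueDiffOn_Ici 0 _ ht.1)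
  exact mem_nhdsWithin.2 ⟨Iio T, isOpen_Iio, ht.2, fun s hs => ⟨hs.2, hs.1.le⟩⟩

/-- Uniqueness for the heat equation in `C¹([0,T]; H^∞)`. -/
lemma SolvesHeat.unique {ν : ℝ} (hν : 0 < ν) {S : ℝ≥0 → ℝ → ℝ} {w W : ℝ → ℝ → ℝ}
    (hw : ∀ T > 0, MemHT 1 T (fun t _ y => w t y)) (hW : ∀ T > 0, MemHT 1 T (fun t _ y => W t y))
    (h0 : w 0 = W 0) (h : SolvesHeat ν S w) (h' : SolvesHeat ν S W) (t : ℝ) (ht : 0 ≤ t) :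
    w t = W t := by
  obtain ⟨F, hF⟩ := (hw (t + 1) (by linarith)).exists_deriv
  obtain ⟨G, hG⟩ := (hW (t + 1) (by linarith)).exists_deriv
  -- The time `t` must lie strictly before the end of `[0, T]`: only there does the derivative along
  -- `[0, T]` agree with the one along `[0, ∞[`.
  set T := t + 1 with hT
  set e : ℝ → Cyl := fun s _ y => 1 * w s y - W s y with he
  have htT : t ∈ Ico 0 T := ⟨ht, by linarith⟩
  have he' : ∀ s ∈ Icc 0 T, MemHInf (e s) := fun s hs => (hF s hs).1.smul_sub (hG s hs).1 1
  have heq : ∀ s ∈ Icc 0 T, toL2 (e s) = toL2 (fun _ y => w s y) - toL2 (fun _ y => W s y) :=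
    fun s hs => by rw [← one_smul ℝ (toL2 fun _ y => w s y), ← (hF s hs).1.toL2_sub (hG s hs).1 1]
  have hd : ∀ s ∈ Icc 0 T, HasDerivWithinAt (fun s => toL2 (e s)) (toL2 (F s) - toL2 (G s))
      (Icc 0 T) s := fun s hs =>
    ((hasDerivWithinAt_toL2 hs (fun r hr => (hF r hr).1) (hF s hs).2.1 (hF s hs).2.2.2).sub
      (hasDerivWithinAt_toL2 hs (fun r hr => (hG r hr).1) (hG s hs).2.1
        (hG s hs).2.2.2)).congr heq (heq s hs)
  have hpde : ∀ s ∈ Ico 0 T, toL2 (F s) - toL2 (G s) = ν • toL2 (OscFlow.dY (OscFlow.dY (e s))) := by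
    intro s hs
    have hs' := Ico_subset_Icc_self hs
    obtain ⟨f1, f2, f3, -⟩ := hF s hs'
    obtain ⟨g1, g2, g3, -⟩ := hG s hs'
    have h1 : toL2 (F s) - toL2 (G s) = toL2 fun θ y => 1 * F s θ y - G s θ y := by
      rw [f2.toL2_sub g2, one_smul]
    have z0 : toL2 (fun _ _ => 0) = 0 := by
      have := f1.toL2_sub f1 1
      simpa using this
    have zm : MemHInf (fun _ _ => 0) := by
      simpa using f1.smul_sub f1 1
    have h2 : ν • toL2 (OscFlow.dY (OscFlow.dY (e s))) =
        toL2 fun θ y => ν * OscFlow.dY (OscFlow.dY (e s)) θ y - 0 := by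
      rw [(he' s hs').dY.dY.toL2_sub zm, z0, sub_zero]
    rw [h1, h2]
    congr 1
    funext θ y
    have a1 := dT_eq_of_hasDerivWithinAt_Icc hs (f3 θ y)
    have a2 := dT_eq_of_hasDerivWithinAt_Icc hs (g3 θ y)
    have b1 := h ⟨s, hs.1⟩ y
    have b2 := h' ⟨s, hs.1⟩ y
    change dT (fun s => w s y) s - ν * deriv (fun x => deriv (fun z => w s z) x) y = _ at b1
    change dT (fun s => W s y) s - ν * deriv (fun x => deriv (fun z => W s z) x) y = _ at b2
    rw [a1] at b1
    rw [a2] at b2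
    have c1 : OscFlow.dY (e s) = fun θ y => 1 * OscFlow.dY (fun _ y => w s y) θ y -
        OscFlow.dY (fun _ y => W s y) θ y := by
      funext θ y
      exact (((f1.hasDerivAt_y θ y).const_mul 1).sub (g1.hasDerivAt_y θ y)).deriv
    have c2 : OscFlow.dY (OscFlow.dY (e s)) θ y =
        1 * OscFlow.dY (OscFlow.dY (fun _ y => w s y)) θ y -
        OscFlow.dY (OscFlow.dY (fun _ y => W s y)) θ y := by
      rw [c1]
      exact (((f1.dY.hasDerivAt_y θ y).const_mul 1).sub (g1.dY.hasDerivAt_y θ y)).deriv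
    rw [c2]
    have d1 : OscFlow.dY (OscFlow.dY (fun _ y => w s y)) θ y =
      deriv (fun x => deriv (fun z => w s z) x) y := rfl
    have d2 : OscFlow.dY (OscFlow.dY (fun _ y => W s y)) θ y =
      deriv (fun x => deriv (fun z => W s z) x) y := rfl
    rw [d1, d2]
    linarith
  have hE : ∀ s ∈ Icc 0 T, HasDerivWithinAt (fun s => inner ℝ (toL2 (e s)) (toL2 (e s)))
      (inner ℝ (toL2 (e s)) (toL2 (F s) - toL2 (G s)) +
        inner ℝ (toL2 (F s) - toL2 (G s)) (toL2 (e s))) (Icc 0 T) s := fun s hs =>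
    (hd s hs).inner ℝ (hd s hs)
  -- The derivative of `‖e‖²` is `2ν ⟨e, ∂_yy e⟩`, which is nonpositive after integration by parts
  -- on the line.
  have hanti : AntitoneOn (fun s => inner ℝ (toL2 (e s)) (toL2 (e s))) (Icc 0 T) := by
    refine antitoneOn_of_hasDerivWithinAt_nonpos (convex_Icc 0 T)
      (fun s hs => (hE s hs).continuousWithinAt)
      (fun s hs => (hE s (interior_subset hs)).mono interior_subset) fun s hs => ?_
    rw [interior_Icc] at hs
    have hs' := Ioo_subset_Icc_self hs
    rw [hpde s ⟨hs.1.le, hs.2⟩, inner_smul_left, inner_smul_right,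
      real_inner_comm (toL2 (e s)), inner_toL2 (he' s hs') (he' s hs').dY.dY]
    have := (he' s hs').integral_mul_dY_dY_nonpos fun _ _ _ => rfl
    simp only [conj_trivial]
    nlinarith
  have hT0 : (0 : ℝ) ∈ Icc 0 T := ⟨le_rfl, by linarith⟩
  have hz : toL2 (e t) = 0 := by
    have := hanti hT0 (Ico_subset_Icc_self htT) ht
    have h00 : toL2 (e 0) = 0 := by rw [heq 0 hT0, h0, sub_self]
    simp only [h00, inner_zero_left] at this
    exact inner_self_eq_zero.1 (le_antisymm this real_inner_self_nonneg)
  funext y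
  have := (he' t (Ico_subset_Icc_self htT)).eq_zero_of_toL2 (fun _ _ _ => rfl) hz 0 y
  simp only [he, one_mul] at this
  exact sub_eq_zero.1 this

end Uniqueness

end

end OscFlow

namespace OscFlow

noncomputable section

/-! ### The algebra of coefficients depending on `θ`. -/

section Coefficients

lemma SmoothPer.const (c : ℝ) : SmoothPer fun _ => c := ⟨contDiff_const, fun _ => rfl⟩

lemma SmoothPer.add {c d : ℝ → ℝ} (hc : SmoothPer c) (hd : SmoothPer d) : SmoothPer (c + d) :=
  ⟨hc.1.add hd.1, hc.2.add hd.2⟩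

lemma SmoothPer.mul {c d : ℝ → ℝ} (hc : SmoothPer c) (hd : SmoothPer d) : SmoothPer (c * d) :=
  ⟨hc.1.mul hd.1, hc.2.mul hd.2⟩

/-- The algebra of smooth functions of `θ ∈ 𝕋`. -/
def coefAlg : Subalgebra ℝ (ℝ → ℝ) where
  carrier := {c | SmoothPer c}
  mul_mem' hc hd := hc.mul hd
  add_mem' hc hd := hc.add hd
  algebraMap_mem' r := SmoothPer.const r

/-- Smooth functions of `θ ∈ 𝕋`. -/
abbrev Cf : Type := coefAlg

namespace Cf

instance : CommRing Cf := inferInstance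
instance : Semiring Cf := inferInstance
instance : Monoid Cf := inferInstance
instance : AddCommGroup Cf := inferInstance
instance : Algebra ℝ Cf := inferInstance
instance : Module ℝ Cf := inferInstance

lemma smoothPer (c : Cf) : SmoothPer (c : ℝ → ℝ) := c.2

/-- The derivative in `θ`. -/
def d (c : Cf) : Cf := ⟨deriv (c : ℝ → ℝ), c.smoothPer.deriv⟩

/-- The mean over `𝕋`. -/
def mean (c : Cf) : ℝ := ∫ θ in (0 : ℝ)..1, (c : ℝ → ℝ) θ

lemma intervalIntegrable (c : Cf) (a b : ℝ) : IntervalIntegrable (c : ℝ → ℝ) volume a b :=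
  c.smoothPer.continuous.intervalIntegrable a b

lemma d_mul (c e : Cf) : (c * e).d = c.d * e + c * e.d := by
  ext θ
  exact ((c.smoothPer.hasDerivAt θ).mul (e.smoothPer.hasDerivAt θ)).deriv

lemma mean_d (c : Cf) : c.d.mean = 0 := by
  have := intervalIntegral.integral_eq_sub_of_hasDerivAt (a := 0) (b := 1)
    (fun x _ => c.smoothPer.hasDerivAt x) (c.d.intervalIntegrable 0 1)
  have h2 := c.smoothPer.2 0
  rw [zero_add] at h2
  rw [h2, sub_self] at this
  exact this

lemma mean_add (c e : Cf) : (c + e).mean = c.mean + e.mean :=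
  intervalIntegral.integral_add (c.intervalIntegrable 0 1) (e.intervalIntegrable 0 1)

lemma mean_sub (c e : Cf) : (c - e).mean = c.mean - e.mean :=
  intervalIntegral.integral_sub (c.intervalIntegrable 0 1) (e.intervalIntegrable 0 1)

lemma mean_smul (r : ℝ) (c : Cf) : (r • c).mean = r * c.mean :=
  intervalIntegral.integral_const_mul r _

lemma mean_one : (1 : Cf).mean = 1 := by
  show ∫ θ in (0 : ℝ)..1, (1 : ℝ) = 1
  simp

lemma hasDerivAt_primitive {u : ℝ → ℝ} (hu : Continuous u) (x : ℝ) :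
    HasDerivAt (primitive u) (u x) x :=
  (intervalIntegral.integral_hasDerivAt_right (hu.intervalIntegrable _ _)
    (hu.stronglyMeasurableAtFilter _ _) hu.continuousAt).sub_const _

lemma smoothPer_primitive (c : Cf) (hc : c.mean = 0) : SmoothPer (primitive c) := by
  have hd := hasDerivAt_primitive c.smoothPer.continuous
  refine ⟨contDiff_infty_iff_deriv.2 ⟨fun x => (hd x).differentiableAt, ?_⟩, fun θ => ?_⟩
  · rw [funext fun x => (hd x).deriv]
    exact c.smoothPer.1
  · have h1 := c.smoothPer.2.intervalIntegral_add_eq θ 0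
    rw [zero_add] at h1
    have h2 := intervalIntegral.integral_add_adjacent_intervals (c.intervalIntegrable 0 θ)
      (c.intervalIntegrable θ (θ + 1))
    have h3 : ∫ x in (0 : ℝ)..1, (c : ℝ → ℝ) x = 0 := hc
    simp only [primitive]
    rw [← h2, h1, h3, add_zero]

/-- The primitive of mean zero of `c - mean c`. -/
def prim (c : Cf) : Cf := ⟨primitive ((c - c.mean • 1 : Cf) : ℝ → ℝ), smoothPer_primitive _ (by
  rw [mean_sub, mean_smul, mean_one]; ring)⟩

lemma d_prim (c : Cf) : c.prim.d = c - c.mean • 1 := by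
  ext θ
  exact (hasDerivAt_primitive (c - c.mean • 1 : Cf).smoothPer.continuous θ).deriv

lemma mean_prim (c : Cf) : c.prim.mean = 0 := by
  have hc : Continuous fun θ : ℝ => ∫ s in (0 : ℝ)..θ, ((c - c.mean • 1 : Cf) : ℝ → ℝ) s :=
    intervalIntegral.continuous_primitive (fun a b => (c - c.mean • 1).intervalIntegrable a b) 0
  show ∫ θ in (0 : ℝ)..1, primitive ((c - c.mean • 1 : Cf) : ℝ → ℝ) θ = 0
  simp only [primitive]
  rw [intervalIntegral.integral_sub (hc.intervalIntegrable 0 1) (by simp)]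
  simp

lemma d_smul (r : ℝ) (c : Cf) : (r • c).d = r • c.d := by
  ext θ
  exact ((c.smoothPer.hasDerivAt θ).const_mul r).deriv

lemma mean_d_mul (c e : Cf) : (c.d * e).mean = -(c * e.d).mean := by
  have := mean_d (c * e)
  rw [d_mul, mean_add] at this
  linarith

end Cf

end Coefficients

/-! ### Slow profiles as a module over the coefficients. -/

section Bundled

/-- The algebra of slow profiles. -/
def slowAlg : NonUnitalSubalgebra ℝ (ℝ≥0 → Cyl) where
  carrier := {f | Slow f}
  mul_mem' hf hg := hf.mul hg
  add_mem' hf hg := hf.add hg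
  zero_mem' := Slow.zero
  smul_mem' c _ hf := hf.const_mul c

/-- Slow profiles. -/
abbrev Sl : Type := slowAlg

namespace Sl

instance : NonUnitalNonAssocRing Sl := inferInstance
instance : NonUnitalNonAssocSemiring Sl := inferInstance
instance : AddCommGroup Sl := inferInstance
instance : AddCommMonoid Sl := inferInstance
instance : AddGroup Sl := inferInstance
instance : SubNegMonoid Sl := inferInstance
instance : AddMonoid Sl := inferInstance
instance : AddZeroClass Sl := inferInstance
instance : Module ℝ Sl := inferInstance
instance : DistribMulAction ℝ Sl := inferInstance
instance : MulAction ℝ Sl := inferInstance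

lemma slow (f : Sl) : Slow (f : ℝ≥0 → Cyl) := f.2

/-- Multiplication by a function of `θ`. -/
def cmul (c : Cf) (f : Sl) : Sl :=
  ⟨fun t θ y => (c : ℝ → ℝ) θ * (f : ℝ≥0 → Cyl) t θ y, Reg.theta_mul f.2 c.2⟩

instance : SMul Cf Sl := ⟨cmul⟩

lemma smul_apply (c : Cf) (f : Sl) (t : ℝ≥0) (θ y : ℝ) :
    (c • f : Sl).1 t θ y = (c : ℝ → ℝ) θ * f.1 t θ y := rfl

instance : Module Cf Sl where
  one_smul f := by ext t θ y; exact one_mul _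
  mul_smul c e f := by ext t θ y; exact mul_assoc _ _ _
  smul_zero c := by ext t θ y; exact mul_zero _
  smul_add c f g := by ext t θ y; exact mul_add _ _ _
  add_smul c e f := by ext t θ y; exact add_mul _ _ _
  zero_smul f := by ext t θ y; exact zero_mul _

instance : DistribMulAction Cf Sl := inferInstance
instance : MulAction Cf Sl := inferInstance

instance : IsScalarTower ℝ Cf Sl := ⟨fun r c f => by ext t θ y; exact mul_assoc _ _ _⟩

lemma smul_comm' (r : ℝ) (c : Cf) (f : Sl) : c • r • f = r • c • f := by
  ext t θ y; exact mul_left_comm _ _ _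

lemma mul_smul' (c : Cf) (f g : Sl) : f * c • g = c • (f * g) := by
  ext t θ y; exact mul_left_comm _ _ _

/-- `∂_t, ∂_θ, ∂_y` for `i = 0, 1, 2`. -/
def di (i : Fin 3) : Sl →ₗ[ℝ] Sl where
  toFun f := ⟨D i f, f.slow.D i⟩
  map_add' f g := Subtype.ext (D_add f.2 g.2 i)
  map_smul' c f := Subtype.ext (D_const_mul f.2 c i)

/-- The mean in `θ`. -/
def mn : Sl →ₗ[ℝ] Sl where
  toFun f := ⟨Mn f, f.slow.mn⟩
  map_add' f g := Subtype.ext (Mn_add f.2 g.2)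
  map_smul' c _ := Subtype.ext (Mn_const_mul _ c)

/-- The primitive of mean zero in `θ` of `f - mn f`. -/
def pr (f : Sl) : Sl := ⟨Pr f, f.slow.pr⟩

lemma di_coe (i : Fin 3) (f : Sl) : (di i f).1 = D i f.1 := rfl

lemma mn_coe (f : Sl) : (mn f).1 = Mn f.1 := rfl

lemma mn_smul (r : ℝ) (f : Sl) : mn (r • f) = r • mn f := map_smul mn r f

lemma di_one_smul (c : Cf) (f : Sl) : di 1 (c • f) = c.d • f + c • di 1 f := by
  ext t θ y
  exact ((c.smoothPer.hasDerivAt θ).mul (f.slow.hasDeriv_x t θ y)).deriv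

lemma di_two_smul (c : Cf) (f : Sl) : di 2 (c • f) = c • di 2 f := by
  ext t θ y
  exact ((f.slow.hasDeriv_y t θ y).const_mul _).deriv

lemma di_comm_xy (f : Sl) : di 1 (di 2 f) = di 2 (di 1 f) := Subtype.ext f.slow.D_comm_xy

lemma di_mn (i : Fin 3) (f : Sl) : di i (mn f) = mn (di i f) := Subtype.ext (D_Mn f.2 i)

lemma mn_di_one (f : Sl) : mn (di 1 f) = 0 := Subtype.ext f.slow.Mn_D_x

lemma mn_pr (f : Sl) : mn (pr f) = 0 := Subtype.ext f.slow.Mn_Pr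

lemma di_pr (f : Sl) : di 1 (pr f) = f - mn f := Subtype.ext f.slow.D_x_Pr

lemma pr_zero : pr 0 = 0 := by
  ext t θ y
  show Pr (fun _ _ _ => 0) t θ y = 0
  simp [Pr, av]

lemma mn_mn (f : Sl) : mn (mn f) = mn f := Subtype.ext (Mn_Mn f.2)

lemma mn_theta {f : Sl} (hf : mn f = f) (t : ℝ≥0) (θ θ' y : ℝ) : f.1 t θ y = f.1 t θ' y := by
  rw [← hf]
  exact f.slow.Mn_theta t θ θ' y

lemma mn_of_const {f : Sl} (hf : ∀ t θ θ' y, f.1 t θ y = f.1 t θ' y) : mn f = f :=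
  Subtype.ext (Mn_of_const hf)

lemma mn_smul_of_const (c : Cf) {f : Sl} (hf : mn f = f) : mn (c • f) = c.mean • f := by
  ext t θ y
  have hp : ∀ (t : ℝ≥0) (θ y : ℝ), (c : ℝ → ℝ) (θ + 1) * f.1 t (θ + 1) y = (c : ℝ → ℝ) θ * f.1 t θ y :=
    fun t θ y => by rw [c.smoothPer.2 θ, f.slow.per]
  have h1 := Mn_apply_of_per (f := (c • f : Sl).1) hp t θ y
  refine h1.trans ?_
  show ∫ x in (0 : ℝ)..1, (c : ℝ → ℝ) x * f.1 t x y = c.mean * f.1 t θ y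
  simp only [mn_theta hf t _ θ y]
  exact intervalIntegral.integral_mul_const _ _

lemma mn_mul_of_const {f g : Sl} (hf : mn f = f) (hg : mn g = g) : mn (f * g) = f * g :=
  mn_of_const fun t θ θ' y => by
    show f.1 t θ y * g.1 t θ y = f.1 t θ' y * g.1 t θ' y
    rw [mn_theta hf t θ θ', mn_theta hg t θ θ']

lemma di_one_of_const {f : Sl} (hf : mn f = f) : di 1 f = 0 := by
  rw [← hf, di_mn, mn_di_one]

lemma mn_di_of_const {f : Sl} (i : Fin 3) (hf : mn f = f) : mn (di i f) = di i f := by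
  rw [← di_mn, hf]

lemma mn_smul_di (c : Cf) (f : Sl) : mn (c • di 1 f) = - mn (c.d • f) := by
  have := mn_di_one (c • f)
  rw [di_one_smul, map_add] at this
  exact eq_neg_of_add_eq_zero_right this

/-- Two integrations by parts on the circle. In this way a mean against an unknown profile is
exchanged for a mean against the right-hand side of its equation. -/
lemma mn_smul_di_di (c : Cf) (f : Sl) : mn (c • di 1 (di 1 f)) = mn (c.d.d • f) := by
  rw [mn_smul_di, mn_smul_di, neg_neg]

lemma di_di_pr_pr {f : Sl} (hf : mn f = 0) : di 1 (di 1 (pr (pr f))) = f := by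
  rw [di_pr, mn_pr, sub_zero, di_pr, hf, sub_zero]

attribute [irreducible] cmul di mn pr

end Sl

end Bundled

/-! ### Coefficients of shifted series and of products. -/

section Sequences

variable {A : Type*} [NonUnitalNonAssocSemiring A]

/-- The coefficients of `ε^m ∑ ε^n a n`. -/
def sh (m : ℕ) (a : ℕ → A) (n : ℕ) : A := if m ≤ n then a (n - m) else 0

/-- The coefficients of a product of two series. -/
def conv (a b : ℕ → A) (n : ℕ) : A :=
  ∑ p ∈ Finset.HasAntidiagonal.antidiagonal n, a p.1 * b p.2

lemma sh_congr {m n : ℕ} {a b : ℕ → A} (h : ∀ i, i + m ≤ n → a i = b i) : sh m a n = sh m b n := by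
  unfold sh
  split_ifs with hm
  · exact h _ (by omega)
  · rfl

lemma conv_congr {n : ℕ} {a a' b b' : ℕ → A} (ha : ∀ i ≤ n, a i = a' i) (hb : ∀ i ≤ n, b i = b' i) :
    conv a b n = conv a' b' n := by
  refine Finset.sum_congr rfl fun p hp => ?_
  have := Finset.HasAntidiagonal.mem_antidiagonal.1 hp
  rw [ha _ (by omega), hb _ (by omega)]

lemma sh_zero_lt {m n : ℕ} (h : n < m) (a : ℕ → A) : sh m a n = 0 := if_neg (by omega)

lemma sh_add_right (m n : ℕ) (a : ℕ → A) : sh m a (n + m) = a n := by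
  simp [sh]

lemma sh_succ_succ (m n : ℕ) (a : ℕ → A) : sh (m + 1) a (n + 1) = sh m a n := by
  simp [sh]

lemma conv_eq_mul_left {n : ℕ} {u : ℕ → A} (hu : ∀ i < n, u i = 0) (b : ℕ → A) :
    conv u b n = u n * b 0 := by
  refine (Finset.sum_eq_single (n, 0) (fun p hp hne => ?_) (fun h => ?_))
  · have h1 := Finset.HasAntidiagonal.mem_antidiagonal.1 hp
    have : p.1 < n := by
      rcases p with ⟨i, j⟩
      simp only [ne_eq, Prod.mk.injEq, not_and] at hne h1 ⊢
      by_contra hcon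
      exact hne (by omega) (by omega)
    rw [hu _ this, zero_mul]
  · exact absurd (Finset.HasAntidiagonal.mem_antidiagonal.2 (add_zero n)) h

lemma conv_eq_mul_right {n : ℕ} {u : ℕ → A} (hu : ∀ i < n, u i = 0) (a : ℕ → A) :
    conv a u n = a 0 * u n := by
  refine (Finset.sum_eq_single (0, n) (fun p hp hne => ?_) (fun h => ?_))
  · have h1 := Finset.HasAntidiagonal.mem_antidiagonal.1 hp
    have : p.2 < n := by
      rcases p with ⟨i, j⟩
      simp only [ne_eq, Prod.mk.injEq, not_and] at hne h1 ⊢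
      by_contra hcon
      exact hne (by omega) (by omega)
    rw [hu _ this, mul_zero]
  · exact absurd (Finset.HasAntidiagonal.mem_antidiagonal.2 (zero_add n)) h

lemma conv_add_left (a a' b : ℕ → A) (n : ℕ) :
    conv (fun i => a i + a' i) b n = conv a b n + conv a' b n := by
  simp only [conv, add_mul, Finset.sum_add_distrib]

lemma conv_add_right (a b b' : ℕ → A) (n : ℕ) :
    conv a (fun i => b i + b' i) n = conv a b n + conv a b' n := by
  simp only [conv, mul_add, Finset.sum_add_distrib]

end Sequences

end

end OscFlow

namespace OscFlow

noncomputable section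

open Sl

/-! ### Homogenization: the slow equations and their solvability conditions. -/

section Slow

/-- The nonlinear terms of order `n`. -/
@[irreducible] def slowNL (M : ℕ) (j : Fin 2) (v : ℕ → Fin 2 → Sl) (n : ℕ) : Sl :=
  sh M (conv (fun i => v i 0) (fun i => di 1 (v i j))) n +
    sh (M + 1) (conv (fun i => v i 1) (fun i => di 2 (v i j))) n

/-- The terms of order `n` in the compressible part of the dissipation that involve `v_j` only. -/
@[irreducible] def slowVisc (lam : ℝ) (j : Fin 2) (v : ℕ → Fin 2 → Sl) (n : ℕ) : Sl :=
  lam • (if j = 0 then sh 1 (fun i => di 1 (di 1 (v i 0))) n else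
    sh 3 (fun i => di 2 (di 2 (v i 1))) n)

/-- The terms of order `n` that are determined by the profiles of order `< n`. -/
@[irreducible] def slowR (μ lam : ℝ) (h : Cf) (M : ℕ) (j : Fin 2) (v : ℕ → Fin 2 → Sl) (n : ℕ) : Sl :=
  h • sh 1 (fun i => di 2 (v i j)) n +
    sh 2 (fun i => di 0 (v i j) - μ • di 2 (di 2 (v i j)) - lam • di 1 (di 2 (v i (1 - j)))) n +
    slowNL M j v n - slowVisc lam j v n

/-- The equations of order `n` for the slow profiles. -/
def SlowEq (μ lam : ℝ) (h : Cf) (M : ℕ) (v : ℕ → Fin 2 → Sl) (n : ℕ) : Prop :=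
  μ • di 1 (di 1 (v n 0)) = slowR μ lam h M 0 v n ∧
    μ • di 1 (di 1 (v n 1)) = h.d • v n 0 + slowR μ lam h M 1 v n

variable {μ lam : ℝ} {h : Cf} {M : ℕ} {v v' : ℕ → Fin 2 → Sl} {n k : ℕ}

lemma slowNL_congr (j : Fin 2) (hv : ∀ i, i + M ≤ n → v i = v' i) :
    slowNL M j v n = slowNL M j v' n := by
  unfold slowNL
  congr 1
  · exact sh_congr fun i hi => conv_congr (fun l hl => by rw [hv l (by omega)])
      fun l hl => by rw [hv l (by omega)]
  · exact sh_congr fun i hi => conv_congr (fun l hl => by rw [hv l (by omega)])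
      fun l hl => by rw [hv l (by omega)]

/-- Each term carries at least one power of `ε`, the nonlinear ones because `1 ≤ M`; hence only
orders below `n` enter. -/
lemma slowR_congr (hM : 1 ≤ M) (j : Fin 2) (hv : ∀ i < n, v i = v' i) :
    slowR μ lam h M j v n = slowR μ lam h M j v' n := by
  unfold slowR slowVisc
  rw [slowNL_congr j fun i hi => hv i (by omega)]
  rw [sh_congr (m := 1) (a := fun i => di 2 (v i j)) (b := fun i => di 2 (v' i j)) fun i hi => by rw [hv i (by omega)],
    sh_congr (m := 2) (b := fun i => di 0 (v' i j) - μ • di 2 (di 2 (v' i j)) -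
      lam • di 1 (di 2 (v' i (1 - j)))) fun i hi => by rw [hv i (by omega)],
    sh_congr (m := 1) (a := fun i => di 1 (di 1 (v i 0))) (b := fun i => di 1 (di 1 (v' i 0)))
      fun i hi => by rw [hv i (by omega)],
    sh_congr (m := 3) (b := fun i => di 2 (di 2 (v' i 1))) fun i hi => by rw [hv i (by omega)]]

lemma slowR_zero (hM : 1 ≤ M) (j : Fin 2) : slowR μ lam h M j v 0 = 0 := by
  unfold slowR slowVisc slowNL
  rw [sh_zero_lt one_pos, sh_zero_lt two_pos, sh_zero_lt (by omega), sh_zero_lt (by omega),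
    sh_zero_lt one_pos, sh_zero_lt three_pos]
  simp

lemma slowR_one (hM : 2 ≤ M) (j : Fin 2) : slowR μ lam h M j v 1 =
    h • di 2 (v 0 j) - (if j = 0 then lam • di 1 (di 1 (v 0 0)) else 0) := by
  unfold slowR slowVisc slowNL
  rw [sh_zero_lt (m := 2) one_lt_two, sh_zero_lt (m := M) (by omega),
    sh_zero_lt (m := M + 1) (by omega), sh_zero_lt (m := 3) (by omega),
    sh_add_right 1 0, sh_add_right 1 0]
  split_ifs <;> simp

/-- Order `k` reaches order `k + 1` only through the terms with exactly one power of `ε`: the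
transport by `h` and, in the first component, the compressible viscosity. `2 ≤ M` keeps the
nonlinearity out. -/
lemma slowR_sub (hM : 2 ≤ M) (j : Fin 2) (hv : ∀ i < k, v i = v' i) :
    slowR μ lam h M j v (k + 1) = slowR μ lam h M j v' (k + 1) +
      (h • di 2 (v k j - v' k j) - (if j = 0 then lam • di 1 (di 1 (v k 0 - v' k 0)) else 0)) := by
  unfold slowR slowVisc
  rw [slowNL_congr j fun i hi => hv i (by omega)]
  rw [sh_congr (m := 2) (b := fun i => di 0 (v' i j) - μ • di 2 (di 2 (v' i j)) -
      lam • di 1 (di 2 (v' i (1 - j)))) fun i hi => by rw [hv i (by omega)],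
    sh_congr (m := 3) (b := fun i => di 2 (di 2 (v' i 1))) fun i hi => by rw [hv i (by omega)],
    sh_add_right 1 k, sh_add_right 1 k, sh_add_right 1 k, sh_add_right 1 k]
  split_ifs
  · simp only [map_sub, smul_sub]; abel
  · simp only [map_sub, smul_sub]; abel

lemma slowR_add_two (j : Fin 2) : slowR μ lam h M j v (k + 2) = h • di 2 (v (k + 1) j) +
    (di 0 (v k j) - μ • di 2 (di 2 (v k j)) - lam • di 1 (di 2 (v k (1 - j)))) +
    slowNL M j v (k + 2) - slowVisc lam j v (k + 2) := by
  unfold slowR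
  rw [sh_add_right 2 k, show k + 2 = (k + 1) + 1 from rfl, sh_add_right 1 (k + 1)]

lemma slowVisc_zero_add_two : slowVisc lam 0 v (k + 2) = lam • di 1 (di 1 (v (k + 1) 0)) := by
  unfold slowVisc
  rw [if_pos rfl, show k + 2 = (k + 1) + 1 from rfl, sh_add_right 1 (k + 1)]

lemma slowVisc_one_congr (hv : ∀ i < k, v i = v' i) :
    slowVisc lam 1 v (k + 2) = slowVisc lam 1 v' (k + 2) := by
  unfold slowVisc
  rw [sh_congr (m := 3) (b := fun i => di 2 (di 2 (v' i 1))) fun i hi => by rw [hv i (by omega)]]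
  simp

/-- The profile of order `k` enters at order `k + 2` only if `M = 2`, and then it is paired with the
profile of order zero: in the Cauchy product, a sequence that vanishes below `k` leaves one term. -/
lemma slowNL_sub (hM : 2 ≤ M) (j : Fin 2) (hv : ∀ i < k, v i = v' i) :
    slowNL M j v (k + 2) = slowNL M j v' (k + 2) + (if M = 2 then
      (v k 0 - v' k 0) * di 1 (v 0 j) + v' 0 0 * di 1 (v k j - v' k j) else 0) := by
  split_ifs with h2
  · subst h2
    unfold slowNL
    rw [sh_add_right 2 k, sh_add_right 2 k, sh_congr (m := 2 + 1)
      (b := conv (fun i => v' i 1) (fun i => di 2 (v' i j))) fun i hi =>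
        conv_congr (fun l hl => by rw [hv l (by omega)]) fun l hl => by rw [hv l (by omega)]]
    have e1 : conv (fun i => v i 0) (fun i => di 1 (v i j)) k =
        conv (fun i => v' i 0) (fun i => di 1 (v i j)) k +
          conv (fun i => v i 0 - v' i 0) (fun i => di 1 (v i j)) k := by
      rw [← conv_add_left]; simp
    have e2 : conv (fun i => v' i 0) (fun i => di 1 (v i j)) k =
        conv (fun i => v' i 0) (fun i => di 1 (v' i j)) k +
          conv (fun i => v' i 0) (fun i => di 1 (v i j - v' i j)) k := by
      rw [← conv_add_right]; simp
    rw [e1, e2, conv_eq_mul_left (u := fun i => v i 0 - v' i 0) (fun i hi => by rw [hv i hi, sub_self]),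
      conv_eq_mul_right (u := fun i => di 1 (v i j - v' i j))
        (fun i hi => by rw [hv i hi, sub_self, map_zero])]
    abel
  · rw [slowNL_congr j fun i hi => hv i (by omega), add_zero]

/-- The correctors of the homogenization in `θ`. -/
structure Correctors (μ : ℝ) (h a χ b : Cf) : Prop where
  mean_h : h.mean = 0
  mean_a : a.mean = 0
  d_a : μ • a.d = h
  d_χ : χ.d = a
  d_b : μ • b.d = χ * h - (χ * h).mean • 1

variable {a χ b : Cf}

lemma Correctors.mean_a_mul_h (hc : Correctors μ h a χ b) : (a * h).mean = 0 := by
  have := Cf.mean_d_mul a a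
  rw [← hc.d_a, mul_smul_comm, Cf.mean_smul, mul_comm a]
  rw [mul_comm a] at this
  have h0 : (a.d * a).mean = 0 := by linarith
  rw [h0, mul_zero]

lemma Correctors.mean_d_a (_ : Correctors μ h a χ b) : a.d.mean = 0 := Cf.mean_d a

lemma Correctors.mean_a_mul_d_a (_ : Correctors μ h a χ b) : (a * a.d).mean = 0 := by
  have := Cf.mean_d_mul a a
  rw [mul_comm a.d] at this
  linarith

/-- `Π(b h) = μ Π(b a') = -Π(μ b' a) = -Π(χ h a)`, as `Π a = 0`. This identity removes `∂_yy w¹`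
from the equation for `w²`. -/
lemma Correctors.mean_b_mul_h (hc : Correctors μ h a χ b) :
    (b * h).mean + (χ * h * a).mean = 0 := by
  have h1 := Cf.mean_d_mul b a
  have h2 : (μ • b.d * a).mean = (χ * h * a).mean := by
    rw [hc.d_b, sub_mul, smul_mul_assoc, one_mul, Cf.mean_sub, Cf.mean_smul, hc.mean_a, mul_zero,
      sub_zero]
  rw [← h2, smul_mul_assoc, Cf.mean_smul, h1]
  conv_lhs => rw [← hc.d_a, mul_smul_comm, Cf.mean_smul]
  ring

/-- `Π(χ h) = μ Π(χ a') = -μ Π(χ' a)` with `χ' = a`. The square fixes the sign: the shear can only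
increase the viscosity. -/
lemma Correctors.mean_χ_mul_h (hc : Correctors μ h a χ b) : (χ * h).mean = -(μ * (a * a).mean) := by
  have h1 := Cf.mean_d_mul χ a
  rw [hc.d_χ] at h1
  conv_lhs => rw [← hc.d_a, mul_smul_comm, Cf.mean_smul]
  rw [h1]; ring

/-- The correctors satisfy `μ χ'' = h`, `μ a'' = h'` and `μ b'' = (χ h)'`. Means against these three
functions thus become means of `μ ∂_θθ f`, which the slow equations express through lower orders. -/
lemma Correctors.mn_h_smul (hc : Correctors μ h a χ b) (f : Sl) :
    mn (h • f) = mn (χ • μ • di 1 (di 1 f)) := by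
  rw [smul_comm', Sl.mn_smul, mn_smul_di_di, hc.d_χ, ← Sl.mn_smul, ← smul_assoc, hc.d_a]

lemma Correctors.mn_d_h_smul (hc : Correctors μ h a χ b) (f : Sl) :
    mn (h.d • f) = mn (a • μ • di 1 (di 1 f)) := by
  rw [smul_comm', Sl.mn_smul, mn_smul_di_di, ← Sl.mn_smul, ← smul_assoc, ← Cf.d_smul, hc.d_a]

lemma Cf.d_sub (c e : Cf) : (c - e).d = c.d - e.d := by
  ext θ
  exact ((c.smoothPer.hasDerivAt θ).sub (e.smoothPer.hasDerivAt θ)).deriv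

lemma Cf.d_one : (1 : Cf).d = 0 := by
  ext θ
  exact deriv_const θ (1 : ℝ)

lemma Correctors.mn_d_mul_smul (hc : Correctors μ h a χ b) (f : Sl) :
    mn ((χ * h).d • f) = mn (b • μ • di 1 (di 1 f)) := by
  rw [smul_comm', Sl.mn_smul, mn_smul_di_di, ← Sl.mn_smul, ← smul_assoc, ← Cf.d_smul, hc.d_b, Cf.d_sub,
    Cf.d_smul, Cf.d_one, smul_zero, sub_zero]

section Sources

variable (μ lam h M a χ b)

/-- The sources of the homogenized equations of order `k`, up to sign. -/
@[irreducible] def sourceG (j : Fin 2) (v : ℕ → Fin 2 → Sl) (k : ℕ) : Sl :=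
  if j = 0 then di 2 (mn (χ • slowR μ lam h M 0 v (k + 1))) + mn (slowNL M 0 v (k + 2)) else
    di 2 (mn (b • slowR μ lam h M 0 v (k + 1))) + di 2 (mn (χ • slowR μ lam h M 1 v (k + 1)))
      - (lam * μ⁻¹) • mn (a • slowR μ lam h M 0 v (k + 1))
      + mn (a • (di 0 (v k 0) - μ • di 2 (di 2 (v k 0)))) - lam • di 2 (mn (a • di 1 (v k 1)))
      + mn (a • slowNL M 0 v (k + 2)) - mn (slowVisc lam 1 v (k + 2)) + mn (slowNL M 1 v (k + 2))

/-- The oscillating part of the slow profile of order `k`, up to a multiple of its mean. -/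
@[irreducible] def corrector (v : ℕ → Fin 2 → Sl) (k : ℕ) : Fin 2 → Sl :=
  let q := μ⁻¹ • pr (pr (slowR μ lam h M 0 v k))
  ![q, μ⁻¹ • pr (pr (h.d • q + slowR μ lam h M 1 v k))]

/-- The profiles of order `< k` of `v`, and the corrector of order `k`. -/
@[irreducible] def hat (v : ℕ → Fin 2 → Sl) (k : ℕ) : ℕ → Fin 2 → Sl := fun i =>
  if i < k then v i else if i = k then corrector μ lam h M v k else 0

/-- The source of the homogenized equation of order `k`. -/
@[irreducible] def source (v : ℕ → Fin 2 → Sl) (k : ℕ) (j : Fin 2) : Sl :=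
  - sourceG μ lam h M a χ b j (hat μ lam h M v k) k

end Sources

lemma mn_corrector (v : ℕ → Fin 2 → Sl) (k : ℕ) (j : Fin 2) :
    mn (corrector μ lam h M v k j) = 0 := by
  fin_cases j <;> simp [corrector, mn_pr]

lemma corrector_congr (hM : 1 ≤ M) (hv : ∀ i < k, v i = v' i) :
    corrector μ lam h M v k = corrector μ lam h M v' k := by
  simp only [corrector, slowR_congr hM _ hv]

lemma hat_congr (hM : 1 ≤ M) (hv : ∀ i < k, v i = v' i) :
    hat μ lam h M v k = hat μ lam h M v' k := by
  funext i
  simp only [hat, corrector_congr hM hv]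
  split_ifs with hi
  · exact hv i hi
  · rfl
  · rfl

lemma source_congr (hM : 1 ≤ M) (hv : ∀ i < k, v i = v' i) (j : Fin 2) :
    source μ lam h M a χ b v k j = source μ lam h M a χ b v' k j := by
  rw [source, source, hat_congr hM hv]

lemma mn_source (v : ℕ → Fin 2 → Sl) (k : ℕ) (j : Fin 2) :
    mn (source μ lam h M a χ b v k j) = source μ lam h M a χ b v k j := by
  unfold source sourceG
  split_ifs <;> simp only [map_neg, map_add, map_sub, map_smul, ← di_mn, mn_mn]

/-- The terms that contain the mean of the profile of order `k` in the source. -/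
lemma Correctors.sourceG_eq (hc : Correctors μ h a χ b) (hM : 2 ≤ M) (hv : ∀ i < k, v i = v' i)
    {w0 w1 c0 : Sl} (hw0 : mn w0 = w0) (hw1 : mn w1 = w1) (h0 : v k 0 = v' k 0 + w0)
    (h1 : v k 1 = v' k 1 + (w1 + a • w0)) (hv0 : di 1 (v 0 0) = 0) (hc0 : mn c0 = c0)
    (hv1 : di 1 (v 0 1) = a.d • c0) (hv0' : mn (v' 0 0) = v' 0 0) (j : Fin 2) :
    sourceG μ lam h M a χ b j v k = sourceG μ lam h M a χ b j v' k +
      (χ * h).mean • di 2 (di 2 (if j = 0 then w0 else w1)) := by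
  have e0 : v k 0 - v' k 0 = w0 := by rw [h0]; abel
  have e1 : v k 1 - v' k 1 = w1 + a • w0 := by rw [h1]; abel
  have dw0 : di 1 w0 = 0 := di_one_of_const hw0
  have dw1 : di 1 w1 = 0 := di_one_of_const hw1
  -- Neither `v 0 0` nor `w0` depends on `θ`, so both products vanish.
  have n0 : slowNL M 0 v (k + 2) = slowNL M 0 v' (k + 2) := by
    rw [slowNL_sub hM 0 hv, e0, hv0, dw0]; simp
  -- For `M = 2` the new products are `a'` times functions of `(t, y)`, and `a'` has mean zero.
  have n1 : mn (slowNL M 1 v (k + 2)) = mn (slowNL M 1 v' (k + 2)) := by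
    rw [slowNL_sub hM 1 hv, e0, e1, hv1, map_add, map_add, dw1, di_one_smul, dw0]
    split_ifs
    · rw [smul_zero, zero_add, add_zero, mul_smul', mul_smul', map_add,
        mn_smul_of_const _ (mn_mul_of_const hw0 hc0), mn_smul_of_const _ (mn_mul_of_const hv0' hw0),
        hc.mean_d_a]
      simp
    · simp
  have r0 : slowR μ lam h M 0 v (k + 1) = slowR μ lam h M 0 v' (k + 1) + h • di 2 w0 := by
    rw [slowR_sub hM 0 hv, e0, dw0]; simp
  have r1 : slowR μ lam h M 1 v (k + 1) = slowR μ lam h M 1 v' (k + 1) +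
      (h • di 2 w1 + (h * a) • di 2 w0) := by
    rw [slowR_sub hM 1 hv, e1]; simp [di_two_smul, mul_smul]
  have d0 := mn_di_of_const 2 hw0
  have d1 := mn_di_of_const 2 hw1
  have dd0 := mn_di_of_const 2 d0
  have t0 := mn_di_of_const 0 hw0
  unfold sourceG
  split_ifs
  · rw [n0, r0, smul_add, map_add, map_add, ← mul_smul, mn_smul_of_const _ d0, map_smul (di 2)]
    abel
  · rw [n0, n1, r0, r1, slowVisc_one_congr hv, h0, h1]
    simp only [map_add, map_sub, map_smul, smul_add, smul_sub, ← mul_smul, mn_smul_of_const _ d0,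
      mn_smul_of_const _ d1, hc.mean_a_mul_h, smul_comm', mn_smul_of_const _ dd0,
      mn_smul_of_const _ t0, hc.mean_a, dw1, di_one_smul, dw0, mn_smul_of_const _ hw0,
      hc.mean_a_mul_d_a, zero_smul, smul_zero, map_zero]
    -- The two contributions of `∂_yy w0` to the second equation, one through `b` and one through `a
    -- • w0`, cancel.
    have hb : (b * h).mean = -(χ * (h * a)).mean := by
      have := hc.mean_b_mul_h
      rw [mul_assoc] at this
      linarith
    rw [hb, neg_smul]
    simp only [add_zero]
    abel

/-- The solvability conditions of order `k + 2`, given the equations of order `k + 1`. -/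
lemma Correctors.mn_slowR_zero (hc : Correctors μ h a χ b) (he : SlowEq μ lam h M v (k + 1)) :
    mn (slowR μ lam h M 0 v (k + 2)) = di 0 (mn (v k 0)) - μ • di 2 (di 2 (mn (v k 0))) +
      sourceG μ lam h M a χ b 0 v k := by
  rw [slowR_add_two, slowVisc_zero_add_two, sourceG, if_pos rfl]
  simp only [map_add, map_sub, map_smul, mn_di_one, di_mn]
  -- `Π(h ∂_y v_{k+1}) = ∂_y Π(χ μ ∂_θθ v_{k+1}) = ∂_y Π(χ R_{k+1})` eliminates the profile of order
  -- `k + 1`.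
  rw [← di_two_smul, ← di_mn, hc.mn_h_smul, he.1, di_mn]
  simp only [smul_zero, sub_zero]
  abel

/-- Order `k + 1` enters the transport terms through `a h v¹ + h v²`. Testing the second equation
with `χ` turns `Π(h v²)` into `Π(χ h' v¹)` plus lower orders; then `a h + χ h' = (χ h)'`, and `b`
eliminates the result. The viscous term in `∂_θθ v¹` is replaced by means of the first equation. -/
lemma Correctors.mn_slowR_one (hc : Correctors μ h a χ b) (hμ : μ ≠ 0)
    (he : SlowEq μ lam h M v (k + 1)) :
    mn (a • slowR μ lam h M 0 v (k + 2) + slowR μ lam h M 1 v (k + 2)) =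
      di 0 (mn (v k 1)) - μ • di 2 (di 2 (mn (v k 1))) + sourceG μ lam h M a χ b 1 v k := by
  have e1 : mn ((χ * h).d • v (k + 1) 0) = mn (b • slowR μ lam h M 0 v (k + 1)) := by
    rw [hc.mn_d_mul_smul, he.1]
  have e2 : mn (h • v (k + 1) 1) =
      mn ((χ * h.d) • v (k + 1) 0) + mn (χ • slowR μ lam h M 1 v (k + 1)) := by
    rw [hc.mn_h_smul, he.2, smul_add, map_add, mul_smul]
  have e3 : mn (a • di 1 (di 1 (v (k + 1) 0))) = μ⁻¹ • mn (a • slowR μ lam h M 0 v (k + 1)) := by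
    rw [← he.1, smul_comm', Sl.mn_smul, smul_smul, inv_mul_cancel₀ hμ, one_smul]
  have e4 : mn ((χ * h).d • v (k + 1) 0) = mn ((a * h) • v (k + 1) 0) +
      mn ((χ * h.d) • v (k + 1) 0) := by
    rw [Cf.d_mul, hc.d_χ, add_smul, map_add]
  rw [slowR_add_two, slowR_add_two, slowVisc_zero_add_two, sourceG, if_neg (by decide)]
  simp only [map_add, map_sub, map_smul, mn_di_one, di_mn, smul_add, smul_sub, smul_comm', e3,
    smul_zero, sub_zero, show (1 : Fin 2) - 0 = 1 from rfl, show (1 : Fin 2) - 1 = 0 from rfl]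
  have f1 : mn (a • h • di 2 (v (k + 1) 0)) + mn (h • di 2 (v (k + 1) 1)) =
      mn (di 2 (b • slowR μ lam h M 0 v (k + 1))) + mn (di 2 (χ • slowR μ lam h M 1 v (k + 1))) := by
    rw [← mul_smul, ← di_two_smul, ← di_two_smul, ← di_mn, ← di_mn, ← di_mn, ← di_mn, e2, ← e1, e4]
    simp only [map_add]
    abel
  have f2 : mn (a • di 1 (di 2 (v k 1))) = mn (di 2 (a • di 1 (v k 1))) := by
    rw [di_two_smul, di_comm_xy]
  rw [f2]
  have f1' := eq_sub_of_add_eq f1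
  rw [f1']
  module

end Slow

end

end OscFlow

namespace OscFlow

noncomputable section

open Sl

/-! ### Slow profiles built from their means solve the slow equations. -/

section SlowSolution

variable {μ lam : ℝ} {h a χ b : Cf} {M : ℕ} {v w : ℕ → Fin 2 → Sl} {k n : ℕ}

/-- The slow profiles `v` are given by their means `w`, which solve the homogenized equations. -/
structure Homogenized (μ lam : ℝ) (h : Cf) (M : ℕ) (a χ b : Cf) (v w : ℕ → Fin 2 → Sl) : Prop where
  mn_mean : ∀ k j, mn (w k j) = w k j
  repr_zero : ∀ k, v k 0 = corrector μ lam h M v k 0 + w k 0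
  repr_one : ∀ k, v k 1 = corrector μ lam h M v k 1 + (w k 1 + a • w k 0)
  heat : ∀ k j, di 0 (w k j) = source μ lam h M a χ b v k j +
    (μ - (χ * h).mean) • di 2 (di 2 (w k j))

lemma corrector_apply_zero : corrector μ lam h M v k 0 = μ⁻¹ • pr (pr (slowR μ lam h M 0 v k)) := by
  simp [corrector]

lemma corrector_apply_one : corrector μ lam h M v k 1 =
    μ⁻¹ • pr (pr (h.d • corrector μ lam h M v k 0 + slowR μ lam h M 1 v k)) := by
  simp [corrector]

lemma corrector_zero (hM : 1 ≤ M) (j : Fin 2) : corrector μ lam h M v 0 j = 0 := by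
  have h0 : corrector μ lam h M v 0 0 = 0 := by
    rw [corrector_apply_zero, slowR_zero hM, pr_zero, pr_zero, smul_zero]
  fin_cases j
  · exact h0
  · exact corrector_apply_one.trans (by
      rw [h0, slowR_zero hM, smul_zero, add_zero, pr_zero, pr_zero, smul_zero])

namespace Homogenized

lemma mn_eq (hw : Homogenized μ lam h M a χ b v w) (hc : Correctors μ h a χ b) (k : ℕ) (j : Fin 2) :
    mn (v k j) = w k j := by
  fin_cases j
  · refine (congrArg mn (hw.repr_zero k)).trans ?_
    rw [map_add, mn_corrector, hw.mn_mean, zero_add]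
    rfl
  · refine (congrArg mn (hw.repr_one k)).trans ?_
    rw [map_add, map_add, mn_corrector, hw.mn_mean, mn_smul_of_const _ (hw.mn_mean k 0), hc.mean_a,
      zero_smul, zero_add, add_zero]
    rfl

/-- The equations of order `n` are solvable. -/
def Solvable (μ lam : ℝ) (h : Cf) (M : ℕ) (a : Cf) (v : ℕ → Fin 2 → Sl) (n : ℕ) : Prop :=
  mn (slowR μ lam h M 0 v n) = 0 ∧
    mn (a • slowR μ lam h M 0 v n + slowR μ lam h M 1 v n) = 0

/-- The double primitive inverts `∂_θθ` on functions of mean zero. For the second component, `Π(h'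
q) = Π(a μ ∂_θθ q)` reduces the mean of the right-hand side to the second solvability condition, and
`a • w` accounts for `h' w` because `μ a'' = h'`. -/
lemma slowEq_of_solvable (hw : Homogenized μ lam h M a χ b v w) (hc : Correctors μ h a χ b)
    (hμ : μ ≠ 0) (hs : Solvable μ lam h M a v n) : SlowEq μ lam h M v n := by
  have d0 : di 1 (w n 0) = 0 := di_one_of_const (hw.mn_mean n 0)
  have d1 : di 1 (w n 1) = 0 := di_one_of_const (hw.mn_mean n 1)
  have q0 : μ • di 1 (di 1 (corrector μ lam h M v n 0)) = slowR μ lam h M 0 v n := by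
    rw [corrector_apply_zero, map_smul, map_smul, di_di_pr_pr hs.1, smul_smul, mul_inv_cancel₀ hμ,
      one_smul]
  have hq : mn (h.d • corrector μ lam h M v n 0 + slowR μ lam h M 1 v n) = 0 := by
    rw [map_add, hc.mn_d_h_smul, q0, ← map_add, hs.2]
  have q1 : μ • di 1 (di 1 (corrector μ lam h M v n 1)) =
      h.d • corrector μ lam h M v n 0 + slowR μ lam h M 1 v n := by
    rw [corrector_apply_one, map_smul, map_smul, di_di_pr_pr hq, smul_smul, mul_inv_cancel₀ hμ,
      one_smul]
  constructor
  · rw [hw.repr_zero, map_add, d0, add_zero, q0]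
  · have e : μ • di 1 (di 1 (a • w n 0)) = h.d • w n 0 := by
      rw [di_one_smul, d0, smul_zero, add_zero, di_one_smul, d0, smul_zero, add_zero, ← smul_assoc,
        ← Cf.d_smul, hc.d_a]
    rw [hw.repr_one, map_add, map_add, map_add, d1, zero_add, smul_add, q1, e, hw.repr_zero,
      smul_add]
    abel

lemma apply_zero_zero (hw : Homogenized μ lam h M a χ b v w) (hM : 2 ≤ M) : v 0 0 = w 0 0 := by
  rw [hw.repr_zero, corrector_zero (by omega), zero_add]

lemma apply_zero_one (hw : Homogenized μ lam h M a χ b v w) (hM : 2 ≤ M) :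
    v 0 1 = w 0 1 + a • w 0 0 := by
  rw [hw.repr_one, corrector_zero (by omega), zero_add]

/-- No heat equation is involved at order one: the conditions hold because `h` and `a h` have mean
zero and the means do not depend on `θ`. -/
lemma solvable_one (hw : Homogenized μ lam h M a χ b v w) (hc : Correctors μ h a χ b)
    (hM : 2 ≤ M) : Solvable μ lam h M a v 1 := by
  have d0 := mn_di_of_const 2 (hw.mn_mean 0 0)
  have d1 := mn_di_of_const 2 (hw.mn_mean 0 1)
  have r0 : slowR μ lam h M 0 v 1 = h • di 2 (w 0 0) := by
    rw [slowR_one hM, hw.apply_zero_zero hM, di_one_of_const (hw.mn_mean 0 0)]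
    simp
  have r1 : slowR μ lam h M 1 v 1 = h • di 2 (w 0 1) + (h * a) • di 2 (w 0 0) := by
    rw [slowR_one hM, hw.apply_zero_one hM, map_add, di_two_smul, smul_add, mul_smul]
    simp
  constructor
  · rw [r0, mn_smul_of_const _ d0, hc.mean_h, zero_smul]
  · rw [r0, r1, ← mul_smul, map_add, map_add, mn_smul_of_const _ d0, mn_smul_of_const _ d0,
      mn_smul_of_const _ d1, mul_comm h, hc.mean_a_mul_h, hc.mean_h]
    simp

lemma sourceG_eq (hw : Homogenized μ lam h M a χ b v w) (hc : Correctors μ h a χ b)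
    (hM : 2 ≤ M) (k : ℕ) (j : Fin 2) : sourceG μ lam h M a χ b j v k =
      (χ * h).mean • di 2 (di 2 (w k j)) - source μ lam h M a χ b v k j := by
  have hk : hat μ lam h M v k k = corrector μ lam h M v k := by simp [hat]
  have hlt : ∀ i < k, v i = hat μ lam h M v k i := fun i hi => by simp [hat, hi]
  have h0 : mn (hat μ lam h M v k 0 0) = hat μ lam h M v k 0 0 := by
    -- For `k = 0` the entry of order zero is the corrector itself, which vanishes; otherwise it is
    -- the mean `w 0 0`.
    rcases Nat.eq_zero_or_pos k with rfl | hpos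
    · rw [hk, corrector_zero (by omega), map_zero]
    · rw [← hlt 0 hpos, hw.apply_zero_zero hM, hw.mn_mean]
  have := hc.sourceG_eq (lam := lam) hM hlt (hw.mn_mean k 0) (hw.mn_mean k 1) (c0 := w 0 0)
    (by rw [hk]; exact hw.repr_zero k) (by rw [hk]; exact hw.repr_one k)
    (by rw [hw.apply_zero_zero hM]; exact di_one_of_const (hw.mn_mean 0 0)) (hw.mn_mean 0 0)
    (by rw [hw.apply_zero_one hM, map_add, di_one_smul, di_one_of_const (hw.mn_mean 0 0),
          di_one_of_const (hw.mn_mean 0 1)]; simp) h0 j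
  rw [this, source]
  have e : (if j = 0 then w k 0 else w k 1) = w k j := by
    fin_cases j <;> rfl
  rw [e]
  abel

/-- The heat equations for the means of order `k` are precisely these conditions once the equations
of order `k + 1` hold. -/
lemma solvable_add_two (hw : Homogenized μ lam h M a χ b v w) (hc : Correctors μ h a χ b)
    (hμ : μ ≠ 0) (hM : 2 ≤ M) (he : SlowEq μ lam h M v (k + 1)) :
    Solvable μ lam h M a v (k + 2) := by
  constructor
  · rw [hc.mn_slowR_zero he, hw.mn_eq hc, hw.sourceG_eq hc hM, hw.heat]
    module
  · rw [hc.mn_slowR_one hμ he, hw.mn_eq hc, hw.sourceG_eq hc hM, hw.heat]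
    module

lemma slowEq (hw : Homogenized μ lam h M a χ b v w) (hc : Correctors μ h a χ b)
    (hμ : μ ≠ 0) (hM : 2 ≤ M) : ∀ n, SlowEq μ lam h M v n
  | 0 => hw.slowEq_of_solvable hc hμ (by
      constructor <;> simp [slowR_zero (show 1 ≤ M by omega)])
  | 1 => hw.slowEq_of_solvable hc hμ (hw.solvable_one hc hM)
  | k + 2 => hw.slowEq_of_solvable hc hμ (hw.solvable_add_two hc hμ hM (hw.slowEq hc hμ hM (k + 1)))

end Homogenized

end SlowSolution

end

end OscFlow

namespace OscFlow

noncomputable section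

/-! ### Integration in time. -/

section TimeIntegral

variable {f : ℝ≥0 → Cyl}

/-- `∫_0^t f(r) dr`. -/
def integ (f : ℝ≥0 → Cyl) : ℝ≥0 → Cyl := fun t θ y => ∫ r in (0 : ℝ)..t, f r.toNNReal θ y

lemma heatAvg_zero_left (d : Fin 3) (r : ℝ) (u : Cyl) : heatAvg 0 d r u = u := by
  funext θ y
  simp [heatAvg]

/-- At diffusivity zero the semigroup is the identity, so the rules for `∂_θ` and `∂_y` of Duhamel's
integral apply to the time integral. -/
lemma integ_eq_duhamel (f : ℝ≥0 → Cyl) : integ f = duhamel 0 1 f := by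
  funext t θ y
  rw [duhamel_eq]
  simp only [heatAvg_zero_left, integ]

lemma integ_zero : integ (fun _ _ _ => 0) = fun _ _ _ => 0 := by
  funext t θ y
  simp [integ]

lemma Slow.hasDeriv_integ_x (h : Slow f) (t : ℝ≥0) (θ y : ℝ) :
    HasDerivAt (fun s => integ f t s y) (integ (OscFlow.D 1 f) t θ y) θ := by
  rw [integ_eq_duhamel, integ_eq_duhamel]
  exact h.hasDeriv_duhamel_x 0 1 t θ y

lemma Slow.hasDeriv_integ_y (h : Slow f) (t : ℝ≥0) (θ y : ℝ) :
    HasDerivAt (fun s => integ f t θ s) (integ (OscFlow.D 2 f) t θ y) y := by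
  rw [integ_eq_duhamel, integ_eq_duhamel]
  exact h.hasDeriv_duhamel_y 0 1 t θ y

lemma Slow.continuous_t (h : Slow f) (θ y : ℝ) : Continuous fun r : ℝ => f r.toNNReal θ y :=
  h.continuous_comp continuous_real_toNNReal continuous_const continuous_const

lemma Slow.hasDeriv_integ_t (h : Slow f) (t : ℝ≥0) (θ y : ℝ) :
    HasDerivWithinAt (fun s : ℝ => integ f s.toNNReal θ y) (f t θ y) (Ici 0) t := by
  have hc := h.continuous_t θ y
  have h1 := (intervalIntegral.integral_hasDerivAt_right (hc.intervalIntegrable 0 (t : ℝ))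
    (hc.stronglyMeasurableAtFilter _ _) hc.continuousAt).hasDerivWithinAt (s := Ici 0)
  rw [Real.toNNReal_coe] at h1
  refine h1.congr (fun s hs => ?_) ?_
  · simp only [integ, Real.coe_toNNReal _ (mem_Ici.1 hs)]
  · simp only [integ, Real.toNNReal_coe]

/-- Time integration of families. -/
def Integ {E : Type*} (F : E → ℝ≥0 → Cyl) : E → ℝ≥0 → Cyl := fun e => integ (F e)

/-- Integration costs a factor `t`. Starting from half of the permitted growth rate absorbs it, so
growth slower than every exponential is preserved. The sets must be closed under going back in time
because the integral sees all earlier times. -/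
lemma Reg.integ {E : Type*} {ℐ : Set (Set (E × ℝ≥0))} {F : E → ℝ≥0 → Cyl}
    (hI : ∀ I ∈ ℐ, ∀ e t s, s ≤ t → (e, t) ∈ I → (e, s) ∈ I)
    (hs : ∀ F : E → ℝ≥0 → Cyl, Reg ℐ (Iio 0) F → ∀ e, Slow (F e)) (h : Reg ℐ (Iio 0) F) :
    Reg ℐ (Iio 0) (Integ F) := by
  refine Reg.of_closed (fun F => ∃ F', Reg ℐ (Iio 0) F' ∧ F = Integ F') ?_ ?_ ?_ _ ⟨F, h, rfl⟩
  · rintro _ ⟨F, hF, rfl⟩ I hII δ (hδ : δ < 0)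
    obtain ⟨g, hg, hb⟩ := Reg.ub hF I hII (δ / 2) (by simp only [mem_Iio]; linarith)
    refine ⟨_, hg.const_mul (c := (-(δ / 2))⁻¹) (inv_nonneg.2 (by linarith)), fun e t he θ y => ?_⟩
    have hg0 := hg.nonneg y
    have h1 : ∀ r ∈ uIoc (0 : ℝ) t, ‖F e r.toNNReal θ y‖ ≤ Real.exp (-(δ / 2 * t)) * g y := by
      intro r hr
      rw [uIoc_of_le t.coe_nonneg] at hr
      refine (hb e r.toNNReal (hI I hII e t _ (Real.toNNReal_le_iff_le_coe.2 hr.2) he) θ y).trans ?_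
      rw [Real.coe_toNNReal _ hr.1.le]
      refine mul_le_mul_of_nonneg_right (Real.exp_le_exp.2 ?_) hg0
      nlinarith [hr.2]
    have h2 := intervalIntegral.norm_integral_le_of_norm_le_const h1
    rw [sub_zero, abs_of_nonneg t.coe_nonneg] at h2
    refine h2.trans ?_
    have hlt : 0 < -(δ / 2) := by linarith
    have h3 : (t : ℝ) ≤ (-(δ / 2))⁻¹ * Real.exp (-(δ / 2) * t) := by
      rw [inv_mul_eq_div, le_div_iff₀ hlt]
      linarith [Real.add_one_le_exp (-(δ / 2) * t)]
    calc Real.exp (-(δ / 2 * t)) * g y * t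
        ≤ Real.exp (-(δ / 2 * t)) * g y * ((-(δ / 2))⁻¹ * Real.exp (-(δ / 2) * t)) := by gcongr
      _ = (Real.exp (-(δ / 2 * t)) * Real.exp (-(δ / 2) * t)) * ((-(δ / 2))⁻¹ * g y) := by ring
      _ = _ := by rw [← Real.exp_add]; ring_nf
  · rintro _ ⟨F, hF, rfl⟩ e t θ y
    simp only [Integ, OscFlow.integ, hF.per]
  · rintro _ ⟨F, hF, rfl⟩ d
    match d with
    | 0 =>
      refine ⟨F, _, fun e t θ y => ?_, hF, ⟨_, Reg.zero, rfl⟩⟩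
      refine ((hs F hF e).hasDeriv_integ_t t θ y).congr_deriv ?_
      simp [Integ, integ_zero]
    | 1 =>
      refine ⟨_, _, fun e t θ y => ?_, Reg.zero, ⟨_, hF.der 1, rfl⟩⟩
      refine ((hs F hF e).hasDeriv_integ_x t θ y).congr_deriv ?_
      simp only [zero_add]; rfl
    | 2 =>
      refine ⟨_, _, fun e t θ y => ?_, Reg.zero, ⟨_, hF.der 2, rfl⟩⟩
      refine ((hs F hF e).hasDeriv_integ_y t θ y).congr_deriv ?_
      simp only [zero_add]; rfl

end TimeIntegral

/-! ### Finite expansions in powers of `ε`. -/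

section Expansion

/-- The parameters `ε ∈ ]0,1]`. -/
abbrev Eps : Type := Ioc (0 : ℝ) 1

/-- Functions of `(ε, t, θ, y)`. -/
abbrev Fam : Type := Eps → ℝ≥0 → Cyl

/-- The parameter `ε` as a function. -/
def epsF : Fam := fun e _ _ _ => e

/-- A function of `θ` as a function of all variables. -/
def thF {E : Type*} (c : Cf) : E → ℝ≥0 → Cyl := fun _ _ θ _ => (c : ℝ → ℝ) θ

variable {ℐ : Set (Set (Eps × ℝ≥0))} {Δ Δ₁ Δ₂ : Set ℝ} {F G X Y : Fam} {A B : ℕ → Fam} {K : ℕ}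

lemma Reg.epsF_mul (h : Reg ℐ Δ F) : Reg ℐ Δ (epsF * F) :=
  h.const_mul_of_bdd (c := fun e : Eps => (e : ℝ)) (K := 1) fun e => by
    rw [abs_of_pos e.2.1]; exact e.2.2

lemma Reg.thF_mul {E : Type*} {ℐ : Set (Set (E × ℝ≥0))} {F : E → ℝ≥0 → Cyl} (h : Reg ℐ Δ F)
    (c : Cf) : Reg ℐ Δ (thF c * F) := h.theta_mul c.smoothPer

/-- `X = A 0 + ε A 1 + … + ε^(K-1) A (K-1) + ε^K R`, where the coefficients and the remainder are
regular. -/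
def Expands (ℐ : Set (Set (Eps × ℝ≥0))) (Δ : Set ℝ) : ℕ → Fam → (ℕ → Fam) → Prop
  | 0, X, _ => Reg ℐ Δ X
  | K + 1, X, A => Reg ℐ Δ (A 0) ∧ ∃ X', Expands ℐ Δ K X' (fun n => A (n + 1)) ∧
      X = A 0 + epsF * X'

namespace Expands

lemma reg (h : Expands ℐ Δ K X A) : Reg ℐ Δ X := by
  induction K generalizing X A with
  | zero => exact h
  | succ K ih =>
    obtain ⟨h0, X', hX', rfl⟩ := h
    exact h0.add (ih hX').epsF_mul

lemma of_succ (h : Expands ℐ Δ (K + 1) X A) : Expands ℐ Δ K X A := by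
  induction K generalizing X A with
  | zero => exact h.reg
  | succ K ih =>
    obtain ⟨h0, X', hX', rfl⟩ := h
    exact ⟨h0, X', ih hX', rfl⟩

lemma congr (h : Expands ℐ Δ K X A) (hA : ∀ n < K, A n = B n) : Expands ℐ Δ K X B := by
  induction K generalizing X A B with
  | zero => exact h
  | succ K ih =>
    obtain ⟨h0, X', hX', rfl⟩ := h
    rw [hA 0 (by omega)] at h0 ⊢
    exact ⟨h0, X', ih hX' fun n hn => hA _ (by omega), rfl⟩

/-- Linear operations on families act on expansions coefficientwise. -/
lemma map {ℐ' : Set (Set (Eps × ℝ≥0))} {Δ' : Set ℝ} (L : Fam → Fam)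
    (hL : ∀ F, Reg ℐ Δ F → Reg ℐ' Δ' (L F))
    (hadd : ∀ F G, Reg ℐ Δ F → Reg ℐ Δ G → L (F + epsF * G) = L F + epsF * L G)
    (h : Expands ℐ Δ K X A) : Expands ℐ' Δ' K (L X) (fun n => L (A n)) := by
  induction K generalizing X A with
  | zero => exact hL _ h
  | succ K ih =>
    obtain ⟨h0, X', hX', rfl⟩ := h
    exact ⟨hL _ h0, L X', ih hX', hadd _ _ h0 hX'.reg⟩

lemma add (h : Expands ℐ Δ K X A) (h' : Expands ℐ Δ K Y B) :
    Expands ℐ Δ K (X + Y) (fun n => A n + B n) := by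
  induction K generalizing X Y A B with
  | zero => exact Reg.add h h'
  | succ K ih =>
    obtain ⟨h0, X', hX', rfl⟩ := h
    obtain ⟨h0', Y', hY', rfl⟩ := h'
    exact ⟨h0.add h0', X' + Y', ih hX' hY', by ring⟩

lemma zero : Expands ℐ Δ K 0 (fun _ => 0) := by
  induction K with
  | zero => exact Reg.zero
  | succ K ih => exact ⟨Reg.zero, 0, ih, by ring⟩

lemma const_mul (r : ℝ) (h : Expands ℐ Δ K X A) : Expands ℐ Δ K (r • X) (fun n => r • A n) :=
  h.map (fun F => r • F) (fun _ hF => hF.const_mul r) fun F G _ _ => by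
    rw [smul_add, mul_smul_comm]

lemma sub (h : Expands ℐ Δ K X A) (h' : Expands ℐ Δ K Y B) :
    Expands ℐ Δ K (X - Y) (fun n => A n - B n) := by
  have := h.add (h'.const_mul (-1))
  simpa only [neg_smul, one_smul, ← sub_eq_add_neg] using this

lemma thF_mul (c : Cf) (h : Expands ℐ Δ K X A) : Expands ℐ Δ K (thF c * X) (fun n => thF c * A n) :=
  h.map (fun F => thF c * F) (fun _ hF => hF.thF_mul c) fun F G _ _ => by ring

lemma der_add_eps_mul (d : Fin 3) (hF : Reg ℐ Δ F) (hG : Reg ℐ Δ G) :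
    OscFlow.der d (F + epsF * G) = OscFlow.der d F + epsF * OscFlow.der d G :=
  ((hF.hasDer d).add ((hG.hasDer d).const_mul fun e : Eps => (e : ℝ))).eq

lemma der (d : Fin 3) (h : Expands ℐ Δ K X A) :
    Expands ℐ Δ K (OscFlow.der d X) (fun n => OscFlow.der d (A n)) :=
  h.map _ (fun _ hF => hF.der d) fun _ _ hF hG => der_add_eps_mul d hF hG

lemma epsF_mul (h : Expands ℐ Δ K X A) : Expands ℐ Δ (K + 1) (epsF * X) (sh 1 A) := by
  refine ⟨Reg.zero, X, h.congr fun n _ => ?_, ?_⟩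
  · rw [sh_add_right]
  · rw [sh_zero_lt one_pos, zero_add]

lemma sh_sh {A' : Type*} [NonUnitalNonAssocSemiring A'] (m : ℕ) (a : ℕ → A') (n : ℕ) :
    sh 1 (sh m a) n = sh (m + 1) a n := by
  rcases n with _ | n
  · rw [sh_zero_lt one_pos, sh_zero_lt (by omega)]
  · rw [sh_add_right 1 n, sh_succ_succ]

lemma pow_mul (m : ℕ) (h : Expands ℐ Δ K X A) : Expands ℐ Δ K (epsF ^ m * X) (sh m A) := by
  induction m with
  | zero => simpa [sh] using h.congr (B := sh 0 A) fun n _ => by simp [sh]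
  | succ m ih =>
    have := ih.epsF_mul.of_succ.congr fun n _ => sh_sh m A n
    rwa [← mul_assoc, ← pow_succ'] at this

lemma mul_left (hΔ : RateMul Δ₁ Δ₂ Δ) (hF : Reg ℐ Δ₁ F) (h : Expands ℐ Δ₂ K X A) :
    Expands ℐ Δ K (F * X) (fun n => F * A n) :=
  h.map (fun G => F * G) (fun _ hG => hF.mul hΔ hG) fun G G' _ _ => by ring

lemma conv_succ {A' : Type*} [NonUnitalNonAssocSemiring A'] (a b : ℕ → A') (n : ℕ) :
    conv a b (n + 1) = a 0 * b (n + 1) + conv (fun i => a (i + 1)) b n := by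
  unfold conv
  rw [Finset.Nat.antidiagonal_succ, Finset.sum_cons, Finset.sum_map]
  rfl

/-- `X Y = A₀ B₀ + ε (A₀ Y' + X' Y)`, where `Y` is kept whole and used at one order less. -/
lemma mul (hΔ : RateMul Δ₁ Δ₂ Δ) (h : Expands ℐ Δ₁ K X A) (h' : Expands ℐ Δ₂ K Y B) :
    Expands ℐ Δ K (X * Y) (conv A B) := by
  induction K generalizing X Y A B with
  | zero => exact Reg.mul hΔ h h'
  | succ K ih =>
    have hY := h'.of_succ
    obtain ⟨h0, X', hX', rfl⟩ := h
    obtain ⟨h0', Y', hY', rfl⟩ := h'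
    have e0 : conv A B 0 = A 0 * B 0 := by simp [conv]
    refine ⟨?_, A 0 * Y' + X' * (B 0 + epsF * Y'),
      ((hY'.mul_left hΔ h0).add (ih hX' hY)).congr fun n _ => (conv_succ A B n).symm, ?_⟩
    · rw [e0]
      exact h0.mul hΔ h0'
    · rw [e0]
      ring

lemma sum_range (hA : ∀ n < K, Reg ℐ Δ (A n)) :
    Expands ℐ Δ K (∑ n ∈ Finset.range K, epsF ^ n * A n) A := by
  induction K generalizing A with
  | zero => exact Reg.zero
  | succ K ih =>
    refine ⟨hA 0 (by omega), _, ih (A := fun n => A (n + 1)) fun n hn => hA _ (by omega), ?_⟩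
    rw [Finset.sum_range_succ', Finset.mul_sum, pow_zero, one_mul, add_comm]
    congr 1
    exact Finset.sum_congr rfl fun n _ => by ring

lemma eq_pow_mul (h : Expands ℐ Δ K X A) (hA : ∀ n < K, A n = 0) :
    ∃ R, Reg ℐ Δ R ∧ X = epsF ^ K * R := by
  induction K generalizing X A with
  | zero => exact ⟨X, h, by simp⟩
  | succ K ih =>
    obtain ⟨-, X', hX', rfl⟩ := h
    obtain ⟨R, hR, rfl⟩ := ih hX' fun n hn => hA _ (by omega)
    exact ⟨R, hR, by rw [hA 0 (by omega)]; ring⟩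

end Expands

end Expansion

end

end OscFlow

namespace OscFlow

noncomputable section

/-! ### Taylor expansion of slow profiles in the fast time. -/

section Classes

/-- `ε²`. -/
def sq (e : Eps) : ℝ≥0 := ⟨(e : ℝ) ^ 2, sq_nonneg _⟩

lemma sq_le_one (e : Eps) : sq e ≤ 1 := by
  rw [← NNReal.coe_le_coe]
  exact pow_le_one₀ e.2.1.le e.2.2

/-- The sets `{(ε, τ) | ε² τ ≤ T}`. -/
def slowI : Set (Set (Eps × ℝ≥0)) := range fun T : ℝ≥0 => {p | sq p.1 * p.2 ≤ T}

lemma slowI_down : ∀ I ∈ slowI, ∀ (e : Eps) (t s : ℝ≥0), s ≤ t → (e, t) ∈ I → (e, s) ∈ I := by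
  rintro _ ⟨T, rfl⟩ e t s hst h
  exact (mul_le_mul_right hst (sq e)).trans h

variable {Δ : Set ℝ} {F : Fam} {f s : ℝ≥0 → Cyl} {μ : ℝ}

lemma Reg.slow_slice (h : Reg slowI Δ F) (hΔ : Δ.Nonempty) (e : Eps) : Slow (F e) :=
  Reg.slow h e (fun T => ⟨_, ⟨T, rfl⟩, fun _ ht =>
    (mul_le_of_le_one_left (zero_le) (sq_le_one e)).trans ht⟩) hΔ

/-- `f(ε² t)`. -/
def scal (f : ℝ≥0 → Cyl) : Fam := fun e t => f (sq e * t)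

lemma Slow.scal (h : Slow f) : Reg slowI {0} (scal f) := by
  have h1 : Reg (range fun T : ℝ≥0 => {p : Eps × ℝ≥0 | p.2 ≤ T}) {0} (fun _ : Eps => f) :=
    Reg.mono h (fun _ => ()) (by
      rintro _ ⟨T, rfl⟩ _ rfl
      exact ⟨_, ⟨T, rfl⟩, 0, rfl, 1, zero_le_one, fun e t ht => ⟨ht, by simp⟩⟩)
  refine h1.rescale sq (C := 1) (fun e => sq_le_one e) ?_
  rintro _ ⟨T, rfl⟩ _ rfl
  exact ⟨_, ⟨T, rfl⟩, 0, rfl, 1, zero_le_one, fun e t ht => ⟨ht, by simp⟩⟩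

lemma Reg.grow_of_slow {E : Type*} {ℐ : Set (Set (E × ℝ≥0))} {F : E → ℝ≥0 → Cyl}
    (h : Reg ℐ {0} F) : Reg ℐ (Iio 0) F := by
  refine Reg.mono h id fun I hI δ (hδ : δ < 0) => ⟨I, hI, 0, rfl, 1, zero_le_one, fun e t ht => ⟨ht, ?_⟩⟩
  rw [one_mul]
  exact Real.exp_le_exp.2 (by nlinarith [t.coe_nonneg])

lemma Reg.slow_of_fast {E : Type*} {ℐ : Set (Set (E × ℝ≥0))} {F : E → ℝ≥0 → Cyl} (hμ : 0 < μ)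
    (h : Reg ℐ (Iio μ) F) : Reg ℐ {0} F := by
  refine Reg.mono h id fun I hI δ hδ => ⟨I, hI, 0, hμ, 1, zero_le_one, fun e t ht => ⟨ht, ?_⟩⟩
  rw [mem_singleton_iff.1 hδ, one_mul]

/-- A function that does not depend on `ε`. -/
def cst {E : Type*} (f : ℝ≥0 → Cyl) : E → ℝ≥0 → Cyl := fun _ => f

lemma Reg.cst (h : Reg {univ} Δ (fun _ : Unit => f)) : Reg slowI Δ (cst f) :=
  Reg.mono h (fun _ => ()) fun _ _ δ hδ =>
    ⟨univ, rfl, δ, hδ, 1, zero_le_one, fun _ _ _ => ⟨mem_univ _, by simp⟩⟩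

/-- Slowly growing profiles. -/
def Grow (f : ℝ≥0 → Cyl) : Prop := Reg {univ} (Iio 0) (fun _ : Unit => f)

lemma Slow.grow_frozen (h : Slow f) : Grow (fun _ => f 0) :=
  Reg.mono (h.frozen 0 (ℐ := {univ}) le_rfl) id fun I hI δ (hδ : δ < 0) =>
    ⟨I, hI, δ, hδ.le, 1, zero_le_one, fun _ _ h => ⟨h, by simp⟩⟩

lemma Grow.integ (h : Grow f) : Grow (integ f) :=
  Reg.integ (E := Unit) (F := fun _ => f) (by rintro _ rfl; simp)
    (fun F hF e => Reg.slow hF e (fun _ => ⟨univ, rfl, fun _ _ => mem_univ _⟩) nonempty_Iio) h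

/-- The coefficients of the expansion of `f(ε² t)` in powers of `ε`. -/
def tay (f : ℝ≥0 → Cyl) : ℕ → ℝ≥0 → Cyl
  | 0 => fun _ => f 0
  | 1 => 0
  | n + 2 => integ (tay (D 0 f) n)

lemma Slow.grow_tay : ∀ (n : ℕ) {f : ℝ≥0 → Cyl}, Slow f → Grow (tay f n)
  | 0, _, h => h.grow_frozen
  | 1, _, _ => Reg.zero
  | n + 2, _, h => (Slow.grow_tay n (h.D 0)).integ

lemma Slow.integ_D_t (h : Slow f) (t : ℝ≥0) (θ y : ℝ) :
    OscFlow.integ (OscFlow.D 0 f) t θ y = f t θ y - f 0 θ y := by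
  have := intervalIntegral.integral_eq_sub_of_hasDerivAt_of_le (a := 0) (b := (t : ℝ))
    (f := fun r : ℝ => f r.toNNReal θ y) (f' := fun r : ℝ => OscFlow.D 0 f r.toNNReal θ y)
    t.coe_nonneg (h.continuous_t θ y).continuousOn (fun x hx => by
      have h1 := h.hasDeriv_t x.toNNReal θ y
      rw [Real.coe_toNNReal _ hx.1.le] at h1
      exact h1.hasDerivAt (Ici_mem_nhds hx.1))
    (((h.D 0).continuous_t θ y).intervalIntegrable _ _)
  rw [Real.toNNReal_coe, Real.toNNReal_zero] at this
  exact this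

lemma Slow.der_scal (h : Slow f) : der 0 (OscFlow.scal f) = epsF ^ 2 * OscFlow.scal (OscFlow.D 0 f) := by
  refine Der.eq (G := epsF ^ 2 * OscFlow.scal (OscFlow.D 0 f)) fun e t θ y => ?_
  have h1 := h.hasDeriv_t (sq e * t) θ y
  have h2 : HasDerivWithinAt (fun s : ℝ => (sq e : ℝ) * s) (sq e) (Ici 0) t := by
    simpa using (hasDerivWithinAt_id (t : ℝ) (Ici 0)).const_mul (sq e : ℝ)
  have h3 := HasDerivWithinAt.scomp (t : ℝ) (t' := Ici 0) (by simpa using h1) h2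
    (fun s hs => mul_nonneg (sq e).coe_nonneg hs)
  refine h3.congr (fun s hs => ?_) ?_ <;>
    simp [Function.comp, OscFlow.scal, Real.toNNReal_mul (NNReal.coe_nonneg (sq e))]

/-- Taylor's formula `f(ε² τ) = f(0) + ε² ∫_0^τ (∂_t f)(ε² r) dr`. Iterated, it yields the
coefficients `tay`, in which only even powers of `ε` occur; the remainder grows more slowly than any
exponential, uniformly on `ε² τ ≤ T`. -/
lemma Slow.scal_eq (h : Slow f) : OscFlow.scal f =
    cst (fun _ => f 0) + epsF * (epsF * Integ (OscFlow.scal (OscFlow.D 0 f))) := by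
  funext e t θ y
  have h1 := (h.scal.slow_slice (singleton_nonempty 0) e).integ_D_t t θ y
  have h2 : OscFlow.D 0 (OscFlow.scal f e) =
      fun t θ y => (e : ℝ) ^ 2 * OscFlow.scal (OscFlow.D 0 f) e t θ y :=
    congrFun h.der_scal e
  rw [h2] at h1
  have h3 : OscFlow.integ (fun t θ y => (e : ℝ) ^ 2 * OscFlow.scal (OscFlow.D 0 f) e t θ y) t θ y =
      (e : ℝ) ^ 2 * OscFlow.integ (OscFlow.scal (OscFlow.D 0 f) e) t θ y :=
    intervalIntegral.integral_const_mul _ _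
  have h4 : OscFlow.scal f e 0 θ y = f 0 θ y := by simp [OscFlow.scal]
  rw [h3, h4] at h1
  show OscFlow.scal f e t θ y = f 0 θ y + (e : ℝ) * ((e : ℝ) *
    OscFlow.integ (OscFlow.scal (OscFlow.D 0 f) e) t θ y)
  linarith

lemma Reg.integ_add_eps_mul {F G : Fam} (hF : Reg slowI (Iio 0) F) (hG : Reg slowI (Iio 0) G) :
    Integ (F + epsF * G) = Integ F + epsF * Integ G := by
  funext e t θ y
  have h1 := (hF.slow_slice nonempty_Iio e).continuous_t θ y
  have h2 := (hG.slow_slice nonempty_Iio e).continuous_t θ y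
  show ∫ r in (0 : ℝ)..t, (F e r.toNNReal θ y + (e : ℝ) * G e r.toNNReal θ y) =
    (∫ r in (0 : ℝ)..t, F e r.toNNReal θ y) + (e : ℝ) * ∫ r in (0 : ℝ)..t, G e r.toNNReal θ y
  rw [intervalIntegral.integral_add (h1.intervalIntegrable _ _)
    ((h2.intervalIntegrable _ _).const_mul _), intervalIntegral.integral_const_mul]

lemma Reg.integ_slowI {F : Fam} (h : Reg slowI (Iio 0) F) : Reg slowI (Iio 0) (Integ F) :=
  Reg.integ slowI_down (fun _ hF e => hF.slow_slice nonempty_Iio e) h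

lemma Slow.expands_scal : ∀ (K : ℕ) {f : ℝ≥0 → Cyl}, Slow f →
    Expands slowI (Iio 0) K (OscFlow.scal f) (fun n => cst (tay f n))
  | 0, _, h => h.scal.grow_of_slow
  | 1, _, h => ⟨h.grow_frozen.cst, _, (h.D 0).scal.grow_of_slow.integ_slowI.epsF_mul, h.scal_eq⟩
  | K + 2, _, h => ⟨h.grow_frozen.cst, _, ⟨Reg.zero, _,
      (Slow.expands_scal K (h.D 0)).map Integ (fun _ hF => hF.integ_slowI)
        (fun _ _ hF hG => hF.integ_add_eps_mul hG), (zero_add _).symm⟩, h.scal_eq⟩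

/-- The coefficients of the expansion of `∑ ε^k v_k(ε² t)` in powers of `ε`. -/
def sig : ℕ → (ℕ → ℝ≥0 → Cyl) → ℝ≥0 → Cyl
  | 0, v => tay (v 0) 0
  | n + 1, v => tay (v 0) (n + 1) + sig n (fun i => v (i + 1))

lemma grow_sig : ∀ (n : ℕ) {v : ℕ → ℝ≥0 → Cyl}, (∀ i, Slow (v i)) → Grow (sig n v)
  | 0, _, h => (h 0).grow_tay 0
  | n + 1, _, h => Reg.add ((h 0).grow_tay (n + 1)) (grow_sig n fun i => h (i + 1))

lemma sig_congr : ∀ (n : ℕ) {v v' : ℕ → ℝ≥0 → Cyl}, (∀ i ≤ n, v i = v' i) → sig n v = sig n v'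
  | 0, _, _, h => by rw [sig, sig, h 0 le_rfl]
  | n + 1, _, _, h => by
    rw [sig, sig, h 0 (by omega), sig_congr n fun i hi => h (i + 1) (by omega)]

lemma expands_sum_scal : ∀ (K : ℕ) {v : ℕ → ℝ≥0 → Cyl}, (∀ i, Slow (v i)) →
    Expands slowI (Iio 0) K (∑ n ∈ Finset.range K, epsF ^ n * scal (v n)) (fun n => cst (sig n v))
  | 0, _, _ => Reg.zero
  | K + 1, v, h => by
    have h1 := (h 0).expands_scal (K + 1)
    have h2 := (expands_sum_scal K fun i => h (i + 1)).epsF_mul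
    have h3 := (h1.add h2).congr (B := fun n => cst (sig n v)) fun n _ => by
      rcases n with _ | n
      · rw [sh_zero_lt one_pos, add_zero]; rfl
      · rw [sh_add_right]; rfl
    convert h3 using 1
    rw [Finset.sum_range_succ', Finset.mul_sum, pow_zero, one_mul, add_comm]
    congr 1
    exact Finset.sum_congr rfl fun n _ => by ring

end Classes

/-! ### The rescaled operators act on expansions. -/

section Operators

variable {E : Type*}

/-- The linear terms of order `n` with lower order profiles, apart from time derivatives. -/
def linC (μ lam : ℝ) (h : Cf) (j : Fin 2) (A : ℕ → Fin 2 → E → ℝ≥0 → Cyl) (n : ℕ) :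
    E → ℝ≥0 → Cyl :=
  thF h * sh 1 (fun i => der 2 (A i j)) n -
    sh 2 (fun i => μ • der 2 (der 2 (A i j)) + lam • der 1 (der 2 (A i (1 - j)))) n -
    lam • (if j = 0 then sh 1 (fun i => der 1 (der 1 (A i 0))) n else
      sh 3 (fun i => der 2 (der 2 (A i 1))) n)

/-- The bilinear terms of order `n`. -/
def nlC (M : ℕ) (j : Fin 2) (A B : ℕ → Fin 2 → E → ℝ≥0 → Cyl) (n : ℕ) : E → ℝ≥0 → Cyl :=
  sh M (conv (fun i => A i 0) (fun i => der 1 (B i j))) n +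
    sh (M + 1) (conv (fun i => A i 1) (fun i => der 2 (B i j))) n

/-- The linear operator whose coefficients are `linC`. -/
def linOp (μ lam : ℝ) (h : Cf) (j : Fin 2) (U : Fin 2 → Fam) : Fam :=
  thF h * (epsF ^ 1 * der 2 (U j)) -
    epsF ^ 2 * (μ • der 2 (der 2 (U j)) + lam • der 1 (der 2 (U (1 - j)))) -
    lam • (if j = 0 then epsF ^ 1 * der 1 (der 1 (U 0)) else epsF ^ 3 * der 2 (der 2 (U 1)))

/-- The bilinear operator whose coefficients are `nlC`. -/
def nlOp (M : ℕ) (j : Fin 2) (U V : Fin 2 → Fam) : Fam :=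
  epsF ^ M * (U 0 * der 1 (V j)) + epsF ^ (M + 1) * (U 1 * der 2 (V j))

variable {ℐ : Set (Set (Eps × ℝ≥0))} {Δ Δ₁ Δ₂ : Set ℝ} {U V : Fin 2 → Fam}
  {A B : ℕ → Fin 2 → Fam} {K M : ℕ} {μ lam : ℝ} {h : Cf}

lemma Expands.linOp (hU : ∀ j, Expands ℐ Δ K (U j) (fun n => A n j)) (j : Fin 2) :
    Expands ℐ Δ K (linOp μ lam h j U) (linC μ lam h j A) := by
  refine (((((hU j).der 2).pow_mul 1).thF_mul h).sub
    ((((((hU j).der 2).der 2).const_mul μ).add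
      ((((hU (1 - j)).der 2).der 1).const_mul lam)).pow_mul 2)).sub (Expands.const_mul lam ?_)
  split_ifs
  · exact (((hU 0).der 1).der 1).pow_mul 1
  · exact (((hU 1).der 2).der 2).pow_mul 3

lemma Expands.nlOp (hΔ : RateMul Δ₁ Δ₂ Δ) (hU : ∀ j, Expands ℐ Δ₁ K (U j) (fun n => A n j))
    (hV : ∀ j, Expands ℐ Δ₂ K (V j) (fun n => B n j)) (j : Fin 2) :
    Expands ℐ Δ K (nlOp M j U V) (nlC M j A B) :=
  (((hU 0).mul hΔ ((hV j).der 1)).pow_mul M).add (((hU 1).mul hΔ ((hV j).der 2)).pow_mul (M + 1))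

end Operators

end

end OscFlow

namespace OscFlow

noncomputable section

open Sl

/-! ### Sources of the fast equations. -/

section FastSources

variable {E : Type*} {μ lam : ℝ} {h : Cf} {M n : ℕ} {j : Fin 2} {A A' B B' : ℕ → Fin 2 → E → ℝ≥0 → Cyl}

lemma linC_congr (hA : ∀ i < n, A i = A' i) : linC μ lam h j A n = linC μ lam h j A' n := by
  unfold linC
  rw [sh_congr (m := 1) (a := fun i => der 2 (A i j)) (b := fun i => der 2 (A' i j)) fun i hi => by rw [hA i (by omega)],
    sh_congr (m := 2) (b := fun i => μ • der 2 (der 2 (A' i j)) +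
      lam • der 1 (der 2 (A' i (1 - j)))) fun i hi => by rw [hA i (by omega)],
    sh_congr (m := 1) (a := fun i => der 1 (der 1 (A i 0))) (b := fun i => der 1 (der 1 (A' i 0))) fun i hi => by rw [hA i (by omega)],
    sh_congr (m := 3) (b := fun i => der 2 (der 2 (A' i 1))) fun i hi => by rw [hA i (by omega)]]

lemma nlC_congr (hM : 1 ≤ M) (hA : ∀ i < n, A i = A' i) (hB : ∀ i < n, B i = B' i) :
    nlC M j A B n = nlC M j A' B' n := by
  unfold nlC
  congr 1
  · exact sh_congr fun i hi => conv_congr (fun l hl => by rw [hA l (by omega)])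
      fun l hl => by rw [hB l (by omega)]
  · exact sh_congr fun i hi => conv_congr (fun l hl => by rw [hA l (by omega)])
      fun l hl => by rw [hB l (by omega)]

/-- The terms of order `n` in the equations for the fast profiles `A` that are determined by the
profiles of order `< n`, where `B` are the coefficients of the slow part. -/
def fastC (μ lam : ℝ) (h : Cf) (M : ℕ) (j : Fin 2) (A B : ℕ → Fin 2 → E → ℝ≥0 → Cyl) (n : ℕ) :
    E → ℝ≥0 → Cyl :=
  linC μ lam h j A n + nlC M j B A n + nlC M j A B n + nlC M j A A n

/-- `fastC` for single profiles. -/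
@[irreducible] def fastP (μ lam : ℝ) (h : Cf) (M : ℕ) (j : Fin 2) (f σ : ℕ → Fin 2 → ℝ≥0 → Cyl)
    (n : ℕ) : ℝ≥0 → Cyl :=
  fastC (E := Unit) μ lam h M j (fun i l => cst (f i l)) (fun i l => cst (σ i l)) n ()

variable {f f' σ σ' : ℕ → Fin 2 → ℝ≥0 → Cyl}

lemma sh_apply (m n : ℕ) (a : ℕ → E → ℝ≥0 → Cyl) (e : E) : sh m a n e = sh m (fun i => a i e) n := by
  unfold sh
  split_ifs <;> rfl

lemma conv_apply (a b : ℕ → E → ℝ≥0 → Cyl) (n : ℕ) (e : E) :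
    conv a b n e = conv (fun i => a i e) (fun i => b i e) n :=
  Finset.sum_apply _ _ _

lemma der_apply (d : Fin 3) (F : E → ℝ≥0 → Cyl) (e : E) : der d F e = D d (F e) := by
  fin_cases d <;> rfl

lemma linC_apply (e : E) : linC μ lam h j A n e =
    linC (E := Unit) μ lam h j (fun i l _ => A i l e) n () := by
  unfold linC
  split_ifs <;> simp only [Pi.sub_apply, Pi.add_apply, Pi.smul_apply, Pi.mul_apply, sh_apply,
    der_apply] <;> rfl

lemma nlC_apply (e : E) : nlC M j A B n e =
    nlC (E := Unit) M j (fun i l _ => A i l e) (fun i l _ => B i l e) n () := by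
  simp only [nlC, Pi.add_apply, sh_apply, conv_apply, der_apply]

lemma fastC_cst : fastC μ lam h M j (fun i l => (cst (f i l) : E → ℝ≥0 → Cyl))
    (fun i l => cst (σ i l)) n = cst (fastP μ lam h M j f σ n) := by
  funext e
  unfold fastP fastC
  exact congrArg₂ (· + ·) (congrArg₂ (· + ·) (congrArg₂ (· + ·) (linC_apply e) (nlC_apply e))
    (nlC_apply e)) (nlC_apply e)

lemma fastP_congr (hM : 1 ≤ M) (hf : ∀ i < n, f i = f' i) (hσ : ∀ i < n, σ i = σ' i) :
    fastP μ lam h M j f σ n = fastP μ lam h M j f' σ' n := by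
  have h1 : ∀ i < n, (fun l => (cst (f i l) : Unit → ℝ≥0 → Cyl)) = fun l => cst (f' i l) :=
    fun i hi => by rw [hf i hi]
  have h2 : ∀ i < n, (fun l => (cst (σ i l) : Unit → ℝ≥0 → Cyl)) = fun l => cst (σ' i l) :=
    fun i hi => by rw [hσ i hi]
  unfold fastP fastC
  rw [linC_congr h1, nlC_congr hM h2 h1, nlC_congr hM h1 h2, nlC_congr hM h1 h1]

variable {ℐ : Set (Set (E × ℝ≥0))} {Δ Δ₁ Δ₂ : Set ℝ}

lemma Reg.sh {m : ℕ} {a : ℕ → E → ℝ≥0 → Cyl} (ha : ∀ i, Reg ℐ Δ (a i)) : Reg ℐ Δ (sh m a n) := by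
  unfold OscFlow.sh
  split_ifs
  · exact ha _
  · exact Reg.zero

lemma Reg.conv {a b : ℕ → E → ℝ≥0 → Cyl} (hΔ : RateMul Δ₁ Δ₂ Δ) (ha : ∀ i, Reg ℐ Δ₁ (a i))
    (hb : ∀ i, Reg ℐ Δ₂ (b i)) : Reg ℐ Δ (conv a b n) := by
  unfold OscFlow.conv
  have := Reg.sum (F := fun p : ℕ × ℕ => a p.1 * b p.2) (ℐ := ℐ) (Δ := Δ)
    (Finset.HasAntidiagonal.antidiagonal n) (fun p _ => Reg.mul hΔ (ha p.1) (hb p.2))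
  convert this using 1
  funext e t θ y
  simp [Finset.sum_apply]

lemma Reg.linC (hA : ∀ i l, Reg ℐ Δ (A i l)) : Reg ℐ Δ (linC μ lam h j A n) := by
  refine Reg.sub (Reg.sub (Reg.thF_mul (Reg.sh fun i => (hA i j).der 2) h) (Reg.sh fun i =>
    Reg.add (Reg.const_mul (((hA i j).der 2).der 2) μ)
      (Reg.const_mul (((hA i (1 - j)).der 2).der 1) lam))) (Reg.const_mul ?_ lam)
  split_ifs
  · exact Reg.sh fun i => ((hA i 0).der 1).der 1
  · exact Reg.sh fun i => ((hA i 1).der 2).der 2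

lemma Reg.nlC (hΔ : RateMul Δ₁ Δ₂ Δ) (hA : ∀ i l, Reg ℐ Δ₁ (A i l)) (hB : ∀ i l, Reg ℐ Δ₂ (B i l)) :
    Reg ℐ Δ (nlC M j A B n) :=
  Reg.add (Reg.sh fun _ => Reg.conv hΔ (fun i => hA i 0) fun i => (hB i j).der 1)
    (Reg.sh fun _ => Reg.conv hΔ (fun i => hA i 1) fun i => (hB i j).der 2)

lemma RateMul.symm (hΔ : RateMul Δ₁ Δ₂ Δ) : RateMul Δ₂ Δ₁ Δ := fun δ hδ => by
  obtain ⟨a, ha, b, hb, hle⟩ := hΔ δ hδ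
  exact ⟨b, hb, a, ha, by linarith⟩

/-- Each term contains a fast factor, and the Taylor coefficients of the slow part grow more slowly
than any exponential; hence every rate below `μ` is kept. -/
lemma Fast.fastP (hμ : 0 < μ) (hf : ∀ i l, Fast μ (f i l)) (hσ : ∀ i l, Grow (σ i l)) :
    Fast μ (fastP μ lam h M j f σ n) := by
  unfold OscFlow.fastP
  exact Reg.add (Reg.add (Reg.add (Reg.linC hf) (Reg.nlC (RateMul.Iio_zero μ) hσ hf))
    (Reg.nlC (RateMul.Iio_zero μ).symm hf hσ)) (Reg.nlC (RateMul.Iio_Iio hμ) hf hf)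

end FastSources

end

end OscFlow

namespace OscFlow

noncomputable section

open Sl

/-! ### Recursive construction of the profiles. -/

section Recursion

/-- Fast profiles. -/
abbrev Fs (μ : ℝ) : Type := {f : ℝ≥0 → Cyl // Fast μ f}

/-- A fast profile as a slow profile. -/
def Fs.sl {μ : ℝ} (f : Fs μ) : Sl := ⟨f.1, f.2.slow⟩

/-- The fixed data of the construction of the profiles. -/
structure Setup where
  μ : ℝ
  lam : ℝ
  h : Cf
  a : Cf
  χ : Cf
  b : Cf
  M : ℕ
  μ_pos : 0 < μ
  two_le_M : 2 ≤ M
  correctors : Correctors μ h a χ b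
  ν_pos : 0 < μ - (χ * h).mean

namespace Setup

variable (P : Setup)

/-- The solution of the fast equation with source `-Q`, with the same oscillating part as `z` at
time `0`. -/
def fastSolve (Q : Fs P.μ) (z : Sl) : Fs P.μ := ⟨fastSol P.μ Q.1 z.1, Q.2.fastSol z.2 P.μ_pos⟩

/-- The solution of the homogenized heat equation with source `S` and the same value at time `0`
as `z`. -/
def heatSolve (S z : Sl) : Sl := ⟨heatSol (P.μ - (P.χ * P.h).mean) S.1 z.1, S.2.heatSol z.2 P.ν_pos⟩

/-- Slow profiles, their means, and fast profiles of some order. -/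
structure Prof where
  s : Fin 2 → Sl
  w : Fin 2 → Sl
  f : Fin 2 → Fs P.μ

instance : Inhabited P.Prof := ⟨⟨0, 0, fun _ => ⟨_, Fast.zero⟩⟩⟩

variable {P} in
/-- The coefficients of the expansion of the slow part. -/
def sigma (p : ℕ → P.Prof) (n : ℕ) (j : Fin 2) : ℝ≥0 → Cyl := sig n fun i => ((p i).s j).1

/-- The source of the fast equation. -/
def fastSrc (p : ℕ → P.Prof) (k : ℕ) (j : Fin 2) : Fs P.μ :=
  ⟨fastP P.μ P.lam P.h P.M j (fun i l => ((p i).f l).1) (sigma p) k,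
    Fast.fastP P.μ_pos (fun i l => ((p i).f l).2) fun n j => grow_sig n fun i => ((p i).s j).2⟩

/-- The corrector of order `k`. -/
def corr (p : ℕ → P.Prof) (k : ℕ) (j : Fin 2) : Sl :=
  corrector P.μ P.lam P.h P.M (fun i => (p i).s) k j

/-- The source of the homogenized equation of order `k`. -/
def slowSrc (p : ℕ → P.Prof) (k : ℕ) (j : Fin 2) : Sl :=
  source P.μ P.lam P.h P.M P.a P.χ P.b (fun i => (p i).s) k j

variable {P}

lemma corr_congr {p p' : ℕ → P.Prof} {k : ℕ} (hp : ∀ i < k, p i = p' i) :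
    P.corr p k = P.corr p' k := by
  funext j
  exact congrFun (corrector_congr (by have := P.two_le_M; omega) fun i hi => by rw [hp i hi]) j

lemma slowSrc_congr {p p' : ℕ → P.Prof} {k : ℕ} (hp : ∀ i < k, p i = p' i) :
    P.slowSrc p k = P.slowSrc p' k := by
  funext j
  exact source_congr (by have := P.two_le_M; omega) (fun i hi => by rw [hp i hi]) j

lemma fastSrc_congr {p p' : ℕ → P.Prof} {k : ℕ} (hp : ∀ i < k, p i = p' i) :
    P.fastSrc p k = P.fastSrc p' k := by
  funext j
  refine Subtype.ext (fastP_congr (by have := P.two_le_M; omega) (fun i hi => by rw [hp i hi])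
    fun i hi => ?_)
  funext l
  exact sig_congr i fun m hm => by rw [hp m (by omega)]

/-- The profiles `r` of order `k` with initial data `z` and the profiles `p` of lower order. -/
structure IsStep (k : ℕ) (z : Fin 2 → Sl) (p : ℕ → P.Prof) (r : P.Prof) : Prop where
  repr_zero : r.s 0 = P.corr p k 0 + r.w 0
  repr_one : r.s 1 = P.corr p k 1 + (r.w 1 + P.a • r.w 0)
  mn_w : ∀ j, mn (r.w j) = r.w j
  heat : ∀ j, di 0 (r.w j) = P.slowSrc p k j + (P.μ - (P.χ * P.h).mean) • di 2 (di 2 (r.w j))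
  init : ∀ j θ y, (r.s j).1 0 θ y + (r.f j).1 0 θ y = (z j).1 0 θ y
  fast_zero : D 0 (r.f 0).1 =
    fun t θ y => P.μ * D 1 (D 1 (r.f 0).1) t θ y - (P.fastSrc p k 0).1 t θ y
  fast_one : D 0 (r.f 1).1 = fun t θ y => P.μ * D 1 (D 1 (r.f 1).1) t θ y -
    ((P.h.d : ℝ → ℝ) θ * (r.f 0).1 t θ y + (P.fastSrc p k 1).1 t θ y)

lemma heatSolve_zero (S z : Sl) : (P.heatSolve S z).1 0 = z.1 0 := heatSol_zero

lemma di_heatSolve (S z : Sl) : di 0 (P.heatSolve S z) =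
    S + (P.μ - (P.χ * P.h).mean) • di 2 (di 2 (P.heatSolve S z)) := by
  ext t θ y
  have := congrFun (congrFun (congrFun (D_t_heatSol S.2 z.2 P.ν_pos) t) θ) y
  rw [di_coe]
  refine this.trans ?_
  show _ = S.1 t θ y + (P.μ - (P.χ * P.h).mean) * (di 2 (di 2 (P.heatSolve S z))).1 t θ y
  rw [di_coe, di_coe]
  rfl

/-- The oscillating parts of `z` and of the fast solution agree at time `0`, so the initial value is
a difference of means; with a source independent of `θ`, the solution is independent of `θ` as well.
-/
lemma mn_heatSolve {S : Sl} (hS : mn S = S) (Q : Fs P.μ) (z : Sl) :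
    mn (P.heatSolve S (z - (P.fastSolve Q z).sl)) = P.heatSolve S (z - (P.fastSolve Q z).sl) := by
  refine mn_of_const (heatSol_theta (mn_theta hS) fun θ θ' y => ?_)
  have h0 : ∀ θ, (z - (P.fastSolve Q z).sl).1 0 θ y = Mn z.1 0 θ y - tail (Mn Q.1) 0 θ y := by
    intro θ
    show z.1 0 θ y - fastSol P.μ Q.1 z.1 0 θ y = _
    rw [fastSol_zero]; ring
  rw [h0, h0, z.2.Mn_theta 0 θ θ']
  simp only [tail, Q.2.slow.Mn_theta _ θ θ']

lemma D_fastSolve (Q : Fs P.μ) (z : Sl) : D 0 (P.fastSolve Q z).1 =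
    fun t θ y => P.μ * D 1 (D 1 (P.fastSolve Q z).1) t θ y - Q.1 t θ y :=
  Q.2.D_t_fastSol z.2 P.μ_pos

/-- The order of choice avoids a loop: the first fast component, then the first mean `w0`, whose
data contain the former; next the second fast component, which needs `h' f0` as a source and `a •
w0` in its data; finally the second mean. -/
lemma exists_isStep (k : ℕ) (z : Fin 2 → Sl) (p : ℕ → P.Prof) : ∃ r, IsStep k z p r := by
  set z0 := z 0 - P.corr p k 0
  set f0 := P.fastSolve (P.fastSrc p k 0) z0
  set w0 := P.heatSolve (P.slowSrc p k 0) (z0 - f0.sl) with hw0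
  set z1 := z 1 - P.corr p k 1 - P.a • w0
  let Q1 : Fs P.μ := ⟨fun t θ y => (P.h.d : ℝ → ℝ) θ * f0.1 t θ y + (P.fastSrc p k 1).1 t θ y,
    Fast.add (Reg.theta_mul f0.2 P.h.d.2) (P.fastSrc p k 1).2⟩
  set f1 := P.fastSolve Q1 z1
  set w1 := P.heatSolve (P.slowSrc p k 1) (z1 - f1.sl) with hw1
  refine ⟨⟨![P.corr p k 0 + w0, P.corr p k 1 + (w1 + P.a • w0)], ![w0, w1], ![f0, f1]⟩,
    rfl, rfl, fun j => ?_, fun j => ?_, fun j θ y => ?_, D_fastSolve _ _, D_fastSolve _ _⟩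
  · fin_cases j
    · exact mn_heatSolve (mn_source _ _ _) _ _
    · exact mn_heatSolve (mn_source _ _ _) _ _
  · fin_cases j
    · exact di_heatSolve _ _
    · exact di_heatSolve _ _
  · fin_cases j
    · have := congrFun (congrFun (heatSolve_zero (P := P) (P.slowSrc p k 0) (z0 - f0.sl)) θ) y
      rw [← hw0] at this
      show (P.corr p k 0).1 0 θ y + w0.1 0 θ y + f0.1 0 θ y = (z 0).1 0 θ y
      rw [this]
      show (P.corr p k 0).1 0 θ y + ((z 0).1 0 θ y - (P.corr p k 0).1 0 θ y - f0.1 0 θ y) +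
        f0.1 0 θ y = (z 0).1 0 θ y
      ring
    · have := congrFun (congrFun (heatSolve_zero (P := P) (P.slowSrc p k 1) (z1 - f1.sl)) θ) y
      rw [← hw1] at this
      show (P.corr p k 1).1 0 θ y + (w1.1 0 θ y + (P.a • w0).1 0 θ y) + f1.1 0 θ y = (z 1).1 0 θ y
      rw [this]
      show (P.corr p k 1).1 0 θ y + ((z 1).1 0 θ y - (P.corr p k 1).1 0 θ y - (P.a • w0).1 0 θ y -
        f1.1 0 θ y + (P.a • w0).1 0 θ y) + f1.1 0 θ y = (z 1).1 0 θ y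
      ring

lemma IsStep.congr {k : ℕ} {z : Fin 2 → Sl} {p p' : ℕ → P.Prof} {r : P.Prof}
    (hr : IsStep k z p r) (hp : ∀ i < k, p i = p' i) : IsStep k z p' r := by
  obtain ⟨h1, h2, h3, h4, h5, h6, h7⟩ := hr
  rw [corr_congr hp] at h1 h2
  rw [slowSrc_congr hp] at h4
  rw [fastSrc_congr hp] at h6 h7
  exact ⟨h1, h2, h3, h4, h5, h6, h7⟩

variable (P) in
/-- The profiles with initial data `z`. -/
def profile (z : ℕ → Fin 2 → Sl) (k : ℕ) : P.Prof :=
  (exists_isStep (P := P) k (z k) fun i => if _ : i < k then profile z i else default).choose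

/-- The recursion fills the orders from `k` on with `default`, which is harmless because a step
depends on lower orders only. -/
lemma isStep_profile (z : ℕ → Fin 2 → Sl) (k : ℕ) : IsStep k (z k) (P.profile z) (P.profile z k) := by
  have h := (exists_isStep (P := P) k (z k) fun i => if _ : i < k then P.profile z i else default).choose_spec
  rw [← profile] at h
  exact h.congr fun i hi => dif_pos hi

lemma homogenized (z : ℕ → Fin 2 → Sl) : Homogenized P.μ P.lam P.h P.M P.a P.χ P.b
    (fun k => (P.profile z k).s) (fun k => (P.profile z k).w) :=
  ⟨fun k => (isStep_profile z k).mn_w, fun k => (isStep_profile z k).repr_zero,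
    fun k => (isStep_profile z k).repr_one, fun k => (isStep_profile z k).heat⟩

end Setup

end Recursion

end

end OscFlow

namespace OscFlow

noncomputable section

open Sl

/-! ### The velocity operator in the fast time. -/

section Evolution

variable {E : Type*} {ℐ ℐ' : Set (Set (E × ℝ≥0))} {Δ Δ' : Set ℝ} {F G : E → ℝ≥0 → Cyl}

lemma Reg.der_add (hF : Reg ℐ Δ F) (hG : Reg ℐ' Δ' G) (d : Fin 3) :
    OscFlow.der d (F + G) = OscFlow.der d F + OscFlow.der d G :=
  ((hF.hasDer d).add (hG.hasDer d)).eq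

lemma der_sum_epsF {ℐ : Set (Set (Eps × ℝ≥0))} {K : ℕ} (d : Fin 3) :
    ∀ {A : ℕ → Fam}, (∀ n, Reg ℐ Δ (A n)) →
    der d (∑ n ∈ Finset.range K, epsF ^ n * A n) = ∑ n ∈ Finset.range K, epsF ^ n * der d (A n) := by
  induction K with
  | zero => exact fun _ => (Der.zero (d := d)).eq
  | succ K ih =>
    intro A hA
    have e : ∀ B : ℕ → Fam, ∑ n ∈ Finset.range (K + 1), epsF ^ n * B n =
        B 0 + epsF * ∑ n ∈ Finset.range K, epsF ^ n * B (n + 1) := fun B => by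
      rw [Finset.sum_range_succ', Finset.mul_sum, pow_zero, one_mul, add_comm]
      congr 1
      exact Finset.sum_congr rfl fun n _ => by ring
    rw [e, e, Expands.der_add_eps_mul d (hA 0)
      (Expands.sum_range fun n _ => hA (n + 1)).reg, ih fun n => hA (n + 1)]

variable (μ lam : ℝ) (h : Cf) (M : ℕ) (j : Fin 2)

/-- The term `h' u_0` of the second equation. -/
def shearOp (h : Cf) (j : Fin 2) (U : Fin 2 → E → ℝ≥0 → Cyl) : E → ℝ≥0 → Cyl :=
  if j = 0 then 0 else thF h.d * U 0

/-- The rescaled velocity operator in the fast time. -/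
def evol (U : Fin 2 → Fam) : Fam :=
  der 0 (U j) + linOp μ lam h j U + nlOp M j U U - μ • der 1 (der 1 (U j)) + shearOp h j U

/-- The part of `evol (U + V)` that involves `V`. -/
def evolDiff (U V : Fin 2 → Fam) : Fam :=
  der 0 (V j) + (linOp μ lam h j V + nlOp M j U V + nlOp M j V U + nlOp M j V V) -
    μ • der 1 (der 1 (V j)) + shearOp h j V

variable {μ lam h M j} {U V : Fin 2 → Fam} {ℐ ℐ' : Set (Set (Eps × ℝ≥0))}

lemma linOp_add (hU : ∀ l, Reg ℐ Δ (U l)) (hV : ∀ l, Reg ℐ' Δ' (V l)) :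
    linOp μ lam h j (U + V) = linOp μ lam h j U + linOp μ lam h j V := by
  have h1 : ∀ d l, der d ((U + V) l) = der d (U l) + der d (V l) := fun d l =>
    (hU l).der_add (hV l) d
  have h2 : ∀ d d' l, der d' (der d ((U + V) l)) = der d' (der d (U l)) + der d' (der d (V l)) :=
    fun d d' l => by rw [h1]; exact ((hU l).der d).der_add ((hV l).der d) d'
  unfold linOp
  simp only [h2]
  rw [h1]
  split_ifs
  · simp only [smul_add, mul_add]; abel
  · simp only [smul_add, mul_add]; abel

lemma nlOp_add (hU : ∀ l, Reg ℐ Δ (U l)) (hV : ∀ l, Reg ℐ' Δ' (V l)) :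
    nlOp M j (U + V) (U + V) = nlOp M j U U + (nlOp M j U V + nlOp M j V U + nlOp M j V V) := by
  have h1 : ∀ d l, der d ((U + V) l) = der d (U l) + der d (V l) := fun d l =>
    (hU l).der_add (hV l) d
  unfold nlOp
  rw [h1, h1, Pi.add_apply, Pi.add_apply]
  ring

lemma shearOp_add (U V : Fin 2 → E → ℝ≥0 → Cyl) : shearOp h j (U + V) = shearOp h j U + shearOp h j V := by
  unfold shearOp
  split_ifs
  · rw [add_zero]
  · rw [Pi.add_apply, mul_add]

lemma evol_add (hU : ∀ l, Reg ℐ Δ (U l)) (hV : ∀ l, Reg ℐ' Δ' (V l)) :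
    evol μ lam h M j (U + V) = evol μ lam h M j U + evolDiff μ lam h M j U V := by
  have h2 : der 1 (der 1 ((U + V) j)) = der 1 (der 1 (U j)) + der 1 (der 1 (V j)) := by
    rw [Pi.add_apply, (hU j).der_add (hV j)]; exact ((hU j).der 1).der_add ((hV j).der 1) 1
  unfold evol evolDiff
  rw [linOp_add hU hV, nlOp_add hU hV, shearOp_add, h2, Pi.add_apply, (hU j).der_add (hV j), smul_add]
  abel

lemma hasDerivWithinAt_rescaled {F : Fam} (hF : Reg ℐ Δ F) (e : Eps) {t : ℝ} (ht : 0 ≤ t) (θ y : ℝ) :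
    HasDerivWithinAt (fun s : ℝ => F e (s / (e : ℝ) ^ 2).toNNReal θ y)
      (((e : ℝ) ^ 2)⁻¹ * der 0 F e (t / (e : ℝ) ^ 2).toNNReal θ y) (Ici 0) t := by
  have hp : 0 < ((e : ℝ) ^ 2)⁻¹ := inv_pos.2 (pow_pos e.2.1 2)
  have h0 := hF.hasDer 0 e (t / (e : ℝ) ^ 2).toNNReal θ y
  have h2 : HasDerivWithinAt (fun s : ℝ => s / (e : ℝ) ^ 2) ((e : ℝ) ^ 2)⁻¹ (Ici 0) t := by
    simpa using (hasDerivWithinAt_id t (Ici 0)).div_const ((e : ℝ) ^ 2)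
  rw [Real.coe_toNNReal _ (div_nonneg ht (sq_nonneg _))] at h0
  exact HasDerivWithinAt.scomp t h0 h2 fun s hs => div_nonneg hs (sq_nonneg _)

/-- Multiplication by `ε²` clears the negative powers: `ε^(M-2)` becomes `ε^M`, and `∂_t` becomes
`∂_τ`. Only polynomials in `ε` remain, to which the expansions apply. -/
lemma La_rescaled (hU : ∀ l, Reg ℐ Δ (U l)) (e : Eps) {t : ℝ} (ht : 0 ≤ t) (θ y : ℝ) :
    La μ lam (h : ℝ → ℝ) M e (fun l s => U l e (s / (e : ℝ) ^ 2).toNNReal) j t θ y =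
      ((e : ℝ) ^ 2)⁻¹ * evol μ lam h M j U e (t / (e : ℝ) ^ 2).toNNReal θ y := by
  have he : (e : ℝ) ≠ 0 := e.2.1.ne'
  have h1 : dT (fun s => U j e (s / (e : ℝ) ^ 2).toNNReal θ y) t = _ :=
    (hasDerivWithinAt_rescaled (hU j) e ht θ y).derivWithin (uniqueDiffOn_Ici 0 _ ht)
  have h2 : (e : ℝ) ^ ((M : ℤ) - 2) = ((e : ℝ) ^ 2)⁻¹ * (e : ℝ) ^ M := by
    rw [zpow_sub₀ he, zpow_natCast, div_eq_inv_mul]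
    rfl
  unfold La
  rw [h1, h2]
  have e1 : ∀ (F : Fam) τ, der 1 F e τ = dTheta (F e τ) := fun _ _ => rfl
  have e2 : ∀ (F : Fam) τ, der 2 F e τ = dY (F e τ) := fun _ _ => rfl
  fin_cases j
  · simp only [evol, linOp, nlOp, shearOp, shearTerm, dissipation, epsF, thF, Pi.add_apply,
      Pi.sub_apply, Pi.mul_apply, Pi.smul_apply, Pi.pow_apply, e1, e2, smul_eq_mul]
    simp [epsF, e1]
    field_simp
    ring
  · simp only [evol, linOp, nlOp, shearOp, shearTerm, dissipation, epsF, thF, Pi.add_apply,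
      Pi.sub_apply, Pi.mul_apply, Pi.smul_apply, Pi.pow_apply, e1, e2, smul_eq_mul]
    simp [epsF, e2, thF, Cf.d]
    field_simp
    ring

end Evolution

end

end OscFlow

namespace OscFlow

noncomputable section

open Sl

/-! ### The slow part of the approximate solution. -/

section SlowPart

/-- `f(ε² t)` for slow profiles `f`. -/
def scalHom : Sl →ₗ[ℝ] Fam where
  toFun f := scal f.1
  map_add' _ _ := rfl
  map_smul' _ _ := rfl

lemma thF_mul_scalHom (c : Cf) (f : Sl) : thF c * scalHom f = scalHom (c • f) := by
  funext e t θ y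
  exact (smul_apply c f _ θ y).symm

lemma der_one_scalHom (f : Sl) : der 1 (scalHom f) = scalHom (di 1 f) := by
  show _ = scal (di 1 f).1
  rw [di_coe]; rfl

lemma der_two_scalHom (f : Sl) : der 2 (scalHom f) = scalHom (di 2 f) := by
  show _ = scal (di 2 f).1
  rw [di_coe]; rfl

lemma der_zero_scalHom (f : Sl) : der 0 (scalHom f) = epsF ^ 2 * scalHom (di 0 f) := by
  show _ = _ * scal (di 0 f).1
  rw [di_coe]; exact f.2.der_scal

lemma sh_scalHom (m n : ℕ) (a : ℕ → Sl) :
    sh m (fun i => scalHom (a i)) n = scalHom (sh m a n) := by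
  unfold sh
  split_ifs
  · rfl
  · exact (map_zero _).symm

lemma conv_scalHom (a b : ℕ → Sl) :
    conv (fun i => scalHom (a i)) (fun i => scalHom (b i)) = fun n => scalHom (conv a b n) := by
  funext n
  unfold conv
  rw [map_sum]
  rfl

lemma smul_scalHom (r : ℝ) (f : Sl) : r • scalHom f = scalHom (r • f) := rfl

lemma add_scalHom (f g : Sl) : scalHom f + scalHom g = scalHom (f + g) := rfl

lemma sub_scalHom (f g : Sl) : scalHom f - scalHom g = scalHom (f - g) := rfl

variable {μ lam : ℝ} {h : Cf} {M n K : ℕ} {j : Fin 2} {v : ℕ → Fin 2 → Sl}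

lemma linC_scalHom : linC μ lam h j (fun i l => scalHom (v i l)) n = scalHom
    (h • sh 1 (fun i => di 2 (v i j)) n -
      sh 2 (fun i => μ • di 2 (di 2 (v i j)) + lam • di 1 (di 2 (v i (1 - j)))) n -
      slowVisc lam j v n) := by
  unfold linC slowVisc
  simp only [der_one_scalHom, der_two_scalHom, smul_scalHom, add_scalHom, sh_scalHom,
    thF_mul_scalHom]
  split_ifs <;> rfl

lemma nlC_scalHom : nlC M j (fun i l => scalHom (v i l)) (fun i l => scalHom (v i l)) n =
    scalHom (slowNL M j v n) := by
  unfold nlC slowNL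
  simp only [der_one_scalHom, der_two_scalHom, add_scalHom, sh_scalHom, conv_scalHom]

lemma shearOp_scalHom : shearOp h j (fun l => scalHom (v n l)) =
    scalHom (if j = 0 then 0 else h.d • v n 0) := by
  unfold shearOp
  split_ifs
  · exact (map_zero _).symm
  · exact thF_mul_scalHom _ _

lemma sh_sub_sub {A : Type*} [NonUnitalNonAssocRing A] (m n : ℕ) (a b c : ℕ → A) :
    sh m (fun i => a i - b i - c i) n = sh m a n - sh m (fun i => b i + c i) n := by
  unfold sh
  split_ifs
  · exact sub_sub _ _ _
  · simp

/-- The coefficients of `evol` on slow profiles vanish by the equations for the slow profiles. -/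
lemma SlowEq.coef_eq_zero (hv : SlowEq μ lam h M v n) (j : Fin 2) :
    sh 2 (fun i => scalHom (di 0 (v i j))) n + linC μ lam h j (fun i l => scalHom (v i l)) n +
      nlC M j (fun i l => scalHom (v i l)) (fun i l => scalHom (v i l)) n -
      μ • der 1 (der 1 (scalHom (v n j))) + shearOp h j (fun l => scalHom (v n l)) = 0 := by
  have key : μ • di 1 (di 1 (v n j)) = (if j = 0 then 0 else h.d • v n 0) + slowR μ lam h M j v n := by
    fin_cases j
    · exact hv.1.trans (zero_add _).symm
    · exact hv.2
  rw [linC_scalHom, nlC_scalHom, shearOp_scalHom, sh_scalHom, der_one_scalHom, der_one_scalHom,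
    smul_scalHom, add_scalHom, add_scalHom, sub_scalHom, add_scalHom, key, slowR, sh_sub_sub,
    ← map_zero scalHom]
  congr 1
  abel

lemma rateMul_zero : RateMul {0} {0} {0} := fun δ hδ =>
  ⟨0, rfl, 0, rfl, by simp [mem_singleton_iff.1 hδ]⟩

lemma Expands.shearOp {ℐ : Set (Set (Eps × ℝ≥0))} {Δ : Set ℝ} {U : Fin 2 → Fam}
    {A : ℕ → Fin 2 → Fam} (hU : ∀ l, Expands ℐ Δ K (U l) (fun n => A n l)) (j : Fin 2) :
    Expands ℐ Δ K (shearOp h j U) (fun n => shearOp h j (A n)) := by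
  unfold OscFlow.shearOp
  split_ifs
  · exact Expands.zero
  · exact (hU 0).thF_mul h.d

/-- `∑ ε^n v_n(ε² t)`. -/
def slowFam (K : ℕ) (v : ℕ → Fin 2 → Sl) (j : Fin 2) : Fam :=
  ∑ n ∈ Finset.range K, epsF ^ n * scalHom (v n j)

lemma expands_slowFam (l : Fin 2) :
    Expands slowI {0} K (slowFam K v l) (fun n => scalHom (v n l)) :=
  Expands.sum_range fun n _ => (v n l).2.scal

/-- The chain rule moves `∂_t v_n` two orders up, which is the shift `sh 2` in the slow equations.
The coefficients below `K` then vanish, with bounds uniform on `ε² τ ≤ T`. -/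
lemma evol_slowFam (hv : ∀ n, SlowEq μ lam h M v n) (j : Fin 2) :
    ∃ R, Reg slowI {0} R ∧ evol μ lam h M j (slowFam K v) = epsF ^ K * R := by
  have hT : Expands slowI {0} K (der 0 (slowFam K v j)) (sh 2 fun n => scalHom (di 0 (v n j))) := by
    have e : der 0 (slowFam K v j) =
        epsF ^ 2 * ∑ n ∈ Finset.range K, epsF ^ n * scalHom (di 0 (v n j)) := by
      unfold slowFam
      rw [der_sum_epsF (A := fun n => scalHom (v n j)) 0 (fun n => (v n j).2.scal), Finset.mul_sum]
      exact Finset.sum_congr rfl fun n _ => by rw [der_zero_scalHom]; ring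
    rw [e]
    exact (Expands.sum_range fun n _ => (di 0 (v n j)).2.scal).pow_mul 2
  exact ((((hT.add (Expands.linOp expands_slowFam j)).add
    (Expands.nlOp rateMul_zero expands_slowFam expands_slowFam j)).sub
    ((((expands_slowFam j).der 1).der 1).const_mul μ)).add
    (Expands.shearOp expands_slowFam j)).eq_pow_mul fun n _ => (hv n).coef_eq_zero j

end SlowPart

/-! ### The fast part and its interaction with the slow part. -/

section FastPart

variable {μ lam : ℝ} {h : Cf} {M n K : ℕ} {j : Fin 2} {v : ℕ → Fin 2 → Sl}
  {f : ℕ → Fin 2 → ℝ≥0 → Cyl}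

/-- `∑ ε^n f_n(t)`. -/
def fastFam (K : ℕ) (f : ℕ → Fin 2 → ℝ≥0 → Cyl) (j : Fin 2) : Fam :=
  ∑ n ∈ Finset.range K, epsF ^ n * cst (f n j)

lemma expands_fastFam (hf : ∀ n l, Fast μ (f n l)) (l : Fin 2) :
    Expands slowI (Iio μ) K (fastFam K f l) (fun n => cst (f n l)) :=
  Expands.sum_range fun n _ => Reg.cst (hf n l)

/-- The equations of order `n` for the fast profiles `f`, where `σ` are the coefficients of the
slow part. -/
def FastEq (μ lam : ℝ) (h : Cf) (M : ℕ) (f σ : ℕ → Fin 2 → ℝ≥0 → Cyl) (n : ℕ) : Prop :=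
  ∀ j, D 0 (f n j) + fastP μ lam h M j f σ n - μ • D 1 (D 1 (f n j)) +
    (if j = 0 then 0 else fun t θ y => (h.d : ℝ → ℝ) θ * f n 0 t θ y) = 0

/-- Next to a fast factor, the slow part is expanded at `τ = 0` in the class of slow growth, while
the fast part decays. The coefficients of the products decay and vanish by the fast equations, and
the remainder decays as well. -/
lemma evolDiff_fastFam (hμ : 0 < μ) (hf : ∀ n l, Fast μ (f n l))
    (he : ∀ n, FastEq μ lam h M f (fun n l => sig n fun i => (v i l).1) n) (j : Fin 2) :
    ∃ R, Reg slowI (Iio μ) R ∧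
      evolDiff μ lam h M j (slowFam K v) (fastFam K f) = epsF ^ K * R := by
  have hF := expands_fastFam (K := K) hf
  have hS : ∀ l, Expands slowI (Iio 0) K (slowFam K v l) (fun n => cst (sig n fun i => (v i l).1)) :=
    fun l => expands_sum_scal K fun i => (v i l).2
  refine (((((hF j).der 0).add ((((Expands.linOp hF j).add
    (Expands.nlOp (RateMul.Iio_zero μ) hS hF j)).add
    (Expands.nlOp (RateMul.Iio_zero μ).symm hF hS j)).add
    (Expands.nlOp (RateMul.Iio_Iio hμ) hF hF j))).sub
    ((((hF j).der 1).der 1).const_mul μ)).add (Expands.shearOp hF j)).eq_pow_mul fun n _ => ?_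
  have h1 := fastC_cst (E := Eps) (μ := μ) (lam := lam) (h := h) (M := M) (n := n) (j := j) (f := f)
    (σ := fun n l => sig n fun i => (v i l).1)
  rw [fastC] at h1
  rw [h1]
  funext e
  have h2 : OscFlow.shearOp h j (fun l => cst (f n l) : Fin 2 → Fam) e =
      if j = 0 then 0 else fun t θ y => (h.d : ℝ → ℝ) θ * f n 0 t θ y := by
    unfold OscFlow.shearOp
    split_ifs <;> rfl
  refine Eq.trans ?_ (he n j)
  rw [← h2]
  have h3 : ∀ d a, der d (cst a : Fam) = cst (D d a) := fun d a => funext fun e => der_apply d _ e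
  rw [h3, h3, h3]
  rfl

end FastPart

end

end OscFlow

namespace OscFlow

noncomputable section

open Sl

/-! ### Norms in the original time. -/

section Norms

variable {μ δ : ℝ} {f : ℝ≥0 → Cyl}

lemma Fast.memE (h : Fast μ f) (hδ : δ < μ) : MemE δ (fun t => f t.toNNReal) := by
  refine ⟨fun t _ => h.slow.memHInf _, fun m => ?_⟩
  obtain ⟨g, hg, hb⟩ := Reg.dMulti_maj h (I := univ) rfl hδ m
  refine lt_of_le_of_lt (iSup₂_le fun t (ht : 0 ≤ t) => ?_) (hg.majNorm_lt_top m)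
  have h1 := hNorm_le hg (Real.exp_pos (-(δ * t.toNNReal))).le fun a ha b hb' θ y =>
    hb a ha b hb' () t.toNNReal (mem_univ _) θ y
  rw [Real.coe_toNNReal _ ht] at h1
  calc _ ≤ ENNReal.ofReal (Real.exp (δ * t)) *
        (ENNReal.ofReal (Real.exp (-(δ * t))) * majNorm m g) := by gcongr
    _ = majNorm m g := by
      rw [← mul_assoc, ← ENNReal.ofReal_mul (Real.exp_pos _).le, ← Real.exp_add, add_neg_cancel,
        Real.exp_zero, ENNReal.ofReal_one, one_mul]

lemma Slow.comp_mul (h : Slow f) (c : ℝ≥0) : Slow (fun t => f (c * t)) := by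
  refine Reg.rescale h (fun _ => c) (C := c) (fun _ => le_rfl) ?_
  rintro _ ⟨T, rfl⟩ _ rfl
  exact ⟨_, ⟨c * T, rfl⟩, 0, rfl, 1, zero_le_one, fun e t ht => ⟨mul_le_mul_right ht c, by simp⟩⟩

/-- The fast time `t / ε²`. -/
lemma toNNReal_div_sq (e : Eps) (t : ℝ) :
    (t / (e : ℝ) ^ 2).toNNReal = (sq e)⁻¹ * t.toNNReal := by
  rw [div_eq_inv_mul, Real.toNNReal_mul (inv_nonneg.2 (sq_nonneg _)), Real.toNNReal_inv]
  congr 2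
  exact Real.toNNReal_of_nonneg (sq_nonneg _)

lemma sq_ne_zero' (e : Eps) : sq e ≠ 0 := fun h => by
  have : ((sq e : ℝ≥0) : ℝ) = 0 := by rw [h]; rfl
  exact (pow_pos e.2.1 2).ne' this

lemma sq_mul_toNNReal_div (e : Eps) (t : ℝ) : sq e * (t / (e : ℝ) ^ 2).toNNReal = t.toNNReal := by
  rw [toNNReal_div_sq, mul_inv_cancel_left₀ (sq_ne_zero' e)]

variable {Δ : Set ℝ} {R : Fam}

lemma Reg.memHT_rescaled (hR : Reg slowI {0} R) (e : Eps) (c : ℝ) (T : ℝ) :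
    MemHT 0 T (fun t θ y => c * R e (t / (e : ℝ) ^ 2).toNNReal θ y) := by
  have h := ((hR.slow_slice (singleton_nonempty 0) e).const_mul c).comp_mul (sq e)⁻¹
  simp only [toNNReal_div_sq]
  exact h.memHT 0 T

/-- In the fast time, `t ≤ T` reads `ε² τ ≤ T`, which is one of the sets of `slowI`; the majorant
attached to it does not depend on `ε`. -/
lemma Reg.exists_hNorm_le (hR : Reg slowI {0} R) (T : ℝ) (m : ℕ) : ∃ C < ⊤, ∀ (e : Eps),
    ∀ t ∈ Icc 0 T, hNorm m (R e (t / (e : ℝ) ^ 2).toNNReal) ≤ C := by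
  obtain ⟨g, hg, hb⟩ := hR.dMulti_maj (I := {p | sq p.1 * p.2 ≤ T.toNNReal}) ⟨_, rfl⟩
    (mem_singleton 0) m
  refine ⟨majNorm m g, hg.majNorm_lt_top m, fun e t ht => ?_⟩
  have h1 := hNorm_le hg zero_le_one fun a ha b hb' θ y => by
    have := hb a ha b hb' e (t / (e : ℝ) ^ 2).toNNReal (by
      rw [mem_ofPred_eq, sq_mul_toNNReal_div]
      exact Real.toNNReal_le_toNNReal ht.2) θ y
    rwa [zero_mul, neg_zero, Real.exp_zero] at this
  rwa [ENNReal.ofReal_one, one_mul] at h1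

lemma memHT_of_eqOn {n : ℕ∞} {T : ℝ} {f g : ℝ → Cyl} (h : MemHT n T f)
    (hfg : ∀ t ∈ Icc 0 T, f t = g t) : MemHT n T g := by
  obtain ⟨F, h0, h1⟩ := h
  exact ⟨F, fun t ht => (h0 t ht).trans (hfg t ht), h1⟩

end Norms

/-! ### The approximate solution and the homogenized equations. -/

section Assembly

namespace Setup

variable {P : Setup} (z : ℕ → Fin 2 → Sl)

lemma slowEq (n : ℕ) : SlowEq P.μ P.lam P.h P.M (fun k => (P.profile z k).s) n :=
  (homogenized z).slowEq P.correctors P.μ_pos.ne' P.two_le_M n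

lemma fastEq (n : ℕ) : FastEq P.μ P.lam P.h P.M (fun k l => ((P.profile z k).f l).1)
    (fun n l => sig n fun i => ((P.profile z i).s l).1) n := by
  intro j
  have hs := isStep_profile (P := P) z n
  funext t θ y
  fin_cases j
  · have := congrFun (congrFun (congrFun hs.fast_zero t) θ) y
    show D 0 ((P.profile z n).f 0).1 t θ y + (P.fastSrc (P.profile z) n 0).1 t θ y -
      P.μ * D 1 (D 1 ((P.profile z n).f 0).1) t θ y + 0 = 0
    rw [this]; ring
  · have := congrFun (congrFun (congrFun hs.fast_one t) θ) y
    show D 0 ((P.profile z n).f 1).1 t θ y + (P.fastSrc (P.profile z) n 1).1 t θ y -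
      P.μ * D 1 (D 1 ((P.profile z n).f 1).1) t θ y +
      (P.h.d : ℝ → ℝ) θ * ((P.profile z n).f 0).1 t θ y = 0
    rw [this]; ring

variable (P) in
/-- The slow profiles as functions of real time. -/
def vs (k : ℕ) (j : Fin 2) : ℝ → Cyl := fun t => ((P.profile z k).s j).1 t.toNNReal

variable (P) in
/-- The fast profiles as functions of real time. -/
def vf (k : ℕ) (j : Fin 2) : ℝ → Cyl := fun t => ((P.profile z k).f j).1 t.toNNReal

lemma approxVelocity_eq (N : ℕ) (e : Eps) : approxVelocity N (P.vs z) (P.vf z) e =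
    fun j t => (slowFam (N + 2) (fun k => (P.profile z k).s) +
      fastFam (N + 2) fun k l => ((P.profile z k).f l).1) j e (t / (e : ℝ) ^ 2).toNNReal := by
  funext j t θ y
  simp only [Pi.add_apply, slowFam, fastFam, Finset.sum_apply, ← Finset.sum_add_distrib,
    approxVelocity]
  refine Finset.sum_congr rfl fun k _ => ?_
  have h1 : scalHom ((P.profile z k).s j) e (t / (e : ℝ) ^ 2).toNNReal θ y = P.vs z k j t θ y := by
    show ((P.profile z k).s j).1 (sq e * (t / (e : ℝ) ^ 2).toNNReal) θ y = _
    rw [sq_mul_toNNReal_div]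
    rfl
  show _ = (e : ℝ) ^ k * scalHom ((P.profile z k).s j) e (t / (e : ℝ) ^ 2).toNNReal θ y +
    (e : ℝ) ^ k * P.vf z k j (t / (e : ℝ) ^ 2) θ y
  rw [h1, mul_add]

/-- The approximate solution solves the equations up to `O(ε^N)`. -/
lemma exists_remainder (N : ℕ) (j : Fin 2) : ∃ R : Fam, Reg slowI {0} R ∧
    ∀ (e : Eps) (t : ℝ), 0 ≤ t →
      La P.μ P.lam P.h P.M e (approxVelocity N (P.vs z) (P.vf z) e) j t =
        fun θ y => (e : ℝ) ^ N * R e (t / (e : ℝ) ^ 2).toNNReal θ y := by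
  have hf : ∀ n l, Fast P.μ ((P.profile z n).f l).1 := fun n l => ((P.profile z n).f l).2
  -- The orders up to `N + 1` give an error of order `ε^(N+2)`, which pays for the factor `ε⁻²` of
  -- the rescaling.
  obtain ⟨R₁, hR₁, h₁⟩ := evol_slowFam (K := N + 2) (slowEq (P := P) z) j
  obtain ⟨R₂, hR₂, h₂⟩ := evolDiff_fastFam (K := N + 2) P.μ_pos hf (fastEq (P := P) z) j
  have hS : ∀ l, Reg slowI {0} (slowFam (N + 2) (fun k => (P.profile z k).s) l) := fun l =>
    (expands_slowFam l).reg
  have hF : ∀ l, Reg slowI {0} (fastFam (N + 2) (fun k l => ((P.profile z k).f l).1) l) := fun l =>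
    (expands_fastFam hf l).reg.slow_of_fast P.μ_pos
  refine ⟨R₁ + R₂, hR₁.add (hR₂.slow_of_fast P.μ_pos), fun e t ht => ?_⟩
  funext θ y
  rw [approxVelocity_eq, La_rescaled (U := _ + _) (fun l => (hS l).add (hF l)) e ht, evol_add hS hF, h₁, h₂]
  have he : (e : ℝ) ≠ 0 := e.2.1.ne'
  show ((e : ℝ) ^ 2)⁻¹ * ((e : ℝ) ^ (N + 2) * R₁ e (t / (e : ℝ) ^ 2).toNNReal θ y +
    (e : ℝ) ^ (N + 2) * R₂ e (t / (e : ℝ) ^ 2).toNNReal θ y) =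
      (e : ℝ) ^ N * (R₁ e (t / (e : ℝ) ^ 2).toNNReal θ y + R₂ e (t / (e : ℝ) ^ 2).toNNReal θ y)
  field_simp
  ring

lemma memHT_La (N : ℕ) (T : ℝ) (e : Eps) (j : Fin 2) :
    MemHT 0 T (La P.μ P.lam P.h P.M e (approxVelocity N (P.vs z) (P.vf z) e) j) := by
  obtain ⟨R, hR, h⟩ := exists_remainder (P := P) z N j
  exact memHT_of_eqOn (hR.memHT_rescaled e ((e : ℝ) ^ N) T) fun t ht => (h e t ht.1).symm

lemma iSup_La_lt_top (N m : ℕ) (T : ℝ) :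
    (⨆ ε ∈ Ioc (0 : ℝ) 1, ⨆ t ∈ Icc (0 : ℝ) T, ⨆ j : Fin 2, hNorm m (fun θ y =>
      (ε ^ N)⁻¹ * La P.μ P.lam P.h P.M ε (approxVelocity N (P.vs z) (P.vf z) ε) j t θ y)) < ⊤ := by
  choose R hR h using exists_remainder (P := P) z N
  choose C hC hb using fun j => (hR j).exists_hNorm_le T m
  refine lt_of_le_of_lt (iSup₂_le fun ε hε => iSup₂_le fun t ht => iSup_le fun j => ?_)
    (ENNReal.sum_lt_top.2 fun j (_ : j ∈ Finset.univ) => hC j)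
  refine le_trans ?_ (Finset.single_le_sum (fun _ _ => zero_le) (Finset.mem_univ j))
  have he : ε ^ N ≠ 0 := pow_ne_zero _ hε.1.ne'
  have := hb j ⟨ε, hε⟩ t ht
  refine le_of_eq_of_le (congrArg _ ?_) this
  funext θ y
  rw [show La P.μ P.lam P.h P.M ε (approxVelocity N (P.vs z) (P.vf z) ε) j t = _ from
    h j ⟨ε, hε⟩ t ht.1, inv_mul_cancel_left₀ he]

lemma approxVelocity_zero (N : ℕ) (ε : ℝ) (j : Fin 2) (θ y : ℝ) :
    approxVelocity N (P.vs z) (P.vf z) ε j 0 θ y =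
      ∑ k ∈ Finset.range (N + 2), ε ^ k * (z k j).1 0 θ y := by
  refine Finset.sum_congr rfl fun k _ => ?_
  rw [← (isStep_profile (P := P) z k).init j θ y]
  simp [vs, vf]

lemma mean_vs (k : ℕ) (j : Fin 2) (t : ℝ) (θ : ℝ) :
    mean (P.vs z k j t) = ((P.profile z k).w j).1 t.toNNReal θ := by
  funext y
  rw [← (homogenized z).mn_eq P.correctors k j, mn_coe]
  exact ((P.profile z k).s j).2.Mn_apply _ _ _ |>.symm

/-- The source terms of the homogenized equations as functions of the slow profiles. -/
def sourceMap (P : Setup) (k : ℕ) (c : Fin k → Fin 2 → ℝ≥0 → Cyl) (j : Fin 2) : ℝ≥0 → ℝ → ℝ :=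
  open Classical in
  fun t y => if hc : ∀ i l, Slow (c i l) then
    (source P.μ P.lam P.h P.M P.a P.χ P.b
      (fun i l => if hi : i < k then ⟨c ⟨i, hi⟩ l, hc _ _⟩ else 0) k j).1 t 0 y else 0

lemma sourceMap_vs (k : ℕ) (j : Fin 2) :
    P.sourceMap k (fun i l t => P.vs z i l t) j =
      fun t y => (P.slowSrc (P.profile z) k j).1 t 0 y := by
  have h0 : (fun (i : Fin k) l (t : ℝ≥0) => P.vs z i l t) =
      fun (i : Fin k) l => ((P.profile z i).s l).1 := by
    funext i l t
    rw [vs, Real.toNNReal_coe]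
  funext t y
  have h1 : ∀ (i : Fin k) l, Slow ((P.profile z i).s l).1 := fun i l => ((P.profile z i).s l).2
  rw [h0, sourceMap, dif_pos h1, slowSrc]
  -- The zeros put in place of the profiles from order `k` on are not seen by the source.
  rw [source_congr (by have := P.two_le_M; omega) fun i hi => ?_]
  funext l
  rw [dif_pos hi]

lemma solvesHeat (k : ℕ) (j : Fin 2) : SolvesHeat (P.μ - (P.χ * P.h).mean)
    (P.sourceMap k (fun i l t => P.vs z i l t) j) (fun t => mean (P.vs z k j t)) := by
  intro t y
  have h1 := (isStep_profile (P := P) z k).heat j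
  have h2 : D 0 ((P.profile z k).w j).1 t 0 y = (P.slowSrc (P.profile z) k j).1 t 0 y +
      (P.μ - (P.χ * P.h).mean) * D 2 (D 2 ((P.profile z k).w j).1) t 0 y := by
    rw [← di_coe, ← di_coe, ← di_coe, h1]
    rfl
  rw [sourceMap_vs]
  simp only [mean_vs z k j _ 0, Real.toNNReal_coe]
  refine sub_eq_of_eq_add ?_
  exact h2

lemma memHT_mean (n : ℕ∞) (k : ℕ) (j : Fin 2) (T : ℝ) :
    MemHT n T (fun t _ y => mean (P.vs z k j t) y) := by
  have : (fun t _ y => mean (P.vs z k j t) y) =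
      fun t : ℝ => ((P.profile z k).w j).1 t.toNNReal := by
    funext t θ
    exact mean_vs z k j t θ
  rw [this]
  exact ((P.profile z k).w j).2.memHT n T

end Setup

end Assembly

/-! ### Correctors, enhanced viscosity and initial data. -/

section Data

/-- The correctors of a smooth shear flow `h` of mean zero. -/
lemma exists_correctors {μ : ℝ} (hμ : μ ≠ 0) {h : Cf} (hh : h.mean = 0) :
    Correctors μ h (μ⁻¹ • h.prim) (μ⁻¹ • h.prim.prim) (μ⁻¹ • (μ⁻¹ • h.prim.prim * h).prim) where
  mean_h := hh
  mean_a := by rw [Cf.mean_smul, Cf.mean_prim, mul_zero]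
  d_a := by rw [Cf.d_smul, smul_inv_smul₀ hμ, Cf.d_prim, hh, zero_smul, sub_zero]
  d_χ := by rw [Cf.d_smul, Cf.d_prim, Cf.mean_prim, zero_smul, sub_zero]
  d_b := by rw [Cf.d_smul, smul_inv_smul₀ hμ, Cf.d_prim]

lemma enhancedViscosity_eq {μ : ℝ} (hμ : μ ≠ 0) {h : Cf} (hh : h.mean = 0) :
    enhancedViscosity μ h = μ - (μ⁻¹ • h.prim.prim * h).mean := by
  have h1 : ((h.prim : Cf) : ℝ → ℝ) = primitive h := by
    show primitive ((h - h.mean • 1 : Cf) : ℝ → ℝ) = _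
    rw [hh, zero_smul, sub_zero]
  have h2 : (h.prim * h.prim).mean = ∫ θ in (0 : ℝ)..1, primitive h θ ^ 2 := by
    show ∫ θ in (0 : ℝ)..1, (h.prim : ℝ → ℝ) θ * (h.prim : ℝ → ℝ) θ = _
    simp only [h1, pow_two]
  rw [(exists_correctors hμ hh).mean_χ_mul_h, smul_mul_smul_comm, Cf.mean_smul, h2, enhancedViscosity]
  field_simp
  ring

lemma enhancedViscosity_pos {μ : ℝ} (hμ : 0 < μ) (h : ℝ → ℝ) : 0 < enhancedViscosity μ h :=
  add_pos_of_pos_of_nonneg hμ (mul_nonneg (inv_nonneg.2 hμ.le)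
    (intervalIntegral.integral_nonneg zero_le_one fun _ _ => sq_nonneg _))

/-- Initial data as slow profiles. -/
def dataSl (u : Cyl) : Sl := open Classical in if hu : MemHInf u then ⟨fun _ => u, hu.slow⟩ else 0

lemma dataSl_apply {u : Cyl} (hu : MemHInf u) (t : ℝ≥0) (θ y : ℝ) : (dataSl u).1 t θ y = u θ y := by
  rw [dataSl, dif_pos hu]

end Data

end

end OscFlow

theorem mainTheorem2 (μ lam : ℝ) (hμ : 0 < μ) (hlam : 0 < lam)
    (h : ℝ → ℝ) (hper : Function.Periodic h 1) (hsmooth : ContDiff ℝ ∞ h)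
    (hmean : ∫ θ in (0 : ℝ)..1, h θ = 0) (M : ℕ) (hM : 2 ≤ M) :
    -- `S k` computes the source of order `k` from the slow profiles of order `< k` on `[0, ∞[`;
    -- it is the same for all `N`, `δ` and all initial data
    ∃ S : (k : ℕ) → (Fin k → Fin 2 → ℝ≥0 → Cyl) → Fin 2 → ℝ≥0 → ℝ → ℝ,
    ∀ (N : ℕ) (δ : ℝ), 0 < δ → δ < μ →
    ∀ v0 : ℕ → Fin 2 → Cyl, (∀ k ≤ N + 1, ∀ j, MemHInf (v0 k j)) →
    ∃ vs vf : ℕ → Fin 2 → ℝ → Cyl,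
      -- regularity and decay of the profiles
      (∀ k ≤ N + 1, ∀ j,
        (∀ T > 0, MemHT ⊤ T (vs k j)) ∧
        MemE δ (vf k j) ∧ (∀ T > 0, MemHT 1 T (vf k j))) ∧
      -- initial data
      (∀ ε ∈ Ioc (0 : ℝ) 1, ∀ j θ y,
        approxVelocity N vs vf ε j 0 θ y = ∑ k ∈ Finset.range (N + 2), ε ^ k * v0 k j θ y) ∧
      -- approximate solution up to `O(ε^N)`
      (∀ T > 0,
        (∀ ε ∈ Ioc (0 : ℝ) 1, ∀ j,
          MemHT 0 T (La μ lam h M ε (approxVelocity N vs vf ε) j)) ∧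
        ∀ m : ℕ,
          (⨆ ε ∈ Ioc (0 : ℝ) 1, ⨆ t ∈ Icc (0 : ℝ) T, ⨆ j : Fin 2,
            hNorm m (fun θ y =>
              (ε ^ N)⁻¹ * La μ lam h M ε (approxVelocity N vs vf ε) j t θ y)) < ⊤) ∧
      -- the means of the slow profiles are determined by the homogenized equation
      (∀ k ≤ N + 1, ∀ j,
        SolvesHeat (enhancedViscosity μ h)
          (S k (fun i c t => vs i c t) j) (fun t => mean (vs k j t)) ∧
        ∀ w : ℝ → ℝ → ℝ, (∀ T > 0, MemHT 1 T (fun t _ y => w t y)) →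
          w 0 = mean (vs k j 0) →
          SolvesHeat (enhancedViscosity μ h) (S k (fun i c t => vs i c t) j) w →
          ∀ t, 0 ≤ t → w t = mean (vs k j t)) := by
  let c : Cf := ⟨h, hsmooth, hper⟩
  have hc : c.mean = 0 := hmean
  have hν := enhancedViscosity_pos hμ h
  have hν' : enhancedViscosity μ h = _ := enhancedViscosity_eq (h := c) hμ.ne' hc
  rw [hν'] at hν ⊢
  let P : Setup := ⟨μ, lam, c, _, _, _, M, hμ, hM, exists_correctors hμ.ne' hc, hν⟩
  refine ⟨P.sourceMap, fun N δ _ hδ v0 hv0 => ?_⟩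
  -- The recursion runs over all orders. Beyond `N + 1` the data may fail to be in `H^∞` and are
  -- then replaced by zero, which does not affect the finite sums.
  let z : ℕ → Fin 2 → Sl := fun k j => dataSl (v0 k j)
  refine ⟨P.vs z, P.vf z, fun k _ j => ⟨fun T _ => ((P.profile z k).s j).2.memHT ⊤ T,
    ((P.profile z k).f j).2.memE hδ, fun T _ => ((P.profile z k).f j).2.slow.memHT 1 T⟩,
    fun ε _ j θ y => ?_, fun T _ => ⟨fun ε hε j => Setup.memHT_La (P := P) z N T ⟨ε, hε⟩ j,
      fun m => Setup.iSup_La_lt_top (P := P) z N m T⟩,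
    fun k _ j => ⟨Setup.solvesHeat z k j, fun w hw h0 hS t ht => hS.unique hν hw
      (fun T _ => Setup.memHT_mean z 1 k j T) h0 (Setup.solvesHeat z k j) t ht⟩⟩
  rw [Setup.approxVelocity_zero]
  refine Finset.sum_congr rfl fun k hk => ?_
  rw [dataSl_apply (hv0 k (by have := Finset.mem_range.1 hk; omega) j)]
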